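/- Let $S$ be a connected compact oriented surface with non-empty boundary, let $M\subset\partial S$ be a finite set of marked points meeting every boundary component, and let $T$ be a triangulation of $(S,M)$ by arcs between marked points, that is, a decomposition of $S$ into triangles whose set of vertices is $M$ and whose sides are the arcs of $T$ and the boundary segments. Assume that $(S,M)$ is not a disc with at most $4$ marked points; equivalently, $T$ has at least two arcs. A triangle is internal if none of its sides is a boundary segment. A cut $(S,M^\dagger,T^\dagger)$ of $(S,M,T)$ is obtained by choosing some of the internal triangles and, in each chosen triangle, one angle, formed at a vertex $v$ by two sides $\alpha,\beta$; at each of these angles one performs the local cut $\chi_{v,\alpha,\beta}$: the point $v$ is replaced by two points $v',v''$ close to it on the boundary, so that the triangle becomes a quasi-triangle, that is, a quadrilateral having the new boundary segment between $v'$ and $v''$ as a side between $\alpha$ and $\beta$. Several chosen angles may lie at the same point of $M$. The internal triangles of $T^\dagger$ are the internal triangles of $T$ that have not been cut. Let $k$ be a field. The surface algebra $B=B_{T^\dagger}=kQ_{T^\dagger}/I_{T^\dagger}$ is given by the following bound quiver: the vertices of $Q_{T^\dagger}$ are the arcs of $T^\dagger$; there is one arrow $\tau\to\tau'$ for each triangle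 or quasi-triangle of $T^\dagger$ and each pair of its sides $\tau,\tau'$ that are arcs and such that $\tau'$ immediately follows $\tau$ in the counterclockwise order of the sides; and $I_{T^\dagger}$ is generated by all paths $\tau\to\tau'\to\tau''$ whose two arrows come from the same triangle or quasi-triangle. Let $\mathrm{AG}(B)\colon\mathbb N^2\to\mathbb N$ be the Avella-Alaminos–Geiss invariant of $(Q_{T^\dagger},I_{T^\dagger})$, where $\mathrm{AG}(B)(n,m)$ is the number of times that the ordered pair $(n,m)$ is formed by the Avella-Alaminos–Geiss algorithm. For a boundary component $C$ of $S$, let $M_{C,T}$ be the set of marked points of $M$ on $C$ that are incident to at least one arc of $T$, let $n(C,T)=|M_{C,T}|$, let $m(C,T)$ be the number of boundary segments of $(S,M)$ on $C$ that have both endpoints in $M_{C,T}$, and let $\ell(C)$ be the number of local cuts $\chi_{v,\alpha,\beta}$ in the cut such that $v$ is a point on $C$. Then sign functions $\sigma,\varepsilon$ as required by the algorithm exist, and for every choice of them: (a) The ordered pairs $(0,3)$ in $\mathrm{AG}(B)$ are in bijection with the internal triangles of $T^\dagger$, that is, $\mathrm{AG}(B)(0,3)$ is their number; and $\mathrm{AG}(B)(0,m)=0$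 for all $m\neq 3$. (b) The ordered pairs $(n,m)$ in $\mathrm{AG}(B)$ with $n\neq0$ are in bijection with the boundary components $C$ of $S$, where the pair corresponding to $C$ is $$n=n(C,T)+\ell(C),\qquad m=m(C,T)+2\,\ell(C);$$ that is, for all $n\neq 0$ and all $m$, $\mathrm{AG}(B)(n,m)$ is the number of boundary components $C$ with $(n,m)=(n(C,T)+\ell(C),\,m(C,T)+2\ell(C))$. -/

import Mathlib

namespace SurfaceAlgebra

noncomputable section

/-! ### Quivers, path algebras and bound quivers -/

/-- A quiver `Q = (Q₀, Q₁, s, t)` with vertex set `V = Q₀` and arrow set `A = Q₁`. -/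
structure FinQuiver (V A : Type) where
  s : A → V
  t : A → V

namespace FinQuiver

variable {V A : Type} (Q : FinQuiver V A)

/-- `l = a₁ a₂ ⋯ aₙ` can be walked from `v`: `s(a₁) = v` and `t(aᵢ) = s(aᵢ₊₁)`. -/
def IsWalk : V → List A → Prop
  | _, [] => True
  | v, a :: l => Q.s a = v ∧ IsWalk (Q.t a) l

/-- The vertex reached from `v` after walking along `l`. -/
def walkEnd : V → List A → V
  | v, [] => v
  | _, a :: l => walkEnd (Q.t a) l

theorem isWalk_append (v : V) (l m : List A) :
    Q.IsWalk v (l ++ m) ↔ Q.IsWalk v l ∧ Q.IsWalk (Q.walkEnd v l) m := by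
  induction l generalizing v with
  | nil => simp [IsWalk, walkEnd]
  | cons a l ih => simp [IsWalk, walkEnd, ih, and_assoc]

theorem walkEnd_append (v : V) (l m : List A) :
    Q.walkEnd v (l ++ m) = Q.walkEnd (Q.walkEnd v l) m := by
  induction l generalizing v with
  | nil => simp [walkEnd]
  | cons a l ih => simp [walkEnd, ih]

/-- An oriented path of `Q`; the constant path `e_v` has no arrows. Paths are written
from left to right, so that `a b` is a path when `t(a) = s(b)`. -/
@[ext] structure QPath where
  src : V
  arrows : List A
  walk : Q.IsWalk src arrows

namespace QPath

variable {Q}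

/-- The target of a path. -/
def tgt (p : Q.QPath) : V := Q.walkEnd p.src p.arrows

/-- The length (number of arrows) of a path. -/
def length (p : Q.QPath) : ℕ := p.arrows.length

/-- The constant path `e_v`. -/
def const (Q : FinQuiver V A) (v : V) : Q.QPath := ⟨v, [], trivial⟩

/-- The path `a b`. -/
def two (a b : A) (h : Q.t a = Q.s b) : Q.QPath := ⟨Q.s a, [a, b], rfl, h.symm, trivial⟩

/-- Concatenation of composable paths. -/
def comp (p q : Q.QPath) (h : p.tgt = q.src) : Q.QPath :=
  ⟨p.src, p.arrows ++ q.arrows, (Q.isWalk_append _ _ _).2 ⟨p.walk, by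
    have hw := q.walk; rw [← h] at hw; exact hw⟩⟩

theorem comp_tgt (p q : Q.QPath) (h : p.tgt = q.src) : (p.comp q h).tgt = q.tgt := by
  have h' : Q.walkEnd p.src p.arrows = q.src := h
  simp [tgt, comp, walkEnd_append, h']

end QPath

/-- The underlying vector space of the path algebra `kQ`: the paths form a basis. -/
def PathAlgebra (k : Type*) [Field k] : Type _ := Q.QPath →₀ k

namespace PathAlgebra

variable (k : Type*) [Field k]

instance : AddCommGroup (Q.PathAlgebra k) := inferInstanceAs (AddCommGroup (Q.QPath →₀ k))

instance : Module k (Q.PathAlgebra k) := inferInstanceAs (Module k (Q.QPath →₀ k))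

variable {Q}

/-- The basis element of `kQ` given by a path. -/
def of (p : Q.QPath) : Q.PathAlgebra k := (Finsupp.single p 1 : Q.QPath →₀ k)

open Classical in
/-- The product of two basis elements: concatenation if possible, and zero otherwise. -/
def mulPath (p q : Q.QPath) : Q.PathAlgebra k :=
  if h : p.tgt = q.src then of k (p.comp q h) else 0

/-- The linear map on `kQ` with prescribed values on the basis of paths. -/
def lift {N : Type*} [AddCommGroup N] [Module k N] (f : Q.QPath → N) : Q.PathAlgebra k →ₗ[k] N :=
  (Finsupp.linearCombination k f : (Q.QPath →₀ k) →ₗ[k] N)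

theorem lift_of {N : Type*} [AddCommGroup N] [Module k N] (f : Q.QPath → N) (p : Q.QPath) :
    lift k f (of k p) = f p :=
  (Finsupp.linearCombination_single k 1 p).trans (one_smul k _)

/-- The multiplication of `kQ`, as the bilinear extension of `mulPath`. -/
def mulLin : Q.PathAlgebra k →ₗ[k] Q.PathAlgebra k →ₗ[k] Q.PathAlgebra k :=
  lift k fun p => lift k fun q => mulPath k p q

instance : Mul (Q.PathAlgebra k) := ⟨fun x y => mulLin k x y⟩

theorem of_mul_of (p q : Q.QPath) : of k p * of k q = mulPath k p q := by
  change mulLin k (of k p) (of k q) = _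
  rw [mulLin, lift_of, lift_of]

theorem lin_ext {N : Type*} [AddCommGroup N] [Module k N] {f g : Q.PathAlgebra k →ₗ[k] N}
    (h : ∀ p, f (of k p) = g (of k p)) : f = g :=
  Finsupp.lhom_ext' (M := k) (R := k) fun p => LinearMap.ext_ring (h p)

theorem of_mul_assoc (p q r : Q.QPath) :
    of k p * of k q * of k r = of k p * (of k q * of k r) := by
  have hz : ∀ x : Q.PathAlgebra k, (0 : Q.PathAlgebra k) * x = 0 := fun x => by
    change mulLin k 0 x = 0; simp
  have hz' : ∀ x : Q.PathAlgebra k, x * (0 : Q.PathAlgebra k) = 0 := fun x => by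
    change mulLin k x 0 = 0; simp
  rw [of_mul_of, of_mul_of, mulPath, mulPath]
  by_cases h₁ : p.tgt = q.src
  · have h₃ : (p.comp q h₁).tgt = q.tgt := QPath.comp_tgt p q h₁
    by_cases h₂ : q.tgt = r.src
    · rw [dif_pos h₁, dif_pos h₂, of_mul_of, of_mul_of, mulPath, mulPath, dif_pos (h₃.trans h₂),
        dif_pos (show p.tgt = (q.comp r h₂).src from h₁)]
      exact congrArg (of k) (QPath.ext rfl (List.append_assoc p.arrows q.arrows r.arrows))
    · rw [dif_pos h₁, dif_neg h₂, of_mul_of, mulPath, dif_neg (by rw [h₃]; exact h₂), hz']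
  · rw [dif_neg h₁, hz]
    by_cases h₂ : q.tgt = r.src
    · rw [dif_pos h₂, of_mul_of, mulPath, dif_neg (show ¬ p.tgt = (q.comp r h₂).src from h₁)]
    · rw [dif_neg h₂, hz']

theorem mul_assoc_aux (x y z : Q.PathAlgebra k) : x * y * z = x * (y * z) := by
  have h₁ : ∀ p q : Q.QPath, mulLin k (mulLin k (of k p) (of k q)) =
      (mulLin k (of k p)).comp (mulLin k (of k q)) := fun p q =>
    lin_ext k fun r => of_mul_assoc k p q r
  have h₂ : ∀ p : Q.QPath, (mulLin k).comp (mulLin k (of k p)) =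
      (LinearMap.llcomp k _ _ _ (mulLin k (of k p))).comp (mulLin k) := fun p =>
    lin_ext k fun q => h₁ p q
  have h₃ : (LinearMap.llcomp k _ _ _ (mulLin k)).comp (mulLin (Q := Q) k) =
      (LinearMap.lcomp k _ (mulLin k)).comp ((LinearMap.llcomp k _ _ _).comp (mulLin k)) :=
    lin_ext k fun p => h₂ p
  exact congrArg (fun f => f x y z) h₃

instance : NonUnitalRing (Q.PathAlgebra k) where
  __ := (inferInstance : AddCommGroup (Q.PathAlgebra k))
  __ := (inferInstance : Mul (Q.PathAlgebra k))
  left_distrib x y z := map_add (mulLin k x) y z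
  right_distrib x y z := by
    change mulLin k (x + y) z = mulLin k x z + mulLin k y z
    simp
  zero_mul x := by
    change mulLin k 0 x = 0
    simp
  mul_zero x := map_zero (mulLin k x)
  mul_assoc := mul_assoc_aux k

end PathAlgebra

end FinQuiver

/-- A bound quiver `(Q, I)`: a quiver and a two-sided ideal of its path algebra. (The ring `kQ`
has the unit `∑ e_v` when `Q` is finite, and two-sided ideals of `kQ` are `k`-subspaces because
of the idempotents `e_v`; neither fact has to be built into the definition.) -/
structure BoundQuiver (k : Type*) [Field k] where
  V : Type
  A : Type
  Q : FinQuiver V A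
  I : TwoSidedIdeal (Q.PathAlgebra k)

/-! ### The Avella-Alaminos–Geiss invariant of a bound quiver -/

namespace BoundQuiver

open FinQuiver

variable {k : Type*} [Field k] (B : BoundQuiver k)

/-- The bound quiver algebra `kQ/I`. -/
abbrev Algebra : Type _ := B.I.ringCon.Quotient

/-- The path `C` lies in the ideal `I`. -/
def InIdeal (C : B.Q.QPath) : Prop := PathAlgebra.of k C ∈ B.I

/-- `a b` is a path that lies in `I`. -/
def Rel (a b : B.A) : Prop := ∃ h : B.Q.t a = B.Q.s b, B.InIdeal (QPath.two a b h)

/-- `a b` is a path that does not lie in `I`. -/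
def NonRel (a b : B.A) : Prop := ∃ h : B.Q.t a = B.Q.s b, ¬ B.InIdeal (QPath.two a b h)

/-- A maximal permitted path: `C ∉ I`, but no path `b C` or `C b` lies outside `I`. -/
def IsNontrivialPermittedThread (C : B.Q.QPath) : Prop :=
  C.arrows ≠ [] ∧ ¬ B.InIdeal C ∧
    ∀ (b : B.A) (D : B.Q.QPath),
      (D.arrows = b :: C.arrows ∨ D.arrows = C.arrows ++ [b]) → B.InIdeal D

/-- A forbidden path: pairwise distinct arrows, any two consecutive ones having product in `I`. -/
def IsForbiddenPath (F : B.Q.QPath) : Prop :=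
  F.arrows ≠ [] ∧ F.arrows.Nodup ∧ F.arrows.IsChain B.Rel

/-- A maximal forbidden path. -/
def IsNontrivialForbiddenThread (F : B.Q.QPath) : Prop :=
  B.IsForbiddenPath F ∧
    ∀ (b : B.A) (D : B.Q.QPath),
      (D.arrows = b :: F.arrows ∨ D.arrows = F.arrows ++ [b]) → ¬ B.IsForbiddenPath D

/-- At most one arrow starts at `v` and at most one arrow ends at `v`. -/
def AtMostOne (v : B.V) : Prop :=
  (∀ a a', B.Q.s a = v → B.Q.s a' = v → a = a') ∧ (∀ a a', B.Q.t a = v → B.Q.t a' = v → a = a')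

/-- The constant path `e_v` is a trivial permitted thread. -/
def IsTrivialPermittedThread (C : B.Q.QPath) : Prop :=
  C.arrows = [] ∧ B.AtMostOne C.src ∧
    ∀ b c, B.Q.t b = C.src → B.Q.s c = C.src → B.NonRel b c

/-- The constant path `e_v` is a trivial forbidden thread. -/
def IsTrivialForbiddenThread (F : B.Q.QPath) : Prop :=
  F.arrows = [] ∧ B.AtMostOne F.src ∧
    ∀ b c, B.Q.t b = F.src → B.Q.s c = F.src → B.Rel b c

/-- The set `𝓗` of permitted threads. -/
def permittedThreads : Set B.Q.QPath :=
  {C | B.IsNontrivialPermittedThread C ∨ B.IsTrivialPermittedThread C}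

/-- The set `𝓕` of forbidden threads. -/
def forbiddenThreads : Set B.Q.QPath :=
  {F | B.IsNontrivialForbiddenThread F ∨ B.IsTrivialForbiddenThread F}

/-- The conditions on the sign functions `σ, ε : Q₁ → {1, -1}`. -/
structure IsSignPair (σ ε : B.A → ℤˣ) : Prop where
  start_ne : ∀ b₁ b₂, b₁ ≠ b₂ → B.Q.s b₁ = B.Q.s b₂ → σ b₁ = -σ b₂
  end_ne : ∀ b₁ b₂, b₁ ≠ b₂ → B.Q.t b₁ = B.Q.t b₂ → ε b₁ = -ε b₂
  comp : ∀ b c, B.NonRel b c → σ c = -ε b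

variable {B}
variable (σ ε : B.A → ℤˣ)

/-- `σ(H) = x`, for a permitted thread `H`. For a trivial thread `h_v` this is `-σ(a)` if `a`
starts at `v`, and `ε(b)` if no arrow starts at `v` and `b` ends at `v`. -/
def PermSigma (H : B.Q.QPath) (x : ℤˣ) : Prop :=
  (∀ a, H.arrows.head? = some a → x = σ a) ∧
  (H.arrows = [] → (∀ a, B.Q.s a = H.src → x = -σ a) ∧
    ((∀ a, B.Q.s a ≠ H.src) → ∀ b, B.Q.t b = H.src → x = ε b))

/-- `ε(H) = x`, for a permitted thread `H`; a trivial thread has `ε(h_v) = -σ(h_v)`. -/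
def PermEps (H : B.Q.QPath) (x : ℤˣ) : Prop :=
  (∀ a, H.arrows.getLast? = some a → x = ε a) ∧ (H.arrows = [] → PermSigma σ ε H (-x))

/-- `σ(F) = x`, for a forbidden thread `F`. For a trivial thread `p_v` this is `-σ(c)` if `c`
starts at `v`, and `-ε(d)` if no arrow starts at `v` and `d` ends at `v`. -/
def ForbSigma (F : B.Q.QPath) (x : ℤˣ) : Prop :=
  (∀ a, F.arrows.head? = some a → x = σ a) ∧
  (F.arrows = [] → (∀ c, B.Q.s c = F.src → x = -σ c) ∧
    ((∀ c, B.Q.s c ≠ F.src) → ∀ d, B.Q.t d = F.src → x = -ε d))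

/-- `ε(F) = x`, for a forbidden thread `F`. For a trivial thread `p_v` this is `-ε(d)` if `d`
ends at `v`, and `-σ(c)` if no arrow ends at `v` and `c` starts at `v`. -/
def ForbEps (F : B.Q.QPath) (x : ℤˣ) : Prop :=
  (∀ a, F.arrows.getLast? = some a → x = ε a) ∧
  (F.arrows = [] → (∀ d, B.Q.t d = F.src → x = -ε d) ∧
    ((∀ d, B.Q.t d ≠ F.src) → ∀ c, B.Q.s c = F.src → x = -σ c))

/-- `F = φ(H)`: the forbidden thread that ends at `t(H)` and has `ε(F) = -ε(H)`. -/
def IsPhi (H F : B.Q.QPath) : Prop :=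
  F ∈ B.forbiddenThreads ∧ F.tgt = H.tgt ∧ ∃ x, PermEps σ ε H x ∧ ForbEps σ ε F (-x)

/-- `H = ψ(F)`: the permitted thread that starts at `s(F)` and has `σ(H) = -σ(F)`. -/
def IsPsi (F H : B.Q.QPath) : Prop :=
  H ∈ B.permittedThreads ∧ H.src = F.src ∧ ∃ x, ForbSigma σ ε F x ∧ PermSigma σ ε H (-x)

/-- `O = {H₀, …, Hₙ₋₁}` is the set of permitted threads met by one run
`H₀, F₀, H₁, F₁, …, Hₙ = H₀` of the algorithm (stopped at the first return to `H₀`), and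
`(n, m)` with `m = ∑ ℓ(Fᵢ)` is the ordered pair obtained from it. -/
def IsRun (O : Set B.Q.QPath) (n m : ℕ) : Prop :=
  ∃ H F : ℕ → B.Q.QPath,
    H 0 ∈ B.permittedThreads ∧ (∀ i, IsPhi σ ε (H i) (F i)) ∧ (∀ i, IsPsi σ ε (F i) (H (i + 1))) ∧
    0 < n ∧ H n = H 0 ∧ (∀ j, 0 < j → j < n → H j ≠ H 0) ∧
    m = ∑ i ∈ Finset.range n, (F i).length ∧ O = H '' Set.Iio n

/-- An oriented cycle (without repeated arrow, up to rotation) in which each pair of consecutive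
arrows forms a relation. -/
def IsZeroCycle (c : Cycle B.A) : Prop := c ≠ Cycle.nil ∧ c.Nodup ∧ c.Chain B.Rel

/-- The invariant `AG : ℕ² → ℕ`, computed with the sign functions `σ, ε`: `AG(n, m)` is the number
of times the ordered pair `(n, m)` is formed by the algorithm. -/
def AG (n m : ℕ) : ℕ :=
  if n = 0 then {c : Cycle B.A | IsZeroCycle c ∧ c.length = m}.ncard
  else {O : Set B.Q.QPath | IsRun σ ε O n m}.ncard

end BoundQuiver

/-! ### Surfaces glued from oriented polygons, their quivers, and cuts -/

/-- A family of oriented polygons with some sides glued in pairs. A polygon is an orbit of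
`next`, the side following a given side in the counterclockwise direction. A side is glued to the
side `glue s`, reversing the direction, if `glue s ≠ s`; it is a boundary segment if
`glue s = s`. -/
structure PolygonGluing where
  Side : Type
  next : Side → Side
  glue : Side → Side
  glue_glue : ∀ s, glue (glue s) = s

namespace PolygonGluing

variable (P : PolygonGluing)

/-- The side is a boundary segment. -/
def IsBoundary (s : P.Side) : Prop := P.glue s = s

/-- The arcs: pairs `{s, glue s}` of glued sides. -/
def Arc : Type := {e : Sym2 P.Side // ∃ s, ¬ P.IsBoundary s ∧ e = s(s, P.glue s)}

/-- The arc of which `s` is one of the two sides. -/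
def arc (s : P.Side) (hs : ¬ P.IsBoundary s) : P.Arc := ⟨s(s, P.glue s), s, hs, rfl⟩

/-- The arrows of the quiver: the pairs `(s, next s)` of consecutive sides of a polygon neither of
which is a boundary segment. -/
def Arrow : Type := {s : P.Side // ¬ P.IsBoundary s ∧ ¬ P.IsBoundary (P.next s)}

/-- The quiver with one vertex for each arc, and one arrow from `τ` to `τ'` each time that `τ'`
follows `τ` when going around a polygon counterclockwise. -/
def quiver : FinQuiver P.Arc P.Arrow where
  s a := P.arc a.1 a.2.1
  t a := P.arc (P.next a.1) a.2.2

/-- The bound quiver: the ideal is generated by the paths `τ → τ' → τ''` of length two that run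
inside one polygon, that is, along three consecutive sides. -/
def boundQuiver (k : Type*) [Field k] : BoundQuiver k where
  V := P.Arc
  A := P.Arrow
  Q := P.quiver
  I := TwoSidedIdeal.span
    {x | ∃ (a b : P.Arrow) (h : P.quiver.t a = P.quiver.s b),
      b.1 = P.next a.1 ∧ x = FinQuiver.PathAlgebra.of k (FinQuiver.QPath.two a b h)}

open Classical in
/-- Cutting at a set `K` of corners, where `s ∈ K` stands for the corner at the beginning of the
side `s`. The vertex `v` of the corner is replaced by two points `v', v''`: a new boundary segment
from `v'` to `v''` is inserted into the polygon just before `s`. All gluings are kept. -/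
def cut (K : Set P.Side) : PolygonGluing where
  Side := P.Side ⊕ K
  next := Sum.elim
    (fun s => if h : P.next s ∈ K then Sum.inr ⟨P.next s, h⟩ else Sum.inl (P.next s))
    (fun s => Sum.inl s.1)
  glue := Sum.map P.glue id
  glue_glue := by
    rintro (s | s)
    · simp [P.glue_glue]
    · rfl

end PolygonGluing

/-! ### Triangulated surfaces -/

/-- The closed triangle with vertices `0, 1, 2` (in counterclockwise order). -/
abbrev ClosedTriangle : Type := stdSimplex ℝ (Fin 3)

/-- The vertex `i` of the closed triangle. -/
def triVertex (i : Fin 3) : ClosedTriangle := ⟨Pi.single i 1, single_mem_stdSimplex ℝ i⟩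

/-- The side `i` of the closed triangle runs from the vertex `i` to the vertex `i + 1`. -/
def triSide (i : Fin 3) : Set ClosedTriangle := {x | x.1 (i + 2) = 0}

/-- The elementary identifications of points of triangles given by a pairing of the sides
`(t, i)`: glued sides are identified affinely, with reversed direction. -/
def SideIdent {Tri : Type} (glue : Tri × Fin 3 → Tri × Fin 3) (p q : Tri × ClosedTriangle) : Prop :=
  ∃ i j : Fin 3, glue (p.1, i) = (q.1, j) ∧ (p.1, i) ≠ (q.1, j) ∧
    p.2 ∈ triSide i ∧ q.2 ∈ triSide j ∧ q.2.1 j = p.2.1 (i + 1) ∧ q.2.1 (j + 1) = p.2.1 i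

/-- A triangulation of an oriented unpunctured surface `S` with marked points, where `S` is a
(Hausdorff, connected) topological space: `S` is obtained from finitely many oriented triangles by
gluing some of their sides in pairs, reversing the direction. The glued sides are the arcs of the
triangulation, the other sides are the boundary segments, and the vertices are the marked points,
all of which lie on the boundary. -/
structure TriangulatedSurface (S : Type*) [TopologicalSpace S] where
  /-- the triangles -/
  Tri : Type
  [finite_tri : Finite Tri]
  /-- the pairing of the sides; `glue h = h` if `h` is a boundary segment -/
  glue : Tri × Fin 3 → Tri × Fin 3
  glue_glue : ∀ h, glue (glue h) = h
  /-- the triangles as (parametrized) parts of the surface -/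
  chart : Tri → ClosedTriangle → S
  continuous_chart : ∀ t, Continuous (chart t)
  surjective_chart : ∀ p, ∃ t x, chart t x = p
  chart_eq_iff : ∀ t x t' x', chart t x = chart t' x' ↔
    Relation.EqvGen (SideIdent glue) (t, x) (t', x')
  /-- the marked points lie on the boundary: there are no punctures -/
  unpunctured : ∀ t i, ∃ t' j, glue (t', j) = (t', j) ∧
    chart t (triVertex i) ∈ chart t' '' triSide j

namespace TriangulatedSurface

variable {S : Type*} [TopologicalSpace S] (T : TriangulatedSurface S)

/-- The triangles of the triangulation, as a gluing of polygons. -/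
def polygons : PolygonGluing where
  Side := T.Tri × Fin 3
  next h := (h.1, h.2 + 1)
  glue := T.glue
  glue_glue := T.glue_glue

/-- The side `h` is a boundary segment. -/
def IsBoundary (h : T.Tri × Fin 3) : Prop := T.polygons.IsBoundary h

/-- The side `h = (t, i)` as a curve in the surface. -/
def side (h : T.Tri × Fin 3) : Set S := T.chart h.1 '' triSide h.2

/-- The starting point in `S` of the side `h = (t, i)`, which is the vertex `i` of `t`. -/
def start (h : T.Tri × Fin 3) : S := T.chart h.1 (triVertex h.2)

/-- The final point in `S` of the side `h = (t, i)`, which is the vertex `i + 1` of `t`. -/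
def finish (h : T.Tri × Fin 3) : S := T.chart h.1 (triVertex (h.2 + 1))

/-- The boundary `∂S`. -/
def boundary : Set S := {p | ∃ h, T.IsBoundary h ∧ p ∈ T.side h}

/-- The boundary components of `S`: the connected components of `∂S`. -/
abbrev BoundaryComponent : Type _ := ConnectedComponents T.boundary

/-- The point `p` of `S` lies on the boundary component `C`. -/
def On (p : S) (C : T.BoundaryComponent) : Prop :=
  ∃ hp : p ∈ T.boundary, ConnectedComponents.mk (⟨p, hp⟩ : T.boundary) = C

/-- `M_{C,T}`: the marked points on `C` that are incident to at least one arc of `T`. -/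
def markedOn (C : T.BoundaryComponent) : Set S :=
  {p | T.On p C ∧ ∃ h, ¬ T.IsBoundary h ∧ (p = T.start h ∨ p = T.finish h)}

/-- `n(C,T)`, the cardinality of `M_{C,T}`. -/
def n (C : T.BoundaryComponent) : ℕ := (T.markedOn C).ncard

/-- `m(C,T)`, the number of boundary segments on `C` with both endpoints in `M_{C,T}`. -/
def m (C : T.BoundaryComponent) : ℕ :=
  {h | T.IsBoundary h ∧ T.start h ∈ T.markedOn C ∧ T.finish h ∈ T.markedOn C}.ncard

/-- The triangle `t` is internal: none of its sides is a boundary segment. -/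
def IsInternal (t : T.Tri) : Prop := ∀ i, ¬ T.IsBoundary (t, i)

/-- A cut of the triangulated surface: a set of angles of internal triangles (the angle of `t` at
its vertex `i` being `(t, i)`), containing at most one angle of each triangle. Each of them is the
place of one local cut. -/
structure Cut where
  corners : Set (T.Tri × Fin 3)
  internal : ∀ c ∈ corners, T.IsInternal c.1
  once : ∀ c ∈ corners, ∀ c' ∈ corners, c.1 = c'.1 → c = c'

namespace Cut

variable {T} (K : T.Cut)

/-- The polygons (triangles and quasi-triangles) of the partial triangulation `T†`. -/
def polygons : PolygonGluing := T.polygons.cut K.corners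

/-- The internal triangles of `T†`: the internal triangles of `T` that have not been cut. -/
def internalTriangles : Set T.Tri := {t | T.IsInternal t ∧ ∀ i, (t, i) ∉ K.corners}

/-- The number of local cuts at points of the boundary component `C`. -/
def numCutsOn (C : T.BoundaryComponent) : ℕ := {c ∈ K.corners | T.On (T.start c) C}.ncard

/-- The surface algebra `B_{T†} = kQ_{T†}/I_{T†}`, given by its bound quiver. A quasi-triangle with
sides `α, γ, β` and a boundary segment between `β` and `α` contributes the arrows
`α → γ → β` and the relation that their composition is zero; a triangle of `T†` contributes the
same arrows and relations as in the Jacobian algebra of a triangulation. -/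
def surfaceAlgebra (k : Type*) [Field k] : BoundQuiver k := K.polygons.boundQuiver k

end Cut

end TriangulatedSurface

end

end SurfaceAlgebra

/-! Every arc has two sides, exchanged by `glue`, and an arrow is a side `s` such that neither `s`
nor `next s` is a boundary segment. A path of two arrows meets its middle arc along one side and
either continues along that side, inside the polygon, or crosses to the other side. The first case
is exactly a generator of the ideal, so forbidden paths iterate `next` and run around a polygon,
while permitted paths iterate `rho = next ∘ glue` and turn around a marked point.

Call a side of an arc an entry if a boundary segment precedes it. Permitted threads correspond to
entries, and so do the forbidden threads that the algorithm meets: start at the entry and go on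
until a boundary segment stops the path. The signs distinguish the two sides of an arc. Hence `φ`
sends a permitted thread to the forbidden thread arriving on the other side of its last arc, and `ψ`
sends a forbidden thread to the permitted thread with the same entry (`exists_isThread_of_isPhi`,
`isThread_of_isPsi` and their converses). Since `glue` fixes boundary segments, `rho` also walks
along the boundary, and `ψ ∘ φ` becomes the first return map of `rho` to the entries
(`isNextEntry_of_isThread`). Runs of the algorithm are therefore orbits of `rho`
(`IsRegular.isRun_iff`).

Topologically, the orbits of `rho` are the boundary components: the orbit is an invariant of the
identifications of points, and the boundary segments of one orbit form a clopen part of the boundary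
(`component_eq_iff`). It remains to count. A marked point incident to an arc is the starting point
of exactly one entry of the triangulation, and each local cut adds one entry. The forbidden thread
has length two at a cut corner. At an old entry it has length one or zero, according to whether the
preceding boundary segment has both endpoints incident to arcs (`ncard_entry_eq`,
`sum_forbiddenLength_eq`).

For pairs with first entry zero, a cycle of relations runs once around a polygon without boundary
segments, that is, around an uncut internal triangle (`exists_eq_triangleCycle`).

Having two arcs on a connected surface excludes an isolated arc, whose two sides would give the same
trivial thread, and provides an entry on each boundary component. -/

namespace SurfaceAlgebra

noncomputable section

/-! ### Walks in a quiver and monomial ideals of its path algebra. -/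

namespace FinQuiver

variable {V A : Type} {Q : FinQuiver V A}

theorem isWalk_iff (v : V) (l : List A) :
    Q.IsWalk v l ↔ (∀ a ∈ l.head?, Q.s a = v) ∧ l.IsChain fun a b => Q.t a = Q.s b := by
  induction l generalizing v with
  | nil => simp [IsWalk]
  | cons a l ih =>
    rw [IsWalk, ih, List.isChain_cons]
    simp [eq_comm]

theorem walkEnd_of_getLast? {v : V} {l : List A} {a : A} (h : l.getLast? = some a) :
    Q.walkEnd v l = Q.t a := by
  induction l generalizing v with
  | nil => simp at h
  | cons b l ih =>
    cases l with
    | nil => simp at h; subst h; rfl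
    | cons c l => exact ih (v := Q.t b) (by simpa using h)

namespace QPath

theorem src_eq_of_head? {p : Q.QPath} {a : A} (h : p.arrows.head? = some a) : p.src = Q.s a :=
  (((isWalk_iff _ _).1 p.walk).1 a h).symm

theorem tgt_eq_of_getLast? {p : Q.QPath} {a : A} (h : p.arrows.getLast? = some a) :
    p.tgt = Q.t a :=
  walkEnd_of_getLast? h

theorem tgt_eq_of_nil {p : Q.QPath} (h : p.arrows = []) : p.tgt = p.src := by
  simp [tgt, h, walkEnd]

theorem isChain (p : Q.QPath) : p.arrows.IsChain fun a b => Q.t a = Q.s b :=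
  ((isWalk_iff _ _).1 p.walk).2

/-- The path with given non-empty list of arrows. -/
def ofChain (l : List A) (a : A) (ha : l.head? = some a)
    (hl : l.IsChain fun a b => Q.t a = Q.s b) : Q.QPath :=
  ⟨Q.s a, l, (isWalk_iff _ _).2 ⟨by simp [ha], hl⟩⟩

end QPath

namespace PathAlgebra

variable (k : Type*) [Field k] (R : A → A → Prop)

theorem of_ne_zero (p : Q.QPath) : of k p ≠ 0 :=
  Finsupp.single_ne_zero.2 one_ne_zero

theorem of_mul_of_comp (p q : Q.QPath) (h : p.tgt = q.src) :
    of k p * of k q = of k (p.comp q h) := by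
  rw [of_mul_of, mulPath, dif_pos h]

open Classical in
/-- The linear projection of `kQ` that kills the paths containing two consecutive arrows
related by `R`. -/
def killRel : Q.PathAlgebra k →ₗ[k] Q.PathAlgebra k :=
  lift k fun p => if p.arrows.IsChain (fun a b => ¬ R a b) then of k p else 0

theorem killRel_of_pos {p : Q.QPath} (h : p.arrows.IsChain fun a b => ¬ R a b) :
    killRel k R (of k p) = of k p := by
  rw [killRel, lift_of, if_pos h]

theorem killRel_of_neg {p : Q.QPath} (h : ¬ p.arrows.IsChain fun a b => ¬ R a b) :
    killRel k R (of k p) = 0 := by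
  rw [killRel, lift_of, if_neg h]

/-- A factor that already contains a related pair passes it on to every concatenation, so killing
such factors beforehand changes nothing. This identity makes the kernel of `killRel` absorb products
on both sides. -/
theorem killRel_mul (x y : Q.PathAlgebra k) :
    killRel k R (x * y) = killRel k R (killRel k R x * killRel k R y) := by
  have h₁ : ∀ p : Q.QPath, (killRel k R).comp (mulLin k (of k p)) =
      (killRel k R).comp ((mulLin k (killRel k R (of k p))).comp (killRel k R)) := by
    intro p
    refine lin_ext k fun q => ?_
    change killRel k R (of k p * of k q) =
      killRel k R (killRel k R (of k p) * killRel k R (of k q))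
    by_cases hp : p.arrows.IsChain fun a b => ¬ R a b
    · by_cases hq : q.arrows.IsChain fun a b => ¬ R a b
      · rw [killRel_of_pos k R hp, killRel_of_pos k R hq]
      · rw [killRel_of_neg k R hq, mul_zero, map_zero, of_mul_of, mulPath]
        split_ifs with h
        · exact killRel_of_neg k R fun hc => hq (List.isChain_append.1 hc).2.1
        · exact map_zero _
    · rw [killRel_of_neg k R hp, zero_mul, map_zero, of_mul_of, mulPath]
      split_ifs with h
      · exact killRel_of_neg k R fun hc => hp (List.isChain_append.1 hc).1
      · exact map_zero _
  have h₂ : (LinearMap.llcomp k _ _ _ (killRel k R)).comp (mulLin k) =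
      ((LinearMap.llcomp k _ _ _ (killRel k R)).comp
        ((LinearMap.lcomp k _ (killRel k R)).comp ((mulLin (Q := Q) k).comp (killRel k R)))) :=
    lin_ext k fun p => h₁ p
  exact congrArg (fun f => f x y) h₂

/-- The two-sided ideal spanned by the paths containing two consecutive arrows related by `R`. -/
def relIdeal : TwoSidedIdeal (Q.PathAlgebra k) :=
  TwoSidedIdeal.mk' {x | killRel k R x = 0} (map_zero _)
    (fun {x y} hx hy => by
      rw [Set.mem_ofPred_eq] at *
      rw [map_add, hx, hy, add_zero])
    (fun {x} hx => by
      rw [Set.mem_ofPred_eq] at *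
      rw [map_neg, hx, neg_zero])
    (fun {x y} hy => by
      rw [Set.mem_ofPred_eq] at *
      rw [killRel_mul, hy, mul_zero, map_zero])
    (fun {x y} hx => by
      rw [Set.mem_ofPred_eq] at *
      rw [killRel_mul, hx, zero_mul, map_zero])

theorem exists_split_of_not_isChain {α : Type*} {R : α → α → Prop} {l : List α}
    (h : ¬ l.IsChain fun a b => ¬ R a b) : ∃ l₁ a b l₂, l = l₁ ++ ([a, b] ++ l₂) ∧ R a b := by
  induction l with
  | nil => simp at h
  | cons a l ih =>
    by_cases hl : l.IsChain fun a b => ¬ R a b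
    · rw [List.isChain_cons, not_and] at h
      have : ¬ ∀ y ∈ l.head?, ¬ R a y := fun h' => h h' hl
      push Not at this
      obtain ⟨b, hb, hR⟩ := this
      obtain ⟨m, rfl⟩ : ∃ m, l = b :: m := by
        cases l with
        | nil => simp at hb
        | cons c m => simp at hb; subst hb; exact ⟨m, rfl⟩
      exact ⟨[], a, b, m, rfl, hR⟩
    · obtain ⟨l₁, x, y, l₂, rfl, hR⟩ := ih hl
      exact ⟨a :: l₁, x, y, l₂, rfl, hR⟩

/-- The kernel of `killRel` is an ideal containing the generators, and a path without related pair
is fixed by `killRel`, hence lies outside it. Conversely, a path with a related pair factors through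
a generator. -/
theorem of_mem_span_iff (p : Q.QPath) :
    of k p ∈ TwoSidedIdeal.span {x : Q.PathAlgebra k | ∃ (a b : A) (h : Q.t a = Q.s b), R a b ∧
      x = of k (QPath.two a b h)} ↔ ¬ p.arrows.IsChain fun a b => ¬ R a b := by
  constructor
  · intro hp hc
    rw [TwoSidedIdeal.mem_span_iff] at hp
    have := hp (relIdeal k R) (by
      rintro x ⟨a, b, h, hR, rfl⟩
      change _ ∈ relIdeal k R
      rw [relIdeal, TwoSidedIdeal.mem_mk', Set.mem_ofPred_eq]
      refine killRel_of_neg k R fun h => ?_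
      change List.IsChain _ [a, b] at h
      rw [List.isChain_cons] at h
      exact h.1 b rfl hR)
    rw [relIdeal, TwoSidedIdeal.mem_mk', Set.mem_ofPred_eq, killRel_of_pos k R hc] at this
    exact of_ne_zero k p this
  · intro hp
    obtain ⟨l₁, a, b, l₂, hl, hR⟩ := exists_split_of_not_isChain hp
    have hw := p.walk
    rw [hl, isWalk_append, isWalk_append] at hw
    obtain ⟨hw₁, ⟨ha, hb, -⟩, hw₂⟩ := hw
    set p₁ : Q.QPath := ⟨p.src, l₁, hw₁⟩
    set p₂ : Q.QPath := ⟨_, l₂, hw₂⟩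
    set q := QPath.two a b hb.symm
    have e₁ : p₁.tgt = q.src := ha.symm
    have e₂ : (p₁.comp q e₁).tgt = p₂.src := QPath.comp_tgt p₁ q e₁
    have : of k p = of k p₁ * of k q * of k p₂ := by
      rw [of_mul_of_comp k p₁ q e₁, of_mul_of_comp k _ p₂ e₂]
      refine congrArg _ (QPath.ext rfl ?_)
      simpa [QPath.comp, p₁, p₂, q, QPath.two] using hl
    rw [this]
    exact TwoSidedIdeal.mul_mem_right _ _ _ (TwoSidedIdeal.mul_mem_left _ _ _
      (TwoSidedIdeal.subset_span ⟨a, b, _, hR, rfl⟩))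

end PathAlgebra

end FinQuiver

/-! ### Relations and non-relations in the quiver of glued polygons. -/

namespace PolygonGluing

open FinQuiver

variable {P : PolygonGluing}

/-- The side of a polygon at which an arrow starts. -/
def Arrow.side (a : P.Arrow) : P.Side := a.1

theorem Arrow.not_isBoundary (a : P.Arrow) : ¬ P.IsBoundary a.side := a.2.1

theorem Arrow.not_isBoundary_next (a : P.Arrow) : ¬ P.IsBoundary (P.next a.side) := a.2.2

theorem Arrow.ext_side {a b : P.Arrow} (h : a.side = b.side) : a = b := Subtype.ext h

theorem not_isBoundary_glue {s : P.Side} (hs : ¬ P.IsBoundary s) : ¬ P.IsBoundary (P.glue s) :=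
  fun h => hs (by
    have h' : P.glue (P.glue s) = P.glue s := h
    rw [P.glue_glue] at h'
    exact h'.symm)

theorem glue_injective : Function.Injective P.glue := fun x y h => by
  rw [← P.glue_glue x, h, P.glue_glue]

theorem arc_eq_arc_iff {s s' : P.Side} (hs : ¬ P.IsBoundary s) (hs' : ¬ P.IsBoundary s') :
    P.arc s hs = P.arc s' hs' ↔ s' = s ∨ s' = P.glue s := by
  refine Subtype.ext_iff.trans (Sym2.eq_iff.trans ?_)
  constructor
  · rintro (⟨h, -⟩ | ⟨-, h⟩)
    · exact Or.inl h.symm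
    · exact Or.inr h.symm
  · rintro (rfl | rfl)
    · simp
    · simp [P.glue_glue]

theorem arc_glue {s : P.Side} (hs : ¬ P.IsBoundary s) :
    P.arc (P.glue s) (not_isBoundary_glue hs) = P.arc s hs :=
  (arc_eq_arc_iff _ _).2 (Or.inr (P.glue_glue s).symm)

variable (k : Type*) [Field k]

theorem inIdeal_iff (p : P.quiver.QPath) :
    (P.boundQuiver k).InIdeal p ↔
      ¬ p.arrows.IsChain fun a b : P.Arrow => ¬ b.side = P.next a.side :=
  PathAlgebra.of_mem_span_iff k (fun a b : P.Arrow => b.side = P.next a.side) p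

theorem inIdeal_two_iff (a b : P.Arrow) (h : P.quiver.t a = P.quiver.s b) :
    (P.boundQuiver k).InIdeal (QPath.two a b h) ↔ b.side = P.next a.side := by
  refine (inIdeal_iff k _).trans ?_
  change ¬ List.IsChain _ [a, b] ↔ _
  simp

theorem t_eq_s_iff (a b : P.Arrow) :
    P.quiver.t a = P.quiver.s b ↔ b.side = P.next a.side ∨ b.side = P.glue (P.next a.side) :=
  arc_eq_arc_iff a.not_isBoundary_next b.not_isBoundary

theorem rel_iff (a b : P.Arrow) : (P.boundQuiver k).Rel a b ↔ b.side = P.next a.side := by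
  constructor
  · rintro ⟨h, h'⟩
    exact (inIdeal_two_iff k a b h).1 h'
  · intro h
    exact ⟨(t_eq_s_iff a b).2 (Or.inl h), (inIdeal_two_iff k a b _).2 h⟩

/-- Two composable arrows share an arc, which has only two sides: staying on the same side is the
relation, so crossing by `glue` is what remains. The two cases exclude each other because the sides
of an arc differ. -/
theorem nonRel_iff (a b : P.Arrow) :
    (P.boundQuiver k).NonRel a b ↔ b.side = P.glue (P.next a.side) := by
  constructor
  · rintro ⟨h, h'⟩
    exact ((t_eq_s_iff a b).1 h).resolve_left fun e => h' ((inIdeal_two_iff k a b h).2 e)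
  · intro h
    refine ⟨(t_eq_s_iff a b).2 (Or.inr h), fun h' => ?_⟩
    have := (inIdeal_two_iff k a b _).1 h'
    exact a.not_isBoundary_next (h.symm.trans this)

theorem not_inIdeal_iff (p : P.quiver.QPath) :
    ¬ (P.boundQuiver k).InIdeal p ↔
      p.arrows.IsChain fun a b : P.Arrow => b.side = P.glue (P.next a.side) := by
  rw [inIdeal_iff, not_not]
  constructor
  · intro h
    have h' := p.isChain
    rw [List.isChain_iff_getElem] at h h' ⊢
    exact fun i hi => ((t_eq_s_iff _ _).1 (h' i hi)).resolve_left (h i hi)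
  · intro h
    exact h.imp fun a b h h' => a.not_isBoundary_next (h.symm.trans h')

end PolygonGluing

/-! ### Threads attached to entries. -/

namespace PolygonGluing

open FinQuiver

variable (P : PolygonGluing)

/-- No arrow ends at the side `s`: it is preceded by a boundary segment. -/
def NoIn (s : P.Side) : Prop := ∃ b, P.IsBoundary b ∧ P.next b = s

/-- No arrow starts at the side `s`: it is followed by a boundary segment. -/
def NoOut (s : P.Side) : Prop := P.IsBoundary (P.next s)

/-- A side of an arc that is preceded by a boundary segment. -/
def Entry (s : P.Side) : Prop := ¬ P.IsBoundary s ∧ P.NoIn s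

/-- The maps `id` and `glue`, which distinguish forbidden and permitted threads. -/
def IsSideMap (j : P.Side → P.Side) : Prop := j = id ∨ j = P.glue

/-- Going around a polygon (`j = id`) or around a vertex (`j = glue`). -/
def step (j : P.Side → P.Side) (s : P.Side) : P.Side := P.next (j s)

/-- Going around a vertex, and on to the next vertex after a boundary segment. -/
abbrev rho : P.Side → P.Side := P.step P.glue

/-- The path starting at the entry `s` and running around a polygon (`j = id`) or around a vertex
(`j = glue`) as far as possible. -/
structure IsThread (j : P.Side → P.Side) (s : P.Side) (H : P.quiver.QPath) : Prop where
  entry : P.Entry s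
  src : H.src = P.arc s entry.1
  arrows : ∀ i a, H.arrows[i]? = some a → a.side = j ((P.step j)^[i] s)
  last : P.IsBoundary ((P.step j)^[H.length + 1] s)

variable {P}

theorem isSideMap_id : P.IsSideMap id := Or.inl rfl

theorem isSideMap_glue : P.IsSideMap P.glue := Or.inr rfl

namespace IsSideMap

variable {j : P.Side → P.Side}

theorem apply_apply (hj : P.IsSideMap j) (s : P.Side) : j (j s) = s := by
  rcases hj with rfl | rfl
  · rfl
  · exact P.glue_glue s

theorem injective (hj : P.IsSideMap j) : Function.Injective j := fun x y h => by
  rw [← hj.apply_apply x, h, hj.apply_apply]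

theorem apply_eq (hj : P.IsSideMap j) (s : P.Side) : j s = s ∨ j s = P.glue s := by
  rcases hj with rfl | rfl
  · exact Or.inl rfl
  · exact Or.inr rfl

theorem not_isBoundary (hj : P.IsSideMap j) {s : P.Side} (hs : ¬ P.IsBoundary s) :
    ¬ P.IsBoundary (j s) := by
  rcases hj with rfl | rfl
  · exact hs
  · exact not_isBoundary_glue hs

theorem arc_apply (hj : P.IsSideMap j) {s : P.Side} (hs : ¬ P.IsBoundary s)
    (h : ¬ P.IsBoundary (j s)) : P.arc (j s) h = P.arc s hs := by
  rcases hj with rfl | rfl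
  · rfl
  · exact arc_glue hs

end IsSideMap

theorem ne_glue {s : P.Side} (hs : ¬ P.IsBoundary s) : s ≠ P.glue s := fun h => hs h.symm

theorem s_eq_arc_iff {s : P.Side} (hs : ¬ P.IsBoundary s) (a : P.Arrow) :
    P.quiver.s a = P.arc s hs ↔ a.side = s ∨ a.side = P.glue s :=
  eq_comm.trans (arc_eq_arc_iff hs a.not_isBoundary)

theorem t_eq_arc_iff {s : P.Side} (hs : ¬ P.IsBoundary s) (a : P.Arrow) :
    P.quiver.t a = P.arc s hs ↔ P.next a.side = s ∨ P.next a.side = P.glue s :=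
  eq_comm.trans (arc_eq_arc_iff hs a.not_isBoundary_next)

theorem exists_arrow_of_not_noIn (hn : Function.Bijective P.next) {s : P.Side}
    (hs : ¬ P.IsBoundary s) (h : ¬ P.NoIn s) : ∃ a : P.Arrow, P.next a.side = s := by
  obtain ⟨b, rfl⟩ := hn.2 s
  exact ⟨⟨b, fun hb => h ⟨b, hb, rfl⟩, hs⟩, rfl⟩

theorem NoIn.next_ne (hn : Function.Bijective P.next) {s : P.Side} (h : P.NoIn s) (a : P.Arrow) :
    P.next a.side ≠ s := by
  rintro rfl
  obtain ⟨b, hb, hb'⟩ := h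
  exact a.not_isBoundary (hn.1 hb' ▸ hb)

theorem NoOut.ne {s : P.Side} (h : P.NoOut s) (a : P.Arrow) : a.side ≠ s := by
  rintro rfl
  exact a.not_isBoundary_next h

theorem exists_arrow_of_not_noOut {s : P.Side} (hs : ¬ P.IsBoundary s) (h : ¬ P.NoOut s) :
    ∃ a : P.Arrow, a.side = s :=
  ⟨⟨s, hs, h⟩, rfl⟩

theorem arrow_eq_of_next_eq (hn : Function.Bijective P.next) {a b : P.Arrow}
    (h : P.next a.side = P.next b.side) : a = b :=
  Arrow.ext_side (hn.1 h)

theorem exists_arc (v : P.Arc) : ∃ s, ∃ hs : ¬ P.IsBoundary s, v = P.arc s hs := by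
  obtain ⟨e, s, hs, rfl⟩ := v
  exact ⟨s, hs, rfl⟩

theorem isChain_comp_of_follows {j : P.Side → P.Side} (hj : P.IsSideMap j) {l : List P.Arrow}
    (h : l.IsChain fun a b => b.side = j (P.next a.side)) :
    l.IsChain fun a b => P.quiver.t a = P.quiver.s b :=
  h.imp fun a b h => (t_eq_s_iff a b).2 (by rw [h]; exact hj.apply_eq _)

theorem iterate_step_succ (j : P.Side → P.Side) (i : ℕ) (s : P.Side) :
    (P.step j)^[i + 1] s = P.next (j ((P.step j)^[i] s)) :=
  Function.iterate_succ_apply' _ _ _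

theorem val_eq_of_isChain {j : P.Side → P.Side} {l : List P.Arrow}
    (h : l.IsChain fun a b => b.side = j (P.next a.side)) {s : P.Side}
    (h₀ : ∀ a, l.head? = some a → a.side = j s) (i : ℕ) (a : P.Arrow) (ha : l[i]? = some a) :
    a.side = j ((P.step j)^[i] s) := by
  induction i generalizing a with
  | zero => exact h₀ a (by rw [List.head?_eq_getElem?]; exact ha)
  | succ i ih =>
    obtain ⟨hi, rfl⟩ := List.getElem?_eq_some_iff.1 ha
    rw [List.isChain_iff_getElem.1 h i hi, Function.iterate_succ_apply', step,
      ← ih l[i] (List.getElem?_eq_getElem _)]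

namespace IsThread

variable {j : P.Side → P.Side} {s : P.Side} {H : P.quiver.QPath}

theorem not_isBoundary (h : P.IsThread j s H) {i : ℕ} (hi : i ≤ H.length) :
    ¬ P.IsBoundary ((P.step j)^[i] s) := by
  cases i with
  | zero => exact h.entry.1
  | succ i =>
    have := (H.arrows[i]'hi).not_isBoundary_next
    rwa [h.arrows i _ (List.getElem?_eq_getElem hi), ← iterate_step_succ] at this

/-- A thread stops exactly where iteration first meets a boundary segment, so its length is dictated
by the entry. This gives the uniqueness of threads. -/
theorem length_eq_of_isBoundary (h : P.IsThread j s H) {n : ℕ}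
    (hn : P.IsBoundary ((P.step j)^[n + 1] s)) (hn' : ∀ i ≤ n, ¬ P.IsBoundary ((P.step j)^[i] s)) :
    H.length = n := by
  by_contra hne
  rcases lt_or_gt_of_ne hne with hlt | hlt
  · exact hn' _ hlt h.last
  · exact h.not_isBoundary hlt hn

theorem unique (h : P.IsThread j s H) {H' : P.quiver.QPath} (h' : P.IsThread j s H') : H = H' := by
  have hl : H.length = H'.length :=
    h.length_eq_of_isBoundary h'.last fun i hi => h'.not_isBoundary hi
  refine QPath.ext (h.src.trans h'.src.symm) (List.ext_getElem hl fun i h₁ h₂ => Arrow.ext_side ?_)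
  rw [h.arrows i _ (List.getElem?_eq_getElem h₁), h'.arrows i _ (List.getElem?_eq_getElem h₂)]

theorem isChain (h : P.IsThread j s H) : H.arrows.IsChain fun a b => b.side = j (P.next a.side) := by
  rw [List.isChain_iff_getElem]
  intro i hi
  rw [h.arrows (i + 1) _ (List.getElem?_eq_getElem hi),
    h.arrows i _ (List.getElem?_eq_getElem (Nat.lt_of_succ_lt hi)), Function.iterate_succ_apply',
    step]

theorem head (h : P.IsThread j s H) {a : P.Arrow} (ha : H.arrows.head? = some a) : a.side = j s :=
  h.arrows 0 a (by rw [← List.head?_eq_getElem?]; exact ha)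

theorem next_last (h : P.IsThread j s H) {a : P.Arrow} (ha : H.arrows.getLast? = some a) :
    P.next a.side = (P.step j)^[H.length] s := by
  have hpos : 0 < H.length := by
    by_contra h0
    have : H.arrows = [] := List.eq_nil_of_length_eq_zero (Nat.eq_zero_of_not_pos h0)
    simp [this] at ha
  rw [List.getLast?_eq_getElem?] at ha
  rw [h.arrows _ a ha, ← iterate_step_succ]
  congr 1
  change (H.length - 1).succ = H.length
  omega

theorem tgt (h : P.IsThread j s H) :
    H.tgt = P.arc ((P.step j)^[H.length] s) (h.not_isBoundary le_rfl) := by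
  cases ha : H.arrows.getLast? with
  | none =>
    have : H.arrows = [] := by simpa using ha
    rw [QPath.tgt_eq_of_nil this, h.src]
    simp [QPath.length, this]
  | some a =>
    rw [QPath.tgt_eq_of_getLast? ha]
    exact (t_eq_arc_iff _ a).2 (Or.inl (h.next_last ha))

theorem not_follows_head (h : P.IsThread j s H) (hj : P.IsSideMap j)
    (hn : Function.Bijective P.next) {a : P.Arrow} (ha : H.arrows.head? = some a) (b : P.Arrow) :
    a.side ≠ j (P.next b.side) := by
  intro hab
  rw [h.head ha] at hab
  exact h.entry.2.next_ne hn b (hj.injective hab).symm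

theorem not_last_follows (h : P.IsThread j s H) {a : P.Arrow}
    (ha : H.arrows.getLast? = some a) (b : P.Arrow) : b.side ≠ j (P.next a.side) := by
  intro hab
  have := h.last
  rw [Function.iterate_succ_apply', ← h.next_last ha, step, ← hab] at this
  exact b.not_isBoundary_next this

theorem noOut (h : P.IsThread j s H) : P.NoOut (j ((P.step j)^[H.length] s)) := by
  have := h.last
  rwa [Function.iterate_succ_apply'] at this

theorem noOut_of_nil (h : P.IsThread j s H) (hH : H.arrows = []) : P.NoOut (j s) := by
  have := h.noOut
  rwa [show H.length = 0 by simp [QPath.length, hH]] at this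

end IsThread

theorem exists_isThread {j : P.Side → P.Side} (hj : P.IsSideMap j) {s : P.Side} (hs : P.Entry s)
    {n : ℕ} (hn : P.IsBoundary ((P.step j)^[n + 1] s))
    (hn' : ∀ i ≤ n, ¬ P.IsBoundary ((P.step j)^[i] s)) : ∃ H, P.IsThread j s H := by
  let f : Fin n → P.Arrow := fun i => ⟨j ((P.step j)^[i] s), hj.not_isBoundary (hn' i i.2.le), by
    have := hn' (i + 1) i.2
    rwa [Function.iterate_succ_apply'] at this⟩
  have hc : (List.ofFn f).IsChain fun a b => b.side = j (P.next a.side) := by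
    rw [List.isChain_ofFn]
    intro i hi
    change j ((P.step j)^[i + 1] s) = j (P.next (j ((P.step j)^[i] s)))
    rw [iterate_step_succ]
  have hw : P.quiver.IsWalk (P.arc s hs.1) (List.ofFn f) := by
    rw [isWalk_iff]
    refine ⟨?_, isChain_comp_of_follows hj hc⟩
    intro a ha
    rw [List.head?_eq_getElem?, Option.mem_def, List.getElem?_eq_some_iff] at ha
    obtain ⟨h0, rfl⟩ := ha
    rw [List.getElem_ofFn]
    exact hj.arc_apply hs.1 (hj.not_isBoundary hs.1)
  refine ⟨⟨_, _, hw⟩, hs, rfl, ?_, ?_⟩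
  · intro i a ha
    obtain ⟨hi, rfl⟩ := List.getElem?_eq_some_iff.1 ha
    change ((List.ofFn f)[i]'hi).side = _
    rw [List.getElem_ofFn]
    rfl
  · simpa [QPath.length] using hn

/-- If no arrow can be put in front, the side `j a.side` must be preceded by a boundary segment, and
if none can be appended, the last arrow leads to a side followed by one. Treating `j = id` and `j =
glue` together serves forbidden and permitted threads at once. -/
theorem isThread_of_maximal {j : P.Side → P.Side} (hj : P.IsSideMap j)
    (hn : Function.Bijective P.next) {H : P.quiver.QPath} {a : P.Arrow}
    (ha : H.arrows.head? = some a)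
    (hc : H.arrows.IsChain fun a b => b.side = j (P.next a.side))
    (h₁ : ∀ b : P.Arrow, a.side ≠ j (P.next b.side))
    (h₂ : ∀ c : P.Arrow, H.arrows.getLast? = some c → ∀ b : P.Arrow, b.side ≠ j (P.next c.side)) :
    P.IsThread j (j a.side) H := by
  have hs : ¬ P.IsBoundary (j a.side) := hj.not_isBoundary a.not_isBoundary
  have harr := val_eq_of_isChain hc (s := j a.side) fun b hb => by
    rw [ha, Option.some.injEq] at hb
    rw [hb, hj.apply_apply]
  have hpos : 0 < H.arrows.length := by
    by_contra h0
    have : H.arrows = [] := List.eq_nil_of_length_eq_zero (by simpa using h0)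
    simp [this] at ha
  refine ⟨⟨hs, ?_⟩, ?_, harr, ?_⟩
  · by_contra hin
    obtain ⟨b, hb⟩ := exists_arrow_of_not_noIn hn hs hin
    exact h₁ b (by rw [hb, hj.apply_apply])
  · rw [QPath.src_eq_of_head? ha]
    exact (hj.arc_apply a.not_isBoundary hs).symm
  · obtain ⟨c, hlast⟩ : ∃ c, H.arrows.getLast? = some c := by
      rw [← Option.isSome_iff_exists]
      simpa using List.ne_nil_of_length_pos hpos
    have hc' := harr _ c (by rw [← List.getLast?_eq_getElem?]; exact hlast)
    have hlen : H.length = (H.arrows.length - 1) + 1 := (Nat.succ_pred_eq_of_pos hpos).symm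
    rw [hlen, Function.iterate_succ_apply', Function.iterate_succ_apply', step, step, ← hc']
    by_contra hb
    exact h₂ c hlast ⟨_, hj.not_isBoundary c.not_isBoundary_next, hb⟩ rfl

end PolygonGluing

/-! ### Permitted and forbidden threads of the bound quiver. -/

namespace PolygonGluing

open FinQuiver BoundQuiver

variable {P : PolygonGluing} (k : Type*) [Field k]

theorem exists_head?_eq {α : Type*} {l : List α} (h : l ≠ []) : ∃ a, l.head? = some a :=
  ⟨l.head h, List.head?_eq_some_head h⟩

theorem exists_getLast?_eq {α : Type*} {l : List α} (h : l ≠ []) : ∃ a, l.getLast? = some a :=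
  ⟨l.getLast h, List.getLast?_eq_some_getLast h⟩

/-- At most one arrow starts at `v`, at most one arrow ends at `v`, and they follow each other
around a polygon (`j = id`) or around a vertex (`j = glue`). -/
structure IsTrivialAt (j : P.Side → P.Side) (v : P.Arc) : Prop where
  s_inj : ∀ a b : P.Arrow, P.quiver.s a = v → P.quiver.s b = v → a = b
  t_inj : ∀ a b : P.Arrow, P.quiver.t a = v → P.quiver.t b = v → a = b
  follows : ∀ b c : P.Arrow, P.quiver.t b = v → P.quiver.s c = v → c.side = j (P.next b.side)

theorem mem_permittedThreads_iff (H : P.quiver.QPath) :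
    H ∈ (P.boundQuiver k).permittedThreads ↔
      (H.arrows ≠ [] ∧ H.arrows.IsChain (fun a b => b.side = P.glue (P.next a.side)) ∧
        ∀ (b : P.Arrow) (D : P.quiver.QPath),
          (D.arrows = b :: H.arrows ∨ D.arrows = H.arrows ++ [b]) →
            ¬ D.arrows.IsChain fun a b => b.side = P.glue (P.next a.side)) ∨
      (H.arrows = [] ∧ IsTrivialAt P.glue H.src) := by
  constructor
  · rintro (⟨h₁, h₂, h₃⟩ | ⟨h₁, ⟨h₂, h₃⟩, h₄⟩)
    · exact Or.inl ⟨h₁, (not_inIdeal_iff k H).1 h₂, fun b D hD hc =>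
        (not_inIdeal_iff k D).2 hc (h₃ b D hD)⟩
    · exact Or.inr ⟨h₁, h₂, h₃, fun b c hb hc => (nonRel_iff k b c).1 (h₄ b c hb hc)⟩
  · rintro (⟨h₁, h₂, h₃⟩ | ⟨h₁, h₂, h₃, h₄⟩)
    · exact Or.inl ⟨h₁, (not_inIdeal_iff k H).2 h₂, fun b D hD =>
        not_not.1 fun hc => h₃ b D hD ((not_inIdeal_iff k D).1 hc)⟩
    · exact Or.inr ⟨h₁, ⟨h₂, h₃⟩, fun b c hb hc => (nonRel_iff k b c).2 (h₄ b c hb hc)⟩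

theorem isChain_rel_iff (l : List P.Arrow) :
    l.IsChain (P.boundQuiver k).Rel ↔ l.IsChain fun a b => b.side = id (P.next a.side) := by
  constructor <;> intro h
  · exact h.imp fun a b => (rel_iff k a b).1
  · exact h.imp fun a b => (rel_iff k a b).2

theorem mem_forbiddenThreads_iff (F : P.quiver.QPath) :
    F ∈ (P.boundQuiver k).forbiddenThreads ↔
      (F.arrows ≠ [] ∧ F.arrows.Nodup ∧
        F.arrows.IsChain (fun a b => b.side = id (P.next a.side)) ∧
        ∀ (b : P.Arrow) (D : P.quiver.QPath),
          (D.arrows = b :: F.arrows ∨ D.arrows = F.arrows ++ [b]) → D.arrows.Nodup →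
            ¬ D.arrows.IsChain fun a b => b.side = id (P.next a.side)) ∨
      (F.arrows = [] ∧ IsTrivialAt id F.src) := by
  constructor
  · rintro (⟨⟨h₁, h₂, h₃⟩, h₄⟩ | ⟨h₁, ⟨h₂, h₃⟩, h₄⟩)
    · refine Or.inl ⟨h₁, h₂, (isChain_rel_iff k _).1 h₃, fun b D hD hn hc => ?_⟩
      refine h₄ b D hD ⟨?_, hn, (isChain_rel_iff k _).2 hc⟩
      rcases hD with hD | hD
      · exact hD ▸ List.cons_ne_nil _ _
      · exact hD ▸ List.append_ne_nil_of_right_ne_nil _ (List.cons_ne_nil _ _)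
    · exact Or.inr ⟨h₁, h₂, h₃, fun b c hb hc => (rel_iff k b c).1 (h₄ b c hb hc)⟩
  · rintro (⟨h₁, h₂, h₃, h₄⟩ | ⟨h₁, h₂, h₃, h₄⟩)
    · exact Or.inl ⟨⟨h₁, h₂, (isChain_rel_iff k _).2 h₃⟩, fun b D hD hF =>
        h₄ b D hD hF.2.1 ((isChain_rel_iff k _).1 hF.2.2)⟩
    · exact Or.inr ⟨h₁, ⟨h₂, h₃⟩, fun b c hb hc => (rel_iff k b c).2 (h₄ b c hb hc)⟩

/-- Each side `x` of the arc offers two places for arrows: one ending at `x` and one starting at `j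
x`. If both sides `x` had an occupied place, there would be two arrows starting at the arc, two
ending at it, or one ending and one starting that do not follow each other. So both places are empty
for one of the sides. -/
theorem exists_entry_of_isTrivialAt {j : P.Side → P.Side} (hj : P.IsSideMap j)
    (hn : Function.Bijective P.next) {v : P.Arc} (h : IsTrivialAt j v) :
    ∃ s, ∃ hs : ¬ P.IsBoundary s, v = P.arc s hs ∧ P.NoIn s ∧ P.NoOut (j s) := by
  obtain ⟨s, hs, rfl⟩ := exists_arc v
  have hne := ne_glue hs
  have hg := not_isBoundary_glue hs
  have hjs : ∀ x : P.Side, x = s ∨ x = P.glue s → j x = s ∨ j x = P.glue s := by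
    rintro x (rfl | rfl)
    · exact hj.apply_eq _
    · rcases hj with rfl | rfl
      · exact Or.inr rfl
      · exact Or.inl (P.glue_glue _)
  have key : ∀ x y : P.Side, (x = s ∨ x = P.glue s) → (y = s ∨ y = P.glue s) → x ≠ y →
      (P.NoIn x ∧ P.NoOut (j x)) ∨ (P.NoIn y ∧ P.NoOut (j y)) := by
    intro x y hx hy hxy
    have hxb : ¬ P.IsBoundary x := by rcases hx with rfl | rfl <;> assumption
    have hyb : ¬ P.IsBoundary y := by rcases hy with rfl | rfl <;> assumption
    by_contra hcon
    rw [not_or, not_and_or, not_and_or] at hcon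
    have hin : ∀ z, (z = s ∨ z = P.glue s) → ¬ P.IsBoundary z → ¬ P.NoIn z →
        ∃ a : P.Arrow, P.quiver.t a = P.arc s hs ∧ P.next a.side = z := by
      intro z hz hzb hzi
      obtain ⟨a, ha⟩ := exists_arrow_of_not_noIn hn hzb hzi
      exact ⟨a, (t_eq_arc_iff hs a).2 (ha ▸ hz), ha⟩
    have hout : ∀ z, (z = s ∨ z = P.glue s) → ¬ P.IsBoundary z → ¬ P.NoOut (j z) →
        ∃ a : P.Arrow, P.quiver.s a = P.arc s hs ∧ a.side = j z := by
      intro z hz hzb hzi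
      obtain ⟨a, ha⟩ := exists_arrow_of_not_noOut (hj.not_isBoundary hzb) hzi
      exact ⟨a, (s_eq_arc_iff hs a).2 (ha ▸ hjs z hz), ha⟩
    rcases hcon with ⟨h1 | h1, h2 | h2⟩
    · obtain ⟨a, ha, ha'⟩ := hin x hx hxb h1
      obtain ⟨b, hb, hb'⟩ := hin y hy hyb h2
      have hab : a = b := h.t_inj a b ha hb
      exact hxy (by rw [← ha', ← hb', hab])
    · obtain ⟨a, ha, ha'⟩ := hin x hx hxb h1
      obtain ⟨b, hb, hb'⟩ := hout y hy hyb h2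
      have := h.follows a b ha hb
      rw [hb', ha'] at this
      exact hxy (hj.injective this).symm
    · obtain ⟨a, ha, ha'⟩ := hout x hx hxb h1
      obtain ⟨b, hb, hb'⟩ := hin y hy hyb h2
      have := h.follows b a hb ha
      rw [hb', ha'] at this
      exact hxy (hj.injective this)
    · obtain ⟨a, ha, ha'⟩ := hout x hx hxb h1
      obtain ⟨b, hb, hb'⟩ := hout y hy hyb h2
      have hab : a = b := h.s_inj a b ha hb
      exact hxy (hj.injective (by rw [← ha', ← hb', hab]))
  -- Which of the two sides is the entry depends on the arc; the other description of the same
  -- vertex is used in the second case.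
  rcases key s (P.glue s) (Or.inl rfl) (Or.inr rfl) hne with h | h
  · exact ⟨s, hs, rfl, h⟩
  · exact ⟨P.glue s, hg, (arc_glue hs).symm, h⟩

theorem isTrivialAt_of_entry {j : P.Side → P.Side} (hj : P.IsSideMap j)
    (hn : Function.Bijective P.next) {s : P.Side} (hs : ¬ P.IsBoundary s) (hi : P.NoIn s)
    (ho : P.NoOut (j s)) : IsTrivialAt j (P.arc s hs) := by
  have hin : ∀ b : P.Arrow, P.quiver.t b = P.arc s hs → P.next b.side = P.glue s := fun b hb =>
    ((t_eq_arc_iff hs b).1 hb).resolve_left (hi.next_ne hn b)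
  have hout : ∀ c : P.Arrow, P.quiver.s c = P.arc s hs → c.side = j (P.glue s) := by
    intro c hc
    have h1 := (s_eq_arc_iff hs c).1 hc
    have h2 := ho.ne c
    rcases hj with rfl | rfl
    · exact h1.resolve_left h2
    · rw [P.glue_glue]
      exact h1.resolve_right h2
  refine ⟨?_, ?_, ?_⟩
  · intro a b ha hb
    exact Arrow.ext_side ((hout a ha).trans (hout b hb).symm)
  · intro a b ha hb
    exact arrow_eq_of_next_eq hn ((hin a ha).trans (hin b hb).symm)
  · intro b c hb hc
    rw [hin b hb, hout c hc]

theorem exists_isThread_of_mem_permittedThreads (hn : Function.Bijective P.next)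
    {H : P.quiver.QPath} (hH : H ∈ (P.boundQuiver k).permittedThreads) :
    ∃ s, P.IsThread P.glue s H := by
  rcases (mem_permittedThreads_iff k H).1 hH with ⟨hne, hc, hmax⟩ | ⟨hnil, htriv⟩
  · obtain ⟨a, ha⟩ := exists_head?_eq hne
    refine ⟨_, isThread_of_maximal isSideMap_glue hn ha hc ?_ ?_⟩
    · intro b hb
      have hc' : (b :: H.arrows).IsChain fun a b => b.side = P.glue (P.next a.side) := by
        rw [List.isChain_cons]
        refine ⟨fun y hy => ?_, hc⟩
        rw [ha, Option.mem_def, Option.some.injEq] at hy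
        rw [← hy, hb]
      exact hmax b (QPath.ofChain (b :: H.arrows) b rfl
        (isChain_comp_of_follows isSideMap_glue hc')) (Or.inl rfl) hc'
    · intro c hlast b hb
      have hc' : (H.arrows ++ [b]).IsChain fun a b => b.side = P.glue (P.next a.side) := by
        rw [List.isChain_append]
        refine ⟨hc, by simp, fun x hx y hy => ?_⟩
        rw [hlast, Option.mem_def, Option.some.injEq] at hx
        rw [List.head?_cons, Option.mem_def, Option.some.injEq] at hy
        rw [← hx, ← hy, hb]
      refine hmax b (QPath.ofChain (H.arrows ++ [b]) a ?_
        (isChain_comp_of_follows isSideMap_glue hc')) (Or.inr rfl) hc'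
      rw [List.head?_append, ha]
      rfl
  · obtain ⟨s, hs, hv, hi, ho⟩ := exists_entry_of_isTrivialAt isSideMap_glue hn htriv
    refine ⟨s, ⟨hs, hi⟩, hv, ?_, ?_⟩
    · simp [hnil]
    · rw [show H.length = 0 by simp [QPath.length, hnil]]
      exact ho

theorem IsThread.mem_permittedThreads (hn : Function.Bijective P.next) {s : P.Side}
    {H : P.quiver.QPath} (h : P.IsThread P.glue s H) :
    H ∈ (P.boundQuiver k).permittedThreads := by
  rw [mem_permittedThreads_iff]
  by_cases hH : H.arrows = []
  · right
    refine ⟨hH, ?_⟩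
    rw [h.src]
    exact isTrivialAt_of_entry isSideMap_glue hn h.entry.1 h.entry.2 (h.noOut_of_nil hH)
  · left
    refine ⟨hH, h.isChain, ?_⟩
    intro b D hD hc
    rcases hD with hD | hD
    · rw [hD, List.isChain_cons] at hc
      obtain ⟨a, ha⟩ := exists_head?_eq hH
      exact h.not_follows_head isSideMap_glue hn ha b (hc.1 a ha)
    · rw [hD, List.isChain_append] at hc
      obtain ⟨a, ha⟩ := exists_getLast?_eq hH
      exact h.not_last_follows ha b (hc.2.2 a ha b rfl)

/-- A repetition would, by injectivity of `next`, bring the path back to its entry. The side before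
the entry is a boundary segment, and the path never meets one. -/
theorem IsThread.nodup (hn : Function.Bijective P.next) {s : P.Side} {F : P.quiver.QPath}
    (h : P.IsThread id s F) : F.arrows.Nodup := by
  have key : ∀ i i' (hlt : i < i') (hi' : i' < F.arrows.length),
      F.arrows[i]'(hlt.trans hi') ≠ F.arrows[i'] := by
    intro i i' hlt hi' heq
    have e : (P.step id)^[i] s = (P.step id)^[i'] s := by
      have h1 := h.arrows i _ (List.getElem?_eq_getElem (hlt.trans hi'))
      have h2 := h.arrows i' _ (List.getElem?_eq_getElem hi')
      rw [heq, h2] at h1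
      exact h1.symm
    have hinj : Function.Injective (P.step id) := hn.1
    obtain ⟨d, rfl⟩ : ∃ d, i' = i + (d + 1) := ⟨i' - i - 1, by omega⟩
    rw [Function.iterate_add_apply] at e
    have e' := hinj.iterate i e
    rw [iterate_step_succ] at e'
    obtain ⟨b, hb, hb'⟩ := h.entry.2
    have hbd : b = (P.step id)^[d] s := hn.1 (hb'.trans e')
    exact h.not_isBoundary (i := d) (by change d ≤ F.arrows.length; omega) (hbd ▸ hb)
  refine List.nodup_iff_getElem?_ne_getElem?.2 fun i i' hlt hi' heq => ?_
  rw [List.getElem?_eq_getElem (hlt.trans hi'), List.getElem?_eq_getElem hi', Option.some.injEq]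
    at heq
  exact key i i' hlt hi' heq

theorem IsThread.mem_forbiddenThreads (hn : Function.Bijective P.next) {s : P.Side}
    {F : P.quiver.QPath} (h : P.IsThread id s F) :
    F ∈ (P.boundQuiver k).forbiddenThreads := by
  rw [mem_forbiddenThreads_iff]
  by_cases hF : F.arrows = []
  · right
    refine ⟨hF, ?_⟩
    rw [h.src]
    exact isTrivialAt_of_entry isSideMap_id hn h.entry.1 h.entry.2 (h.noOut_of_nil hF)
  · left
    refine ⟨hF, h.nodup hn, h.isChain, ?_⟩
    intro b D hD _ hc
    rcases hD with hD | hD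
    · rw [hD, List.isChain_cons] at hc
      obtain ⟨a, ha⟩ := exists_head?_eq hF
      exact h.not_follows_head isSideMap_id hn ha b (hc.1 a ha)
    · rw [hD, List.isChain_append] at hc
      obtain ⟨a, ha⟩ := exists_getLast?_eq hF
      exact h.not_last_follows ha b (hc.2.2 a ha b rfl)

/-- A forbidden thread ending at a side that is followed by a boundary segment runs around a
polygon from an entry to that side. -/
theorem exists_isThread_of_mem_forbiddenThreads (hn : Function.Bijective P.next)
    {F : P.quiver.QPath} (hF : F ∈ (P.boundQuiver k).forbiddenThreads) {e : P.Side}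
    (he : ¬ P.IsBoundary e) (ho : P.NoOut e)
    (h₁ : ∀ b : P.Arrow, F.arrows.getLast? = some b → P.next b.side = e)
    (h₂ : F.arrows = [] → F.src = P.arc e he ∧ P.NoIn e) :
    ∃ s, P.IsThread id s F ∧ (P.step id)^[F.length] s = e := by
  rcases (mem_forbiddenThreads_iff k F).1 hF with ⟨hne, hnd, hc, hmax⟩ | ⟨hnil, -⟩
  · obtain ⟨a, ha⟩ := exists_head?_eq hne
    obtain ⟨c, hlast⟩ := exists_getLast?_eq hne
    have hT : P.IsThread id (id a.side) F := by
      refine isThread_of_maximal isSideMap_id hn ha hc ?_ ?_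
      · intro b hb
        have hc' : (b :: F.arrows).IsChain fun a b => b.side = id (P.next a.side) := by
          rw [List.isChain_cons]
          refine ⟨fun y hy => ?_, hc⟩
          rw [ha, Option.mem_def, Option.some.injEq] at hy
          rw [← hy, hb]
        -- Forbidden paths have distinct arrows, so a prolongation by `b` can fail only because `b`
        -- already occurs. If `b` is not last, its successor repeats the first arrow; if it is last,
        -- the first arrow would start at `e`, which is followed by a boundary segment.
        have hbF : b ∈ F.arrows := by
          by_contra hbF
          exact hmax b (QPath.ofChain (b :: F.arrows) b rfl
            (isChain_comp_of_follows isSideMap_id hc')) (Or.inl rfl)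
            (List.nodup_cons.2 ⟨hbF, hnd⟩) hc'
        obtain ⟨i, hi, rfl⟩ := List.getElem_of_mem hbF
        by_cases hi' : i + 1 < F.arrows.length
        · have h3 := List.isChain_iff_getElem.1 hc i hi'
          have h4 : F.arrows[0] = F.arrows[i + 1] := by
            rw [List.head?_eq_getElem?, List.getElem?_eq_some_iff] at ha
            obtain ⟨h0, ha⟩ := ha
            exact Arrow.ext_side (by rw [ha, hb, h3])
          have := (List.Nodup.getElem_inj_iff hnd).1 h4
          omega
        · rw [List.getLast?_eq_getElem?, List.getElem?_eq_some_iff] at hlast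
          obtain ⟨h0, hlast⟩ := hlast
          have h5 : F.arrows[i] = c := by
            rw [← hlast]
            congr 1
            omega
          have h6 := h₁ c (by
            rw [List.getLast?_eq_getElem?, List.getElem?_eq_some_iff]; exact ⟨h0, hlast⟩)
          rw [h5, h6] at hb
          exact ho.ne a hb
      · intro d hd b hb
        rw [h₁ d hd] at hb
        exact ho.ne b hb
    exact ⟨_, hT, by rw [← hT.next_last hlast, h₁ c hlast]⟩
  · obtain ⟨hsrc, hin⟩ := h₂ hnil
    have hlen : F.length = 0 := by simp [QPath.length, hnil]
    refine ⟨e, ⟨⟨he, hin⟩, hsrc, ?_, ?_⟩, ?_⟩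
    · simp [hnil]
    · rw [hlen]
      exact ho
    · rw [hlen]
      rfl

end PolygonGluing

/-! ### Sign functions and the maps `φ` and `ψ` on threads. -/

namespace PolygonGluing

open FinQuiver BoundQuiver

variable {P : PolygonGluing} {k : Type*} [Field k] {σ ε : P.Arrow → ℤˣ}

theorem head?_ne_some {α : Type*} {l : List α} (h : l = []) (a : α) : l.head? ≠ some a := by
  simp [h]

theorem getLast?_ne_some {α : Type*} {l : List α} (h : l = []) (a : α) :
    l.getLast? ≠ some a := by
  simp [h]

/-- Give opposite signs to the two sides of each arc, using a well-ordering of the sides to choose.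
An arrow takes `σ` from the side where it starts and `ε` from the side where it ends. Distinct
arrows with a common source or target use opposite sides of that arc, and a non-relation crosses it.
-/
theorem exists_isSignPair (k : Type*) [Field k] (hn : Function.Bijective P.next) :
    ∃ σ ε, (P.boundQuiver k).IsSignPair σ ε := by
  classical
  let θ : P.Side → ℤˣ := fun s => if WellOrderingRel s (P.glue s) then 1 else -1
  have hθ : ∀ s, ¬ P.IsBoundary s → θ (P.glue s) = -θ s := by
    intro s hs
    simp only [θ, P.glue_glue]
    rcases trichotomous_of WellOrderingRel s (P.glue s) with h | h | h
    · rw [if_pos h, if_neg (asymm h)]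
    · exact absurd h.symm hs
    · rw [if_pos h, if_neg (asymm h), neg_neg]
  refine ⟨fun a : P.Arrow => θ a.side, fun a : P.Arrow => θ (P.next a.side), ?_, ?_, ?_⟩
  · intro (a : P.Arrow) (b : P.Arrow) hab h
    rcases (s_eq_arc_iff b.not_isBoundary a).1 h with h | h
    · exact absurd (Arrow.ext_side h) hab
    · rw [h, hθ _ b.not_isBoundary]
  · intro (a : P.Arrow) (b : P.Arrow) hab h
    rcases (t_eq_arc_iff b.not_isBoundary_next a).1 h with h' | h'
    · exact absurd (arrow_eq_of_next_eq hn h') hab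
    · rw [h', hθ _ b.not_isBoundary_next]
  · intro (a : P.Arrow) (b : P.Arrow) h
    rw [(nonRel_iff k a b).1 h, hθ _ a.not_isBoundary_next]

/-- The forbidden thread ends at the same arc as `H`. If it arrived on the same side, its last arrow
would be that of `H` and the signs would agree instead of being opposite; so it arrives on the other
side, where the permitted thread is blocked by a boundary segment. -/
theorem exists_isThread_of_isPhi (hn : Function.Bijective P.next)
    {s : P.Side} {H F : P.quiver.QPath} (hH : P.IsThread P.glue s H)
    (hφ : IsPhi (B := P.boundQuiver k) σ ε H F) :
    ∃ t, P.IsThread id t F ∧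
      (P.step id)^[F.length] t = P.glue ((P.step P.glue)^[H.length] s) := by
  obtain ⟨hF, htgt, x, ⟨hx₁, hx₂⟩, ⟨hy₁, hy₂⟩⟩ := hφ
  have he := hH.not_isBoundary le_rfl
  have ho := hH.noOut
  have htgt' : F.tgt = P.arc _ he := htgt.trans hH.tgt
  have hlen : H.arrows = [] → H.length = 0 := fun h => by simp [QPath.length, h]
  have hsrc : H.arrows = [] → H.src = P.arc _ he := fun h =>
    (QPath.tgt_eq_of_nil h).symm.trans hH.tgt
  have hlast : ∀ a : P.Arrow, H.arrows.getLast? = some a →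
      P.next a.side = (P.step P.glue)^[H.length] s := fun a ha => hH.next_last ha
  have hin : H.arrows = [] → P.NoIn ((P.step P.glue)^[H.length] s) := fun h => by
    rw [hlen h]
    exact hH.entry.2
  generalize (P.step P.glue)^[H.length] s = e at *
  have hge := not_isBoundary_glue he
  refine exists_isThread_of_mem_forbiddenThreads k hn hF hge ho ?_ ?_
  · intro b hb
    have htb : P.quiver.t b = P.arc e he := (QPath.tgt_eq_of_getLast? hb).symm.trans htgt'
    refine ((t_eq_arc_iff he b).1 htb).resolve_left fun hbe => ?_
    by_cases hnil : H.arrows = []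
    · exact (hin hnil).next_ne hn b hbe
    · obtain ⟨a, ha⟩ := exists_getLast?_eq hnil
      have hab : a = b := arrow_eq_of_next_eq hn ((hlast a ha).trans hbe.symm)
      have h1 : x = ε a := hx₁ a ha
      have h2 : -x = ε b := hy₁ b hb
      rw [h1, hab] at h2
      exact units_ne_neg_self _ h2.symm
  · intro hFnil
    have hFsrc : F.src = P.arc e he := (QPath.tgt_eq_of_nil hFnil).symm.trans htgt'
    refine ⟨hFsrc.trans (arc_glue he).symm, ?_⟩
    by_contra hni
    obtain ⟨b, hb⟩ := exists_arrow_of_not_noIn hn hge hni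
    have htb : P.quiver.t b = P.arc e he := (t_eq_arc_iff he b).2 (Or.inr hb)
    obtain ⟨htriv⟩ : Nonempty (PLift (IsTrivialAt id F.src)) := by
      rcases (mem_forbiddenThreads_iff k F).1 hF with ⟨h, -⟩ | ⟨-, h⟩
      · exact absurd hFnil h
      · exact ⟨⟨h⟩⟩
    replace htriv := htriv.down
    rw [hFsrc] at htriv
    -- When both threads are trivial and `b` arrives at the other side, no arrow starts at the arc.
    -- Then both signs are read off from `b`, and the conventions for trivial threads give a
    -- contradiction.
    by_cases hnil : H.arrows = []
    · have hns : ∀ c : P.Arrow, P.quiver.s c ≠ P.arc e he := by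
        intro c hc
        have := htriv.follows b c htb hc
        rw [hb] at this
        exact ho.ne c this
      have h1 := (hx₂ hnil).2 hnil
      have h2 : -x = ε b := h1.2 (fun c hc => hns c (hc.trans (hsrc hnil))) b
        (htb.trans (hsrc hnil).symm)
      have h3 : -x = -ε b := (hy₂ hFnil).1 b (htb.trans hFsrc.symm)
      rw [h2] at h3
      exact units_ne_neg_self _ h3
    · obtain ⟨a, ha⟩ := exists_getLast?_eq hnil
      have hta : P.quiver.t a = P.arc e he := (t_eq_arc_iff he a).2 (Or.inl (hlast a ha))
      have hab := htriv.t_inj a b hta htb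
      rw [hab] at ha
      exact ne_glue he ((hlast b ha).symm.trans hb)

/-- A common value of the two signs has to be exhibited. It comes from the last arrow of `H`, or
else from the last arrow of `F`, or else from an arrow starting at the arc. -/
theorem isPhi_of_isThread (hn : Function.Bijective P.next)
    (hiso : ∀ s, ¬ P.IsBoundary s →
      ¬ (P.NoIn s ∧ P.NoOut s ∧ P.NoIn (P.glue s) ∧ P.NoOut (P.glue s)))
    (hσ : (P.boundQuiver k).IsSignPair σ ε) {s t : P.Side} {H F : P.quiver.QPath}
    (hH : P.IsThread P.glue s H) (hF : P.IsThread id t F)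
    (hst : (P.step id)^[F.length] t = P.glue ((P.step P.glue)^[H.length] s)) :
    IsPhi (B := P.boundQuiver k) σ ε H F := by
  have he := hH.not_isBoundary le_rfl
  have ho := hH.noOut
  have hge := not_isBoundary_glue he
  have hFtgt : F.tgt = P.arc _ he := by
    rw [hF.tgt, ← arc_glue he]
    congr 1
  refine ⟨hF.mem_forbiddenThreads k hn, hFtgt.trans hH.tgt.symm, ?_⟩
  have hlen : H.arrows = [] → H.length = 0 := fun h => by simp [QPath.length, h]
  have hsrc : H.arrows = [] → H.src = P.arc _ he := fun h =>
    (QPath.tgt_eq_of_nil h).symm.trans hH.tgt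
  have hFsrc : F.arrows = [] → F.src = P.arc _ he := fun h =>
    (QPath.tgt_eq_of_nil h).symm.trans hFtgt
  have hlast : ∀ a : P.Arrow, H.arrows.getLast? = some a →
      P.next a.side = (P.step P.glue)^[H.length] s := fun a ha => hH.next_last ha
  have hFlast : ∀ b : P.Arrow, F.arrows.getLast? = some b →
      P.next b.side = P.glue ((P.step P.glue)^[H.length] s) := fun b hb =>
    (hF.next_last hb).trans hst
  have hin : H.arrows = [] → P.NoIn ((P.step P.glue)^[H.length] s) := fun h => by
    rw [hlen h]
    exact hH.entry.2
  have hFin : F.arrows = [] → P.NoIn (P.glue ((P.step P.glue)^[H.length] s)) := fun h => by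
    rw [← hst, show F.length = 0 by simp [QPath.length, h]]
    exact hF.entry.2
  generalize (P.step P.glue)^[H.length] s = e at *
  by_cases hnil : H.arrows = []
  · have hs : ∀ c : P.Arrow, P.quiver.s c = P.arc e he → c.side = e := fun c hc =>
      ((s_eq_arc_iff he c).1 hc).resolve_right (ho.ne c)
    have ht : ∀ b : P.Arrow, P.quiver.t b = P.arc e he → P.next b.side = P.glue e := fun b hb =>
      ((t_eq_arc_iff he b).1 hb).resolve_left ((hin hnil).next_ne hn b)
    by_cases hFnil : F.arrows = []
    -- With both threads trivial, three of the four possible places of arrows at this arc are empty.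
    -- As the arc is not isolated, the fourth place holds an arrow `c`, which fixes the signs.
    · have hout : ¬ P.NoOut e := fun h => hiso e he ⟨hin hnil, h, hFin hFnil, ho⟩
      obtain ⟨c, hc⟩ := exists_arrow_of_not_noOut he hout
      have hsc : P.quiver.s c = P.arc e he := (s_eq_arc_iff he c).2 (Or.inl hc)
      have hc' : ∀ a : P.Arrow, P.quiver.s a = P.arc e he → a = c := fun a ha =>
        Arrow.ext_side ((hs a ha).trans hc.symm)
      refine ⟨σ c, ⟨?_, ?_⟩, ⟨?_, ?_⟩⟩
      · intro a ha
        exact absurd ha (getLast?_ne_some hnil a)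
      · intro _
        refine ⟨?_, fun _ => ⟨?_, ?_⟩⟩
        · intro a ha
          exact absurd ha (head?_ne_some hnil a)
        · intro (a : P.Arrow) ha
          rw [hc' a (ha.trans (hsrc hnil))]
        · intro h
          exact absurd (hsc.trans (hsrc hnil).symm) (h c)
      · intro a ha
        exact absurd ha (getLast?_ne_some hFnil a)
      · intro _
        refine ⟨?_, fun _ => ?_⟩
        · intro (b : P.Arrow) hb
          exact absurd (ht b (hb.trans (hFsrc hFnil))) ((hFin hFnil).next_ne hn b)
        · intro (a : P.Arrow) ha
          rw [hc' a (ha.trans (hFsrc hFnil))]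
    · obtain ⟨b, hb⟩ := exists_getLast?_eq hFnil
      have hb' := hFlast b hb
      have htb : P.quiver.t b = P.arc e he := (t_eq_arc_iff he b).2 (Or.inr hb')
      refine ⟨-ε b, ⟨?_, ?_⟩, ⟨?_, ?_⟩⟩
      · intro a ha
        exact absurd ha (getLast?_ne_some hnil a)
      · intro _
        refine ⟨?_, fun _ => ⟨?_, ?_⟩⟩
        · intro a ha
          exact absurd ha (head?_ne_some hnil a)
        · intro (c : P.Arrow) hc
          have := hσ.comp b c ((nonRel_iff k b c).2 (by
            rw [hb', P.glue_glue]; exact hs c (hc.trans (hsrc hnil))))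
          rw [this]
        · intro _ (d : P.Arrow) hd
          rw [neg_neg, arrow_eq_of_next_eq hn ((ht d (hd.trans (hsrc hnil))).trans hb'.symm)]
      · intro (a : P.Arrow) ha
        have hab : b = a := Option.some.inj (hb.symm.trans ha)
        rw [neg_neg, hab]
      · intro h
        exact absurd h hFnil
  · obtain ⟨a, ha⟩ := exists_getLast?_eq hnil
    have ha' := hlast a ha
    have hta : P.quiver.t a = P.arc e he := (t_eq_arc_iff he a).2 (Or.inl ha')
    refine ⟨ε a, ⟨?_, ?_⟩, ⟨?_, ?_⟩⟩
    · intro (b : P.Arrow) hb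
      have hab : a = b := Option.some.inj (ha.symm.trans hb)
      rw [hab]
    · intro h
      exact absurd h hnil
    · intro (b : P.Arrow) hb
      have hb' := hFlast b hb
      have htb : P.quiver.t b = P.arc e he := (t_eq_arc_iff he b).2 (Or.inr hb')
      refine (hσ.end_ne b a ?_ (htb.trans hta.symm)).symm
      rintro rfl
      exact ne_glue he (ha'.symm.trans hb')
    · intro hFnil
      refine ⟨?_, ?_⟩
      · intro (b : P.Arrow) hb
        have hb' := ((t_eq_arc_iff he b).1 (hb.trans (hFsrc hFnil))).resolve_right
          ((hFin hFnil).next_ne hn b)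
        rw [arrow_eq_of_next_eq hn (ha'.trans hb'.symm)]
      · intro h
        exact absurd (hta.trans (hFsrc hFnil).symm) (h a)

/-- The permitted thread starts at one of the two sides of the arc of `t`. The opposite side is
impossible: both threads would then have the same first arrow, or both would be trivial with signs
read off from the same arrow, against the requirement of opposite signs. -/
theorem isThread_of_isPsi (hn : Function.Bijective P.next)
    (hiso : ∀ s, ¬ P.IsBoundary s →
      ¬ (P.NoIn s ∧ P.NoOut s ∧ P.NoIn (P.glue s) ∧ P.NoOut (P.glue s)))
    {t : P.Side} {F H : P.quiver.QPath}
    (hF : P.IsThread id t F) (hψ : IsPsi (B := P.boundQuiver k) σ ε F H) :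
    P.IsThread P.glue t H := by
  obtain ⟨hH, hsrc, x, ⟨hx₁, hx₂⟩, ⟨hy₁, hy₂⟩⟩ := hψ
  obtain ⟨s, hs⟩ := exists_isThread_of_mem_permittedThreads k hn hH
  have hst := (arc_eq_arc_iff hs.entry.1 hF.entry.1).1 (hs.src.symm.trans (hsrc.trans hF.src))
  rcases hst with rfl | hts
  · exact hs
  exfalso
  have htb := hF.entry.1
  have hgt : s = P.glue t := by rw [hts, P.glue_glue]
  by_cases hnil : H.arrows = []
  · have hout : P.NoOut t := hts ▸ hs.noOut_of_nil hnil
    have hFnil : F.arrows = [] := by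
      by_contra hFnil
      obtain ⟨b, hb⟩ := exists_head?_eq hFnil
      exact hout.ne b (hF.head hb)
    have hout' : ¬ P.NoOut (P.glue t) := fun h =>
      hiso t htb ⟨hF.entry.2, hout, hgt ▸ hs.entry.2, h⟩
    obtain ⟨c, hc⟩ := exists_arrow_of_not_noOut (not_isBoundary_glue htb) hout'
    have hsc : P.quiver.s c = P.arc t htb := (s_eq_arc_iff htb c).2 (Or.inr hc)
    have h1 : x = -σ c := (hx₂ hFnil).1 c (hsc.trans hF.src.symm)
    have h2 : -x = -σ c := (hy₂ hnil).1 c (hsc.trans (hsrc.trans hF.src).symm)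
    rw [← h1] at h2
    exact units_ne_neg_self _ h2.symm
  · obtain ⟨a, ha⟩ := exists_head?_eq hnil
    have ha' : a.side = t := (hs.head ha).trans hts.symm
    have hFnil : F.arrows ≠ [] := fun h => (hF.noOut_of_nil h).ne a ha'
    obtain ⟨b, hb⟩ := exists_head?_eq hFnil
    have hab : a = b := Arrow.ext_side (ha'.trans (hF.head hb).symm)
    have h1 : x = σ b := hx₁ b hb
    have h2 : -x = σ a := hy₁ a ha
    rw [hab, ← h1] at h2
    exact units_ne_neg_self _ h2.symm

/-- The sign is taken from the first arrow of `F`, or else from the first arrow of `H`. If both are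
trivial, the only arrow left at the non-isolated arc ends there, which is the case of the
conventions using `ε`. -/
theorem isPsi_of_isThread (hn : Function.Bijective P.next)
    (hiso : ∀ s, ¬ P.IsBoundary s →
      ¬ (P.NoIn s ∧ P.NoOut s ∧ P.NoIn (P.glue s) ∧ P.NoOut (P.glue s)))
    (hσ : (P.boundQuiver k).IsSignPair σ ε) {t : P.Side} {F H : P.quiver.QPath}
    (hF : P.IsThread id t F) (hH : P.IsThread P.glue t H) :
    IsPsi (B := P.boundQuiver k) σ ε F H := by
  have ht := hF.entry.1
  refine ⟨hH.mem_permittedThreads k hn, hH.src.trans hF.src.symm, ?_⟩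
  by_cases hFnil : F.arrows = []
  · have hout : P.NoOut t := hF.noOut_of_nil hFnil
    have hFs : ∀ c : P.Arrow, P.quiver.s c = P.arc t ht → c.side = P.glue t := fun c hc =>
      ((s_eq_arc_iff ht c).1 hc).resolve_left (hout.ne c)
    have hFt : ∀ d : P.Arrow, P.quiver.t d = P.arc t ht → P.next d.side = P.glue t := fun d hd =>
      ((t_eq_arc_iff ht d).1 hd).resolve_left (hF.entry.2.next_ne hn d)
    by_cases hnil : H.arrows = []
    · have hout' : P.NoOut (P.glue t) := hH.noOut_of_nil hnil
      have hin : ¬ P.NoIn (P.glue t) := fun h => hiso t ht ⟨hF.entry.2, hout, h, hout'⟩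
      obtain ⟨d, hd⟩ := exists_arrow_of_not_noIn hn (not_isBoundary_glue ht) hin
      refine ⟨-ε d, ⟨?_, fun _ => ⟨?_, fun _ => ?_⟩⟩, ⟨?_, fun _ => ⟨?_, fun _ => ?_⟩⟩⟩
      · intro a ha
        exact absurd ha (head?_ne_some hFnil a)
      · intro (c : P.Arrow) hc
        exact absurd (hFs c (hc.trans hF.src)) (hout'.ne c)
      · intro (d' : P.Arrow) hd'
        rw [arrow_eq_of_next_eq hn ((hFt d' (hd'.trans hF.src)).trans hd.symm)]
      · intro a ha
        exact absurd ha (head?_ne_some hnil a)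
      · intro (c : P.Arrow) hc
        exact absurd (hFs c (hc.trans hH.src)) (hout'.ne c)
      · intro (d' : P.Arrow) hd'
        rw [neg_neg, arrow_eq_of_next_eq hn ((hFt d' (hd'.trans hH.src)).trans hd.symm)]
    · obtain ⟨c, hc⟩ := exists_head?_eq hnil
      have hc' := hH.head hc
      refine ⟨-σ c, ⟨?_, fun _ => ⟨?_, fun h => ?_⟩⟩, ⟨?_, fun h => absurd h hnil⟩⟩
      · intro a ha
        exact absurd ha (head?_ne_some hFnil a)
      · intro (a : P.Arrow) ha
        rw [Arrow.ext_side ((hFs a (ha.trans hF.src)).trans hc'.symm)]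
      · exact absurd (((s_eq_arc_iff ht c).2 (Or.inr hc')).trans hF.src.symm) (h c)
      · intro (a : P.Arrow) ha
        have hac : c = a := Option.some.inj (hc.symm.trans ha)
        rw [neg_neg, hac]
  · obtain ⟨b, hb⟩ := exists_head?_eq hFnil
    have hb' : b.side = t := hF.head hb
    have hsb : P.quiver.s b = P.arc t ht := (s_eq_arc_iff ht b).2 (Or.inl hb')
    refine ⟨σ b, ⟨?_, fun h => absurd h hFnil⟩, ⟨?_, fun hnil => ⟨?_, fun h => ?_⟩⟩⟩
    · intro (a : P.Arrow) ha
      have hac : b = a := Option.some.inj (hb.symm.trans ha)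
      rw [hac]
    · intro (c : P.Arrow) hc
      have hc' := hH.head hc
      have hsc : P.quiver.s c = P.arc t ht := (s_eq_arc_iff ht c).2 (Or.inr hc')
      refine (hσ.start_ne c b ?_ (hsc.trans hsb.symm)).symm
      rintro rfl
      exact ne_glue ht (hb'.symm.trans hc')
    · intro (a : P.Arrow) ha
      have ha' := ((s_eq_arc_iff ht a).1 (ha.trans hH.src)).resolve_right
        ((hH.noOut_of_nil hnil).ne a)
      rw [Arrow.ext_side (ha'.trans hb'.symm)]
    · exact absurd (hsb.trans hH.src.symm) (h b)

end PolygonGluing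

/-! ### Runs of the algorithm as orbits of `rho`. -/

namespace PolygonGluing

open FinQuiver BoundQuiver

variable (P : PolygonGluing)

/-- The conditions on a gluing of polygons under which the threads of its quiver correspond to the
entries: no arc is isolated, going around a vertex one meets the boundary, and the sides of a
polygon that are boundary segments are consecutive. -/
structure IsRegular : Prop where
  bijective : Function.Bijective P.next
  not_isolated : ∀ s, ¬ P.IsBoundary s →
    ¬ (P.NoIn s ∧ P.NoOut s ∧ P.NoIn (P.glue s) ∧ P.NoOut (P.glue s))
  exists_isBoundary : ∀ s, ∃ i, P.IsBoundary (P.rho^[i] s)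
  exists_run : ∀ e, ¬ P.IsBoundary e → P.NoOut e → ∃ t l j, P.Entry t ∧
    (P.step id)^[l] t = e ∧ (∀ i ≤ l, ¬ P.IsBoundary ((P.step id)^[i] t)) ∧
    (∀ i ≤ j, P.IsBoundary ((P.step id)^[i + 1] e)) ∧ (P.step id)^[j + 2] e = t

/-- `t` is the first entry that is met when `rho` is iterated, starting from `s`. -/
def IsNextEntry (s t : P.Side) : Prop :=
  ∃ n, P.rho^[n + 1] s = t ∧ P.Entry t ∧ ∀ i, 0 < i → i ≤ n → ¬ P.Entry (P.rho^[i] s)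

/-- The length of the forbidden thread starting at an entry. -/
def forbiddenLength (t : P.Side) : ℕ := sInf {l | P.IsBoundary ((P.step id)^[l + 1] t)}

/-- The entries that are met when `rho` is iterated, starting from `s`. -/
def entryOrbit (s : P.Side) : Set P.Side := {t | P.Entry t ∧ ∃ i, P.rho^[i] s = t}

variable {P}

theorem IsThread.length_eq_forbiddenLength {t : P.Side} {F : P.quiver.QPath}
    (h : P.IsThread id t F) : F.length = P.forbiddenLength t := by
  refine h.length_eq_of_isBoundary (Nat.sInf_mem (s := {l | P.IsBoundary ((P.step id)^[l + 1] t)})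
    ⟨_, h.last⟩) fun i hi => ?_
  cases i with
  | zero => exact h.entry.1
  | succ i => exact fun hb => Nat.notMem_of_lt_sInf hi hb

theorem IsNextEntry.unique {s t t' : P.Side} (h : P.IsNextEntry s t) (h' : P.IsNextEntry s t') :
    t = t' := by
  obtain ⟨n, hn, ht, hlt⟩ := h
  obtain ⟨n', hn', ht', hlt'⟩ := h'
  have : n = n' := by
    by_contra hne
    rcases lt_or_gt_of_ne hne with h | h
    · exact hlt' (n + 1) n.succ_pos h (hn ▸ ht)
    · exact hlt (n' + 1) n'.succ_pos h (hn' ▸ ht')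
  rw [← hn, ← hn', this]

namespace IsRegular

/-- The source leaves only the two sides of one arc. The first arrow decides between them, and a
trivial path belonging to both would make the arc isolated. -/
theorem side_unique (hP : P.IsRegular) {s s' : P.Side} {H : P.quiver.QPath} (h : P.IsThread P.glue s H)
    (h' : P.IsThread P.glue s' H) : s = s' := by
  rcases (arc_eq_arc_iff h.entry.1 h'.entry.1).1 (h.src.symm.trans h'.src) with hs | hs
  · exact hs.symm
  · by_cases hnil : H.arrows = []
    · refine absurd ⟨h.entry.2, ?_, hs ▸ h'.entry.2, h.noOut_of_nil hnil⟩ (hP.not_isolated s h.entry.1)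
      have := h'.noOut_of_nil hnil
      rwa [hs, P.glue_glue] at this
    · obtain ⟨a, ha⟩ := exists_head?_eq hnil
      exact glue_injective ((h.head ha).symm.trans (h'.head ha))

theorem exists_thread (hP : P.IsRegular) {s : P.Side} (hs : P.Entry s) : ∃ H, P.IsThread P.glue s H := by
  classical
  have hex := hP.exists_isBoundary s
  have hpos : Nat.find hex ≠ 0 := fun h => by
    have := Nat.find_spec hex
    rw [h] at this
    exact hs.1 this
  obtain ⟨n, hn⟩ := Nat.exists_eq_succ_of_ne_zero hpos
  refine exists_isThread isSideMap_glue hs (n := n) ?_ fun i hi => ?_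
  · have := Nat.find_spec hex
    rwa [hn] at this
  · exact Nat.find_min hex (by omega)

/-- While `rho` follows `H`, every new side comes after a glued one, so no entry is met. Afterwards
`rho` runs through the consecutive boundary segments of the polygon containing `F`, and the first
side after them is the entry of `F`. -/
theorem isNextEntry_of_isThread (hP : P.IsRegular) {s t : P.Side} {H F : P.quiver.QPath}
    (hH : P.IsThread P.glue s H) (hF : P.IsThread id t F)
    (hst : (P.step id)^[F.length] t = P.glue (P.rho^[H.length] s)) : P.IsNextEntry s t := by
  have he := hH.not_isBoundary le_rfl
  have ho := hH.noOut
  obtain ⟨t', l, j, ht', htl, hnb, hbd, hret⟩ := hP.exists_run _ (not_isBoundary_glue he) ho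
  have hinj : Function.Injective (P.step id) := hP.bijective.1
  -- Going backwards from a common side, one cannot pass an entry without meeting a boundary
  -- segment. Used twice, this identifies the start of the polygon run with the entry of `F`.
  have aux : ∀ (x y : P.Side) (a b : ℕ), P.Entry x →
      (∀ i ≤ b, ¬ P.IsBoundary ((P.step id)^[i] y)) →
      (P.step id)^[a] x = (P.step id)^[b] y → b ≤ a := by
    intro x y a b hx hy hxy
    by_contra hlt
    obtain ⟨d, rfl⟩ : ∃ d, b = a + (d + 1) := ⟨b - a - 1, by omega⟩
    rw [Function.iterate_add_apply] at hxy
    have hx' := hinj.iterate a hxy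
    rw [iterate_step_succ] at hx'
    obtain ⟨c, hc, hc'⟩ := hx.2
    have := hP.bijective.1 (hc'.trans hx')
    exact hy d (by omega) ((show c = (P.step id)^[d] y from this) ▸ hc)
  have hlen : l = F.length := le_antisymm
    (aux t t' _ _ hF.entry hnb (hst.trans htl.symm))
    (aux t' t _ _ ht' (fun i hi => hF.not_isBoundary hi) (htl.trans hst.symm))
  have htt : t = t' := hinj.iterate F.length (by rw [hst, ← htl, hlen])
  subst htt
  -- On boundary segments `glue` is the identity, so there `rho` coincides with `next`.
  have hiter : ∀ i ≤ j + 1, P.rho^[i + (H.length + 1)] s =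
      (P.step id)^[i + 1] (P.glue (P.rho^[H.length] s)) := by
    intro i hi
    induction i with
    | zero => rw [zero_add, iterate_step_succ]; rfl
    | succ i ih =>
      rw [show i + 1 + (H.length + 1) = (i + (H.length + 1)) + 1 by omega, iterate_step_succ,
        ih (by omega), iterate_step_succ id (i + 1)]
      exact congrArg _ (hbd i (by omega))
  refine ⟨j + 1 + H.length, ?_, ht', ?_⟩
  · rw [show j + 1 + H.length + 1 = (j + 1) + (H.length + 1) by omega, hiter _ le_rfl, hret]
  · rintro i hi0 hi ⟨hib, c, hc, hc'⟩
    by_cases hir : i ≤ H.length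
    · obtain ⟨i, rfl⟩ := Nat.exists_eq_succ_of_ne_zero hi0.ne'
      rw [Nat.succ_eq_add_one, iterate_step_succ] at hc'
      have := hP.bijective.1 hc'
      exact not_isBoundary_glue (hH.not_isBoundary (by omega)) (this ▸ hc)
    · obtain ⟨d, rfl⟩ : ∃ d, i = d + (H.length + 1) := ⟨i - (H.length + 1), by omega⟩
      rw [hiter d (by omega)] at hib
      exact hib (hbd d (by omega))

theorem exists_isNextEntry (hP : P.IsRegular) {s : P.Side} {H : P.quiver.QPath} (hH : P.IsThread P.glue s H) :
    ∃ t F, P.IsThread id t F ∧ (P.step id)^[F.length] t = P.glue (P.rho^[H.length] s) := by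
  have he := hH.not_isBoundary le_rfl
  obtain ⟨t, l, j, ht, htl, hnb, hbd, -⟩ := hP.exists_run _ (not_isBoundary_glue he) hH.noOut
  have hl : P.IsBoundary ((P.step id)^[l + 1] t) := by
    have := hbd 0 (Nat.zero_le _)
    rw [iterate_step_succ] at this
    rw [iterate_step_succ, htl]
    exact this
  obtain ⟨F, hF⟩ := exists_isThread isSideMap_id ht hl hnb
  exact ⟨t, F, hF, by rw [hF.length_eq_of_isBoundary hl hnb, htl]⟩

theorem exists_entry_seq (hP : P.IsRegular) {s : P.Side} (hs : P.Entry s) :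
    ∃ u : ℕ → P.Side, u 0 = s ∧ ∀ i, P.IsNextEntry (u i) (u (i + 1)) := by
  have hex : ∀ x : {x // P.Entry x}, ∃ y : {x // P.Entry x}, P.IsNextEntry x.1 y.1 := by
    rintro ⟨x, hx⟩
    obtain ⟨H, hH⟩ := hP.exists_thread hx
    obtain ⟨t, F, hF, hst⟩ := hP.exists_isNextEntry hH
    exact ⟨⟨t, hF.entry⟩, hP.isNextEntry_of_isThread hH hF hst⟩
  choose g hg using hex
  refine ⟨fun i => (g^[i] ⟨s, hs⟩).1, rfl, fun i => ?_⟩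
  change P.IsNextEntry (g^[i] ⟨s, hs⟩).1 (g^[i + 1] ⟨s, hs⟩).1
  rw [Function.iterate_succ_apply']
  exact hg _

end IsRegular

section Seq

variable {u : ℕ → P.Side}

theorem exists_eq_of_entry (hu : ∀ i, P.IsNextEntry (u i) (u (i + 1)))
    (m : ℕ) (hm : P.Entry (P.rho^[m] (u 0))) :
    ∃ i, u i = P.rho^[m] (u 0) := by
  induction m using Nat.strong_induction_on generalizing u with
  | _ m ih =>
    rcases Nat.eq_zero_or_pos m with rfl | hpos
    · exact ⟨0, rfl⟩
    · obtain ⟨n, hn, -, hlt⟩ := hu 0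
      have hle : n + 1 ≤ m := by
        by_contra hcon
        exact hlt m hpos (by omega) hm
      obtain ⟨d, rfl⟩ := Nat.exists_eq_add_of_le' hle
      rw [Function.iterate_add_apply, hn] at hm ⊢
      obtain ⟨i, hi⟩ := ih d (by omega) (u := fun i => u (i + 1)) (fun i => hu (i + 1)) hm
      exact ⟨i + 1, hi⟩

theorem exists_iterate_eq (hu : ∀ i, P.IsNextEntry (u i) (u (i + 1)))
    (i : ℕ) : ∃ m, P.rho^[m] (u 0) = u i := by
  induction i with
  | zero => exact ⟨0, rfl⟩
  | succ i ih =>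
    obtain ⟨m, hm⟩ := ih
    obtain ⟨n, hn, -⟩ := hu i
    exact ⟨n + 1 + m, by rw [Function.iterate_add_apply, hm, hn]⟩

theorem eq_add_of_eq (hu : ∀ i, P.IsNextEntry (u i) (u (i + 1)))
    {i j : ℕ} (h : u i = u j) (d : ℕ) : u (i + d) = u (j + d) := by
  induction d with
  | zero => exact h
  | succ d ih =>
    have := hu (i + d)
    rw [ih] at this
    exact this.unique (hu (j + d))

/-- `rho` is injective on a finite set, so the first entry is periodic under it, and a return under
`rho` to an entry shows up in the sequence of successive entries. -/
theorem exists_pos_eq (hu : ∀ i, P.IsNextEntry (u i) (u (i + 1)))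
    [Finite P.Side] (hn : Function.Bijective P.next) (h₀ : P.Entry (u 0)) :
    ∃ n, 0 < n ∧ u n = u 0 := by
  have hinj : Function.Injective P.rho := fun x y h => glue_injective (hn.1 h)
  obtain ⟨p, hp, hper⟩ := hinj.mem_periodicPts (u 0)
  obtain ⟨n, hn, -⟩ := hu 0
  -- The period is multiplied by `n + 1` so that the return surely happens no earlier than the
  -- passage through `u 1`; this makes the index found positive.
  have hper' : P.rho^[p * (n + 1)] (u 0) = u 0 := (hper.mul_const (n + 1))
  obtain ⟨d, hd⟩ := Nat.exists_eq_add_of_le' (Nat.le_mul_of_pos_left (n + 1) hp)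
  rw [hd, Function.iterate_add_apply, hn] at hper'
  obtain ⟨i, hi⟩ := exists_eq_of_entry (u := fun i => u (i + 1)) (fun i => hu (i + 1)) d
    (hper'.symm ▸ h₀)
  exact ⟨i + 1, i.succ_pos, hi.trans hper'⟩

theorem image_Iio_eq_entryOrbit (hu : ∀ i, P.IsNextEntry (u i) (u (i + 1))) {n : ℕ}
    (hret : u n = u 0) (hpos : 0 < n) (h₀ : P.Entry (u 0)) :
    u '' Set.Iio n = P.entryOrbit (u 0) := by
  ext t
  constructor
  · rintro ⟨i, -, rfl⟩
    refine ⟨?_, exists_iterate_eq hu i⟩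
    cases i with
    | zero => exact h₀
    | succ i =>
      obtain ⟨_, _, h, _⟩ := hu i
      exact h
  · rintro ⟨ht, m, rfl⟩
    obtain ⟨i, hi⟩ := exists_eq_of_entry hu m ht
    have hmod : ∀ q r, u (r + n * q) = u r := by
      intro q r
      induction q with
      | zero => rfl
      | succ q ih =>
        have := eq_add_of_eq hu hret (r + n * q)
        rw [← ih, zero_add] at *
        rw [← this]
        congr 1
        ring
    refine ⟨i % n, Nat.mod_lt _ hpos, ?_⟩
    rw [← hi, ← hmod (i / n) (i % n), Nat.mod_add_div]

theorem injOn_Iio (hu : ∀ i, P.IsNextEntry (u i) (u (i + 1))) {n : ℕ}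
    (hret : u n = u 0) (hmin : ∀ j, 0 < j → j < n → u j ≠ u 0) : Set.InjOn u (Set.Iio n) := by
  have key : ∀ i j, i < j → j < n → u i ≠ u j := by
    intro i j hij hj h
    have := eq_add_of_eq hu h (n - j)
    rw [show j + (n - j) = n by omega, hret] at this
    exact hmin _ (by omega) (by omega) this
  intro i hi j hj h
  by_contra hne
  rcases lt_or_gt_of_ne hne with hlt | hlt
  · exact key i j hlt hj h
  · exact key j i hlt hi h.symm

end Seq

section Run

variable {k : Type*} [Field k] {σ ε : P.Arrow → ℤˣ}

/-- Through the correspondence of threads and entries, a run is a sequence of successive entries up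
to its first return. Such a sequence lists each entry of its `rho`-orbit once. -/
theorem IsRegular.isRun_iff [Finite P.Side] (hP : P.IsRegular)
    (hσ : (P.boundQuiver k).IsSignPair σ ε) (O : Set P.quiver.QPath) (n m : ℕ) :
    IsRun (B := P.boundQuiver k) σ ε O n m ↔ ∃ s, P.Entry s ∧ n = (P.entryOrbit s).ncard ∧
      m = ∑ t ∈ (Set.toFinite (P.entryOrbit s)).toFinset, P.forbiddenLength t ∧
      O = {H | ∃ t ∈ P.entryOrbit s, P.IsThread P.glue t H} := by
  classical
  have main : ∀ (u : ℕ → P.Side) (H F : ℕ → P.quiver.QPath) (N : ℕ),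
      (∀ i, P.IsThread P.glue (u i) (H i)) → (∀ i, P.IsThread id (u (i + 1)) (F i)) →
      (∀ i, P.IsNextEntry (u i) (u (i + 1))) → 0 < N → u N = u 0 →
      (∀ j, 0 < j → j < N → u j ≠ u 0) → N = (P.entryOrbit (u 0)).ncard ∧
      ∑ i ∈ Finset.range N, (F i).length =
        ∑ t ∈ (Set.toFinite (P.entryOrbit (u 0))).toFinset, P.forbiddenLength t ∧
      H '' Set.Iio N = {H | ∃ t ∈ P.entryOrbit (u 0), P.IsThread P.glue t H} := by
    intro u H F N hH hF hu hpos hret hmin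
    have himg := image_Iio_eq_entryOrbit hu hret hpos (hH 0).entry
    have hinj := injOn_Iio hu hret hmin
    refine ⟨?_, ?_, ?_⟩
    · rw [← himg, hinj.ncard_image, Set.ncard_eq_toFinset_card', Set.toFinset_Iio, Nat.card_Iio]
    · have hfin : (Set.toFinite (P.entryOrbit (u 0))).toFinset = (Finset.range N).image u := by
        ext t
        rw [Set.Finite.mem_toFinset, ← himg]
        simp
      rw [hfin, Finset.sum_image (by simpa using hinj),
        Finset.sum_congr rfl fun i _ => (hF i).length_eq_forbiddenLength]
      -- `F i` starts at `u (i + 1)`, so the sum is shifted by one; since `u N = u 0`, the shift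
      -- does not change it.
      have h1 := Finset.sum_range_succ (fun i => P.forbiddenLength (u i)) N
      rw [Finset.sum_range_succ', hret] at h1
      exact Nat.add_right_cancel h1
    · ext H'
      rw [Set.mem_ofPred_eq, ← himg]
      constructor
      · rintro ⟨i, hi, rfl⟩
        exact ⟨u i, ⟨i, hi, rfl⟩, hH i⟩
      · rintro ⟨_, ⟨i, hi, rfl⟩, h⟩
        exact ⟨i, hi, (hH i).unique h⟩
  constructor
  · rintro ⟨H, F, h₀, hφ, hψ, hpos, hret, hmin, rfl, rfl⟩
    have hperm : ∀ i, ∃ s, P.IsThread P.glue s (H i) := by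
      intro i
      refine exists_isThread_of_mem_permittedThreads k hP.bijective ?_
      cases i with
      | zero => exact h₀
      | succ i => exact (hψ i).1
    choose u hu using hperm
    have hstep : ∀ i, P.IsThread id (u (i + 1)) (F i) ∧ P.IsNextEntry (u i) (u (i + 1)) := by
      intro i
      obtain ⟨t, hF, hst⟩ := exists_isThread_of_isPhi hP.bijective (hu i) (hφ i)
      have hH' := isThread_of_isPsi hP.bijective hP.not_isolated hF (hψ i)
      have htu := hP.side_unique hH' (hu (i + 1))
      rw [← htu]
      exact ⟨hF, hP.isNextEntry_of_isThread (hu i) hF hst⟩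
    obtain ⟨h1, h2, h3⟩ := main u H F n hu (fun i => (hstep i).1) (fun i => (hstep i).2) hpos
      (hP.side_unique (hret ▸ hu n) (hu 0)) fun j hj hjn h =>
        hmin j hj hjn ((hu j).unique (h ▸ hu 0))
    exact ⟨u 0, (hu 0).entry, h1, h2, h3⟩
  · rintro ⟨s, hs, rfl, rfl, rfl⟩
    obtain ⟨u, rfl, hu⟩ := hP.exists_entry_seq hs
    have hent : ∀ i, P.Entry (u i) := by
      intro i
      cases i with
      | zero => exact hs
      | succ i =>
        obtain ⟨_, _, h, _⟩ := hu i
        exact h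
    choose H hH using fun i => hP.exists_thread (hent i)
    have hF : ∀ i, ∃ F, P.IsThread id (u (i + 1)) F ∧
        (P.step id)^[F.length] (u (i + 1)) = P.glue (P.rho^[(H i).length] (u i)) := by
      intro i
      obtain ⟨t, F, hF, hst⟩ := hP.exists_isNextEntry (hH i)
      have := (hP.isNextEntry_of_isThread (hH i) hF hst).unique (hu i)
      rw [← this]
      exact ⟨F, hF, hst⟩
    choose F hF hst using hF
    have hex := exists_pos_eq hu hP.bijective hs
    obtain ⟨hpos, hret⟩ := Nat.find_spec hex
    have hmin : ∀ j, 0 < j → j < Nat.find hex → u j ≠ u 0 := fun j hj hjn h =>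
      Nat.find_min hex hjn ⟨hj, h⟩
    obtain ⟨h1, h2, h3⟩ := main u H F _ hH hF hu hpos hret hmin
    refine ⟨H, F, (hH 0).mem_permittedThreads k hP.bijective, fun i => ?_, fun i => ?_,
      h1 ▸ hpos, ?_, ?_, ?_, ?_⟩
    · exact isPhi_of_isThread hP.bijective hP.not_isolated hσ (hH i) (hF i) (hst i)
    · exact isPsi_of_isThread hP.bijective hP.not_isolated hσ (hF i) (hH (i + 1))
    · rw [← h1]
      exact (hH _).unique (by rw [hret]; exact hH 0)
    · intro j hj hjn h
      rw [← h1] at hjn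
      exact hmin j hj hjn (hP.side_unique (h ▸ hH j) (hH 0))
    · rw [← h1]
      exact h2.symm
    · rw [← h1]
      exact h3.symm

/-- The map `κ` abstracts the boundary components: it labels the orbits of `rho`, and each label is
attained by an entry. A label is recovered from its set of permitted threads, so counting runs is
counting labels. -/
theorem IsRegular.AG_eq_ncard [Finite P.Side] (hP : P.IsRegular)
    (hσ : (P.boundQuiver k).IsSignPair σ ε) {Γ : Type*} (κ : P.Side → Γ)
    (hκ : ∀ s t, κ s = κ t ↔ ∃ i, P.rho^[i] s = t) (hΓ : ∀ c, ∃ s, P.Entry s ∧ κ s = c)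
    {n m : ℕ} (hn : n ≠ 0) :
    AG (B := P.boundQuiver k) σ ε n m = {c : Γ | n = {t | P.Entry t ∧ κ t = c}.ncard ∧
      m = ∑ t ∈ (Set.toFinite {t | P.Entry t ∧ κ t = c}).toFinset, P.forbiddenLength t}.ncard := by
  have horb : ∀ s, P.entryOrbit s = {t | P.Entry t ∧ κ t = κ s} := by
    intro s
    ext t
    exact and_congr_right fun _ => (hκ s t).symm.trans eq_comm
  let O : Γ → Set P.quiver.QPath := fun c => {H | ∃ t, (P.Entry t ∧ κ t = c) ∧ P.IsThread P.glue t H}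
  have hO : Function.Injective O := by
    intro c c' h
    obtain ⟨s, hs, rfl⟩ := hΓ c
    obtain ⟨H, hH⟩ := hP.exists_thread hs
    have hmem : H ∈ O (κ s) := ⟨s, ⟨hs, rfl⟩, hH⟩
    rw [h] at hmem
    obtain ⟨t, ⟨-, rfl⟩, hH'⟩ := hmem
    rw [hP.side_unique hH hH']
  refine (if_neg hn).trans ?_
  rw [← Set.ncard_image_of_injective _ hO]
  refine congrArg Set.ncard ?_
  ext X
  refine (hP.isRun_iff hσ X n m).trans ?_
  constructor
  · rintro ⟨s, -, h1, h2, h3⟩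
    refine ⟨κ s, ⟨?_, ?_⟩, ?_⟩
    · rw [h1, horb]
    · rw [h2]
      simp only [horb]
    · rw [h3, horb]
      rfl
  · rintro ⟨c, ⟨h1, h2⟩, rfl⟩
    obtain ⟨s, hs, rfl⟩ := hΓ c
    refine ⟨s, hs, ?_, ?_, ?_⟩
    · rw [h1, horb]
    · rw [h2]
      simp only [horb]
    · rw [horb]
      rfl

end Run

end PolygonGluing

/-! ### The closed triangle, its vertices and sides. -/

section Triangle

theorem eq_triVertex_iff (x : ClosedTriangle) (i : Fin 3) :
    x = triVertex i ↔ x.1 (i + 1) = 0 ∧ x.1 (i + 2) = 0 := by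
  constructor
  · rintro rfl
    fin_cases i <;> simp [triVertex]
  · rintro ⟨h₁, h₂⟩
    have hs := x.2.2
    rw [Fin.sum_univ_three] at hs
    refine Subtype.ext (funext fun l => ?_)
    change x.1 l = Pi.single (M := fun _ => ℝ) i 1 l
    fin_cases i <;> fin_cases l <;> simp_all

theorem triVertex_injective : Function.Injective triVertex := by
  intro i j h
  by_contra hne
  have := congrArg (fun x : ClosedTriangle => x.1 i) h
  simp [triVertex, hne] at this

theorem triVertex_mem_triSide (i : Fin 3) : triVertex i ∈ triSide i :=
  ((eq_triVertex_iff _ i).1 rfl).2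

theorem triVertex_succ_mem_triSide (i : Fin 3) : triVertex (i + 1) ∈ triSide i := by
  have := ((eq_triVertex_iff _ (i + 1)).1 rfl).1
  rwa [show i + 1 + 1 = i + 2 by rw [add_assoc]; rfl] at this

theorem eq_or_eq_of_triVertex_mem {i j : Fin 3} (h : triVertex j ∈ triSide i) :
    j = i ∨ j = i + 1 := by
  have h' : (triVertex j).1 (i + 2) = 0 := h
  fin_cases i <;> fin_cases j <;> simp_all [triVertex]

theorem exists_eq_triVertex {x : ClosedTriangle} {i j : Fin 3} (hij : i ≠ j) (hi : x ∈ triSide i)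
    (hj : x ∈ triSide j) : ∃ l, x = triVertex l := by
  have hi' : x.1 (i + 2) = 0 := hi
  have hj' : x.1 (j + 2) = 0 := hj
  have : j = i + 1 ∨ j = i + 2 := by clear hi hj hi' hj'; revert i j; decide
  rcases this with rfl | rfl
  · refine ⟨i + 1, (eq_triVertex_iff _ _).2 ⟨?_, ?_⟩⟩
    · rwa [show i + 1 + 1 = i + 2 by rw [add_assoc]; rfl]
    · exact hj'
  · refine ⟨i, (eq_triVertex_iff _ _).2 ⟨?_, hi'⟩⟩
    rwa [show i + 2 + 2 = i + 1 by rw [add_assoc]; rfl] at hj'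

theorem isClosed_triSide (i : Fin 3) : IsClosed (triSide i) :=
  isClosed_eq ((continuous_apply _).comp continuous_subtype_val) continuous_const

theorem isPreconnected_triSide (i : Fin 3) : IsPreconnected (triSide i) := by
  rw [← Topology.IsInducing.subtypeVal.isPreconnected_image]
  have : Subtype.val '' triSide i = stdSimplex ℝ (Fin 3) ∩ {x | x (i + 2) = 0} := by
    ext x
    constructor
    · rintro ⟨y, hy, rfl⟩
      exact ⟨y.2, hy⟩
    · rintro ⟨hx, hx'⟩
      exact ⟨⟨x, hx⟩, hx', rfl⟩
  rw [this]
  refine ((convex_stdSimplex ℝ _).inter ?_).isPreconnected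
  intro x hx y hy a b _ _ _
  have hx' : x (i + 2) = 0 := hx
  have hy' : y (i + 2) = 0 := hy
  change (a • x + b • y) (i + 2) = 0
  simp [hx', hy']

end Triangle

/-! ### Orbits of self-maps. -/

section Orbit

variable {α : Type*} {f : α → α}

/-- All points of a finite set are periodic under an injective map, so forward orbits are
equivalence classes. -/
theorem exists_iterate_symm [Finite α] (hf : Function.Injective f) {s t : α} (h : ∃ i, f^[i] s = t) :
    ∃ i, f^[i] t = s := by
  obtain ⟨i, rfl⟩ := h
  obtain ⟨p, hp, hper⟩ := hf.mem_periodicPts s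
  have hper' : f^[p * i] s = s := hper.mul_const i
  obtain ⟨d, hd⟩ := Nat.exists_eq_add_of_le' (Nat.le_mul_of_pos_left i hp)
  rw [hd, Function.iterate_add_apply] at hper'
  exact ⟨d, hper'⟩

theorem exists_iterate_trans {s t u : α} (h : ∃ i, f^[i] s = t) (h' : ∃ i, f^[i] t = u) :
    ∃ i, f^[i] s = u := by
  obtain ⟨i, rfl⟩ := h
  obtain ⟨j, rfl⟩ := h'
  exact ⟨j + i, Function.iterate_add_apply _ _ _ _⟩

end Orbit

/-! ### Boundary components as orbits of `rho`. -/

namespace TriangulatedSurface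

variable {S : Type*} [TopologicalSpace S] (T : TriangulatedSurface S)

instance : Finite T.Tri := T.finite_tri

/-- The next side of the triangle, counterclockwise. -/
def nxt (h : T.Tri × Fin 3) : T.Tri × Fin 3 := (h.1, h.2 + 1)

/-- The side following `glue h`; iteration moves around the vertex `start h`, and on along the
boundary. -/
def rho (h : T.Tri × Fin 3) : T.Tri × Fin 3 := T.nxt (T.glue h)

theorem nxt_bijective : Function.Bijective T.nxt := by
  constructor
  · rintro ⟨t, i⟩ ⟨t', i'⟩ h
    have h' := Prod.ext_iff.1 h
    exact Prod.ext h'.1 (add_right_cancel h'.2)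
  · rintro ⟨t, i⟩
    exact ⟨(t, i - 1), Prod.ext rfl (sub_add_cancel i 1)⟩

theorem glue_injective : Function.Injective T.glue := fun x y h => by
  rw [← T.glue_glue x, h, T.glue_glue]

theorem rho_injective : Function.Injective T.rho := fun _ _ h =>
  T.glue_injective (T.nxt_bijective.1 h)

theorem rho_of_isBoundary {h : T.Tri × Fin 3} (hh : T.IsBoundary h) : T.rho h = T.nxt h :=
  congrArg T.nxt hh

theorem not_isBoundary_glue {h : T.Tri × Fin 3} (hh : ¬ T.IsBoundary h) :
    ¬ T.IsBoundary (T.glue h) := fun h' => hh (by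
  have h'' : T.glue (T.glue h) = T.glue h := h'
  rw [T.glue_glue] at h''
  exact h''.symm)

/-- Two sides lie in the same orbit of `rho`. -/
def SameOrbit (s t : T.Tri × Fin 3) : Prop := ∃ i, T.rho^[i] s = t

variable {T}

theorem SameOrbit.refl (s : T.Tri × Fin 3) : T.SameOrbit s s := ⟨0, rfl⟩

theorem SameOrbit.symm {s t : T.Tri × Fin 3} (h : T.SameOrbit s t) : T.SameOrbit t s :=
  exists_iterate_symm T.rho_injective h

theorem SameOrbit.trans {s t u : T.Tri × Fin 3} (h : T.SameOrbit s t) (h' : T.SameOrbit t u) :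
    T.SameOrbit s u :=
  exists_iterate_trans h h'

theorem sameOrbit_rho (s : T.Tri × Fin 3) : T.SameOrbit s (T.rho s) := ⟨1, rfl⟩

/-- Gluing reverses direction, so the start of side `i` meets the end of side `j`, which is the
corner reached by one step of `rho`. Away from vertices, only inner points of arcs are identified.
-/
theorem sideIdent_cases {p q : T.Tri × ClosedTriangle} (h : SideIdent T.glue p q) :
    (∃ a b, p.2 = triVertex a ∧ q.2 = triVertex b ∧
      ((¬ T.IsBoundary (p.1, a) ∧ T.rho (p.1, a) = (q.1, b)) ∨
        (¬ T.IsBoundary (q.1, b) ∧ T.rho (q.1, b) = (p.1, a)))) ∨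
    ((∀ a, p.2 ≠ triVertex a) ∧ (∀ b, q.2 ≠ triVertex b) ∧
      (∃ i, p.2 ∈ triSide i ∧ ¬ T.IsBoundary (p.1, i)) ∧
      ∃ j, q.2 ∈ triSide j ∧ ¬ T.IsBoundary (q.1, j)) := by
  obtain ⟨i, j, hg, hne, hp, hq, h₁, h₂⟩ := h
  have hg' : T.glue (q.1, j) = (p.1, i) := by rw [← hg, T.glue_glue]
  have hbi : ¬ T.IsBoundary (p.1, i) := fun h => hne (h.symm.trans hg)
  have hbj : ¬ T.IsBoundary (q.1, j) := fun h => hne (hg'.symm.trans h)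
  have hp' : p.2.1 (i + 2) = 0 := hp
  have hq' : q.2.1 (j + 2) = 0 := hq
  have h3 : ∀ l : Fin 3, l + 1 + 1 = l + 2 := by decide
  have h4 : ∀ l : Fin 3, l + 1 + 2 = l := by decide
  have e₁ : p.2 = triVertex i ↔ q.2 = triVertex (j + 1) := by
    rw [eq_triVertex_iff, eq_triVertex_iff, h3, h4, h₁]
    tauto
  have e₂ : p.2 = triVertex (i + 1) ↔ q.2 = triVertex j := by
    rw [eq_triVertex_iff, eq_triVertex_iff, h3, h4, h₂]
    tauto
  by_cases hpi : p.2 = triVertex i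
  · exact Or.inl ⟨i, j + 1, hpi, e₁.1 hpi, Or.inl ⟨hbi, congrArg T.nxt hg⟩⟩
  by_cases hpi' : p.2 = triVertex (i + 1)
  · exact Or.inl ⟨i + 1, j, hpi', e₂.1 hpi', Or.inr ⟨hbj, congrArg T.nxt hg'⟩⟩
  refine Or.inr ⟨fun a ha => ?_, fun b hb => ?_, ⟨i, hp, hbi⟩, ⟨j, hq, hbj⟩⟩
  · rcases eq_or_eq_of_triVertex_mem (ha ▸ hp) with rfl | rfl
    · exact hpi ha
    · exact hpi' ha
  · rcases eq_or_eq_of_triVertex_mem (hb ▸ hq) with rfl | rfl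
    · exact hpi' (e₂.2 hb)
    · exact hpi (e₁.2 hb)

variable (T)

/-- The orbit of sides belonging to a boundary point or vertex. -/
def orbitOf (p : T.Tri × ClosedTriangle) : Set (T.Tri × Fin 3) :=
  {s | ∃ i, T.SameOrbit (p.1, i) s ∧
    (p.2 = triVertex i ∨ (T.IsBoundary (p.1, i) ∧ p.2 ∈ triSide i))}

variable {T}

theorem orbitOf_of_eq_triVertex {p : T.Tri × ClosedTriangle} {i : Fin 3} (h : p.2 = triVertex i) :
    T.orbitOf p = {s | T.SameOrbit (p.1, i) s} := by
  ext s
  constructor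
  · rintro ⟨j, hs, hj | ⟨hb, hj⟩⟩
    · rw [h] at hj
      exact triVertex_injective hj ▸ hs
    · rw [h] at hj
      rcases eq_or_eq_of_triVertex_mem hj with rfl | rfl
      · exact hs
      · refine SameOrbit.trans (SameOrbit.symm ?_) hs
        have := sameOrbit_rho (p.1, j)
        rwa [T.rho_of_isBoundary hb] at this
  · exact fun hs => ⟨i, hs, Or.inl h⟩

theorem orbitOf_of_isBoundary {p : T.Tri × ClosedTriangle} {i : Fin 3} (h : p.2 ∈ triSide i)
    (hb : T.IsBoundary (p.1, i)) : T.orbitOf p = {s | T.SameOrbit (p.1, i) s} := by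
  have hmem : (p.1, i) ∈ T.orbitOf p := ⟨i, SameOrbit.refl _, Or.inr ⟨hb, h⟩⟩
  by_cases hv : ∃ a, p.2 = triVertex a
  · obtain ⟨a, ha⟩ := hv
    rw [orbitOf_of_eq_triVertex ha] at hmem ⊢
    ext s
    exact ⟨fun hs => (SameOrbit.symm hmem).trans hs, fun hs => SameOrbit.trans hmem hs⟩
  · ext s
    constructor
    · rintro ⟨j, hs, hj | ⟨-, hj⟩⟩
      · exact absurd ⟨j, hj⟩ hv
      · by_cases hij : i = j
        · exact hij ▸ hs
        · exact absurd (exists_eq_triVertex hij h hj) hv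
    · exact fun hs => ⟨i, hs, Or.inr ⟨hb, h⟩⟩

theorem orbitOf_eq_empty {p : T.Tri × ClosedTriangle} (hv : ∀ a, p.2 ≠ triVertex a)
    (h : ∃ i, p.2 ∈ triSide i ∧ ¬ T.IsBoundary (p.1, i)) : T.orbitOf p = ∅ := by
  obtain ⟨i, hi, hb⟩ := h
  rw [Set.eq_empty_iff_forall_notMem]
  rintro s ⟨j, -, hj | ⟨hb', hj⟩⟩
  · exact hv j hj
  · obtain ⟨a, ha⟩ := exists_eq_triVertex (fun e => hb (e ▸ hb') : i ≠ j) hi hj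
    exact hv a ha

/-- The principle by which combinatorial data become invariants of points of the surface: check
elementary identifications only. It is used for orbits, outgoing segments and sets of triangles
closed under gluing. -/
theorem eq_of_chart_eq {β : Type*} (Φ : T.Tri × ClosedTriangle → β)
    (hΦ : ∀ p q, SideIdent T.glue p q → Φ p = Φ q) {t t' : T.Tri} {x x' : ClosedTriangle}
    (h : T.chart t x = T.chart t' x') : Φ (t, x) = Φ (t', x') := by
  have := (T.chart_eq_iff t x t' x').1 h
  generalize (t, x) = p at this
  generalize (t', x') = q at this
  induction this with
  | rel p q h => exact hΦ p q h
  | refl p => rfl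
  | symm p q _ ih => exact ih.symm
  | trans p q r _ _ ih₁ ih₂ => exact ih₁.trans ih₂

theorem orbitOf_eq_of_chart_eq {t t' : T.Tri} {x x' : ClosedTriangle}
    (h : T.chart t x = T.chart t' x') : T.orbitOf (t, x) = T.orbitOf (t', x') := by
  refine eq_of_chart_eq T.orbitOf (fun p q hpq => ?_) h
  rcases sideIdent_cases hpq with ⟨a, b, ha, hb, hab⟩ | ⟨h₁, h₂, h₃, h₄⟩
  · rw [orbitOf_of_eq_triVertex ha, orbitOf_of_eq_triVertex hb]
    have key : T.SameOrbit (p.1, a) (q.1, b) := by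
      rcases hab with ⟨-, h⟩ | ⟨-, h⟩
      · exact ⟨1, h⟩
      · exact SameOrbit.symm ⟨1, h⟩
    ext s
    exact ⟨fun hs => key.symm.trans hs, fun hs => key.trans hs⟩
  · rw [orbitOf_eq_empty h₁ h₃, orbitOf_eq_empty h₂ h₄]

theorem sameOrbit_of_mem_side {h h' : T.Tri × Fin 3} (hb : T.IsBoundary h) (hb' : T.IsBoundary h')
    {p : S} (hp : p ∈ T.side h) (hp' : p ∈ T.side h') : T.SameOrbit h h' := by
  obtain ⟨x, hx, rfl⟩ := hp
  obtain ⟨x', hx', he⟩ := hp'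
  have key := orbitOf_eq_of_chart_eq he
  rw [orbitOf_of_isBoundary hx' hb', orbitOf_of_isBoundary hx hb] at key
  have : h' ∈ {s | T.SameOrbit (h'.1, h'.2) s} := SameOrbit.refl h'
  rw [key] at this
  exact this

theorem sameOrbit_of_start_mem_side {s h : T.Tri × Fin 3} (hb : T.IsBoundary h)
    (hp : T.start s ∈ T.side h) : T.SameOrbit s h := by
  obtain ⟨x, hx, he⟩ := hp
  have key := orbitOf_eq_of_chart_eq he
  rw [orbitOf_of_isBoundary hx hb, orbitOf_of_eq_triVertex (i := s.2) rfl] at key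
  have : h ∈ {s | T.SameOrbit (h.1, h.2) s} := SameOrbit.refl h
  rw [key] at this
  exact this

theorem exists_isBoundary_start_mem_side (s : T.Tri × Fin 3) :
    ∃ h, T.IsBoundary h ∧ T.start s ∈ T.side h := by
  obtain ⟨t', j, hb, hmem⟩ := T.unpunctured s.1 s.2
  exact ⟨(t', j), hb, hmem⟩

theorem exists_isBoundary_iterate (s : T.Tri × Fin 3) : ∃ i, T.IsBoundary (T.rho^[i] s) := by
  obtain ⟨h, hb, hmem⟩ := exists_isBoundary_start_mem_side s
  obtain ⟨i, rfl⟩ := sameOrbit_of_start_mem_side hb hmem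
  exact ⟨i, hb⟩

theorem start_rho {s : T.Tri × Fin 3} (hs : ¬ T.IsBoundary s) : T.start (T.rho s) = T.start s := by
  refine ((T.chart_eq_iff _ _ _ _).2 (Relation.EqvGen.rel _ _ ?_)).symm
  refine ⟨s.2, (T.glue s).2, rfl, fun h => hs h.symm, triVertex_mem_triSide _,
    triVertex_succ_mem_triSide _, ?_, ?_⟩
  · change (triVertex ((T.glue s).2 + 1)).1 (T.glue s).2 = (triVertex s.2).1 (s.2 + 1)
    simp [triVertex]
  · change (triVertex ((T.glue s).2 + 1)).1 ((T.glue s).2 + 1) = (triVertex s.2).1 s.2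
    simp [triVertex]

variable (T)

/-- The boundary component containing the starting point of a side. -/
def component (s : T.Tri × Fin 3) : T.BoundaryComponent :=
  ConnectedComponents.mk ⟨T.start s, exists_isBoundary_start_mem_side s⟩

variable {T}

theorem on_start_iff (s : T.Tri × Fin 3) (C : T.BoundaryComponent) :
    T.On (T.start s) C ↔ T.component s = C :=
  ⟨fun ⟨_, h⟩ => h, fun h => ⟨_, h⟩⟩

theorem mk_eq_mk_of_mem_side {h : T.Tri × Fin 3} (hb : T.IsBoundary h) {p q : T.boundary}
    (hp : p.1 ∈ T.side h) (hq : q.1 ∈ T.side h) :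
    ConnectedComponents.mk p = ConnectedComponents.mk q := by
  have hconn : IsPreconnected (T.side h) :=
    (isPreconnected_triSide h.2).image _ (T.continuous_chart h.1).continuousOn
  have hsub : T.side h ⊆ T.boundary := fun x hx => ⟨h, hb, hx⟩
  have hA : IsPreconnected (Subtype.val ⁻¹' T.side h : Set T.boundary) := by
    rw [← Topology.IsInducing.subtypeVal.isPreconnected_image, Subtype.image_preimage_val,
      Set.inter_eq_right.2 hsub]
    exact hconn
  rw [ConnectedComponents.coe_eq_coe]
  exact connectedComponent_eq (hA.subset_connectedComponent (x := p) hp hq)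

theorem start_mem_side (h : T.Tri × Fin 3) : T.start h ∈ T.side h :=
  ⟨_, triVertex_mem_triSide _, rfl⟩

theorem start_nxt_mem_side (h : T.Tri × Fin 3) : T.start (T.nxt h) ∈ T.side h :=
  ⟨_, triVertex_succ_mem_triSide _, rfl⟩

theorem component_rho (s : T.Tri × Fin 3) : T.component (T.rho s) = T.component s := by
  by_cases hs : T.IsBoundary s
  · refine mk_eq_mk_of_mem_side hs ?_ (start_mem_side s)
    rw [T.rho_of_isBoundary hs]
    exact start_nxt_mem_side s
  · exact congrArg ConnectedComponents.mk (Subtype.ext (start_rho hs))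

theorem component_eq_of_sameOrbit {s t : T.Tri × Fin 3} (h : T.SameOrbit s t) :
    T.component s = T.component t := by
  obtain ⟨i, rfl⟩ := h
  induction i with
  | zero => rfl
  | succ i ih => rw [Function.iterate_succ_apply', component_rho, ih]

theorem component_surjective : Function.Surjective T.component := by
  intro C
  obtain ⟨⟨p, h, hb, hp⟩, rfl⟩ := ConnectedComponents.surjective_coe C
  exact ⟨h, mk_eq_mk_of_mem_side hb (start_mem_side h) hp⟩

theorem isClosed_side [T2Space S] (h : T.Tri × Fin 3) : IsClosed (T.side h) :=
  ((isClosed_triSide h.2).isCompact.image (T.continuous_chart h.1)).isClosed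

/-- The boundary segments in the orbit of `s` and those outside it cover the boundary by two finite
unions of compact sets. A common point would put two segments in one orbit, so the unions are
complementary and clopen, and no component meets both. -/
theorem sameOrbit_of_component_eq [T2Space S] {s t : T.Tri × Fin 3}
    (h : T.component s = T.component t) : T.SameOrbit s t := by
  let U : Set T.boundary := ⋃ h ∈ {h | T.IsBoundary h ∧ T.SameOrbit s h}, Subtype.val ⁻¹' T.side h
  let U' : Set T.boundary :=
    ⋃ h ∈ {h | T.IsBoundary h ∧ ¬ T.SameOrbit s h}, Subtype.val ⁻¹' T.side h
  have hU : IsClosed U :=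
    (Set.toFinite _).isClosed_biUnion fun h _ => (isClosed_side h).preimage continuous_subtype_val
  have hU' : IsClosed U' :=
    (Set.toFinite _).isClosed_biUnion fun h _ => (isClosed_side h).preimage continuous_subtype_val
  have hcompl : Uᶜ = U' := by
    ext p
    constructor
    · intro hp
      obtain ⟨h, hb, hph⟩ := p.2
      refine Set.mem_biUnion (x := h) ⟨hb, fun hs => hp ?_⟩ hph
      exact Set.mem_biUnion (x := h) ⟨hb, hs⟩ hph
    · intro hp hp'
      obtain ⟨h, ⟨hb, hs⟩, hph⟩ := Set.mem_iUnion₂.1 hp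
      obtain ⟨h', ⟨hb', hs'⟩, hph'⟩ := Set.mem_iUnion₂.1 hp'
      exact hs (hs'.trans (sameOrbit_of_mem_side hb' hb hph' hph))
  have hclopen : IsClopen U := ⟨hU, by rw [← isClosed_compl_iff, hcompl]; exact hU'⟩
  have hs : (⟨T.start s, exists_isBoundary_start_mem_side s⟩ : T.boundary) ∈ U := by
    obtain ⟨h, hb, hmem⟩ := exists_isBoundary_start_mem_side s
    exact Set.mem_biUnion (x := h) ⟨hb, sameOrbit_of_start_mem_side hb hmem⟩ hmem
  have ht : (⟨T.start t, exists_isBoundary_start_mem_side t⟩ : T.boundary) ∈ U := by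
    refine hclopen.connectedComponent_subset hs ?_
    rw [ConnectedComponents.coe_eq_coe.1 h]
    exact mem_connectedComponent
  obtain ⟨h, ⟨hb, hs⟩, hth⟩ := Set.mem_iUnion₂.1 ht
  exact hs.trans (sameOrbit_of_start_mem_side hb hth).symm

theorem component_eq_iff [T2Space S] {s t : T.Tri × Fin 3} :
    T.component s = T.component t ↔ T.SameOrbit s t :=
  ⟨sameOrbit_of_component_eq, component_eq_of_sameOrbit⟩

/-- The triangles in `X` and the others have disjoint closed images covering the surface, because
identifications never leave `X`. Connectedness does the rest. -/
theorem eq_univ_of_glue_closed [T2Space S] [ConnectedSpace S] {X : Set T.Tri} (hne : X.Nonempty)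
    (hX : ∀ h : T.Tri × Fin 3, h.1 ∈ X ↔ (T.glue h).1 ∈ X) : X = Set.univ := by
  have hmem : ∀ {t t' x x'}, T.chart t x = T.chart t' x' → (t ∈ X ↔ t' ∈ X) := by
    intro t t' x x' h
    refine iff_of_eq (eq_of_chart_eq (fun p => p.1 ∈ X) (fun p q hpq => ?_) h)
    obtain ⟨i, j, hg, -⟩ := hpq
    have := hX (p.1, i)
    rw [hg] at this
    exact propext this
  have hcl : ∀ Y : Set T.Tri, IsClosed (⋃ t ∈ Y, Set.range (T.chart t)) := fun Y =>
    (Set.toFinite _).isClosed_biUnion fun t _ => (isCompact_range (T.continuous_chart t)).isClosed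
  have hcompl : (⋃ t ∈ X, Set.range (T.chart t))ᶜ = ⋃ t ∈ Xᶜ, Set.range (T.chart t) := by
    ext p
    constructor
    · intro hp
      obtain ⟨t, x, rfl⟩ := T.surjective_chart p
      refine Set.mem_biUnion (x := t) (fun ht => hp ?_) ⟨x, rfl⟩
      exact Set.mem_biUnion (x := t) ht ⟨x, rfl⟩
    · intro hp hp'
      obtain ⟨t, ht, x, rfl⟩ := Set.mem_iUnion₂.1 hp
      obtain ⟨t', ht', x', hx'⟩ := Set.mem_iUnion₂.1 hp'
      exact ht ((hmem hx').1 ht')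
  have hclopen : IsClopen (⋃ t ∈ X, Set.range (T.chart t)) :=
    ⟨hcl X, by rw [← isClosed_compl_iff, hcompl]; exact hcl _⟩
  obtain ⟨t₀, ht₀⟩ := hne
  have huniv := hclopen.eq_univ
    ⟨T.chart t₀ (triVertex 0), Set.mem_biUnion (x := t₀) ht₀ ⟨_, rfl⟩⟩
  refine Set.eq_univ_of_forall fun t => ?_
  have : T.chart t (triVertex 0) ∈ ⋃ t ∈ X, Set.range (T.chart t) := huniv ▸ Set.mem_univ _
  obtain ⟨t', ht', x', hx'⟩ := Set.mem_iUnion₂.1 this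
  exact (hmem hx').1 ht'

end TriangulatedSurface

/-! ### Counting marked points and boundary segments by entries. -/

namespace TriangulatedSurface

variable {S : Type*} [TopologicalSpace S] {T : TriangulatedSurface S}

theorem nxt_nxt_nxt (s : T.Tri × Fin 3) : T.nxt (T.nxt (T.nxt s)) = s := by
  obtain ⟨t, i⟩ := s
  refine Prod.ext rfl ?_
  change i + 1 + 1 + 1 = i
  revert i
  decide

theorem eq_or_eq_nxt {s h : T.Tri × Fin 3} (hs : s.1 = h.1) :
    s = h ∨ s = T.nxt h ∨ s = T.nxt (T.nxt h) := by
  obtain ⟨t, i⟩ := s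
  obtain ⟨t', j⟩ := h
  obtain rfl : t = t' := hs
  have : i = j ∨ i = j + 1 ∨ i = j + 1 + 1 := by revert i j; decide
  rcases this with rfl | rfl | rfl
  · exact Or.inl rfl
  · exact Or.inr (Or.inl rfl)
  · exact Or.inr (Or.inr rfl)

theorem nxt_ne (s : T.Tri × Fin 3) : T.nxt s ≠ s := by
  intro h
  have h' : s.2 + 1 = s.2 := congrArg Prod.snd h
  revert h'
  generalize s.2 = i
  revert i
  decide

theorem nxt_nxt_ne (s : T.Tri × Fin 3) : T.nxt (T.nxt s) ≠ s := by
  intro h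
  have h' : s.2 + 1 + 1 = s.2 := congrArg Prod.snd h
  revert h'
  generalize s.2 = i
  revert i
  decide

variable (T)

/-- A side of an arc that is preceded by a boundary segment. -/
def IsEntry (s : T.Tri × Fin 3) : Prop := ¬ T.IsBoundary s ∧ ∃ b, T.IsBoundary b ∧ T.nxt b = s

/-- The first boundary segment met from a side by iterating `rho`. -/
def outgoing (s : T.Tri × Fin 3) : T.Tri × Fin 3 :=
  T.rho^[sInf {i | T.IsBoundary (T.rho^[i] s)}] s

variable {T}

theorem exists_outgoing (s : T.Tri × Fin 3) : ∃ i, T.outgoing s = T.rho^[i] s ∧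
    T.IsBoundary (T.outgoing s) ∧ ∀ l < i, ¬ T.IsBoundary (T.rho^[l] s) :=
  ⟨_, rfl, Nat.sInf_mem (s := {i | T.IsBoundary (T.rho^[i] s)}) (exists_isBoundary_iterate s),
    fun _ hl => Nat.notMem_of_lt_sInf hl⟩

theorem outgoing_eq {s : T.Tri × Fin 3} {i : ℕ} (hi : T.IsBoundary (T.rho^[i] s))
    (hlt : ∀ l < i, ¬ T.IsBoundary (T.rho^[l] s)) : T.outgoing s = T.rho^[i] s := by
  obtain ⟨j, hj, hb, hlt'⟩ := exists_outgoing s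
  rw [hj] at hb ⊢
  rcases lt_trichotomy i j with h | rfl | h
  · exact absurd hi (hlt' _ h)
  · rfl
  · exact absurd hb (hlt _ h)

theorem outgoing_of_isBoundary {s : T.Tri × Fin 3} (hs : T.IsBoundary s) : T.outgoing s = s :=
  outgoing_eq (i := 0) hs fun _ hl => absurd hl (Nat.not_lt_zero _)

theorem outgoing_rho {s : T.Tri × Fin 3} (hs : ¬ T.IsBoundary s) :
    T.outgoing (T.rho s) = T.outgoing s := by
  obtain ⟨i, hi, hb, hlt⟩ := exists_outgoing (T.rho s)
  rw [hi] at hb ⊢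
  refine (outgoing_eq (i := i + 1) hb fun l hl => ?_).symm
  cases l with
  | zero => exact hs
  | succ l => exact hlt l (by omega)

/-- Corners at one point are linked by steps of `rho` across arcs, and such a step does not change
the first boundary segment met. So the outgoing segment depends on the marked point only. -/
theorem outgoing_eq_of_start_eq {s s' : T.Tri × Fin 3} (h : T.start s = T.start s') :
    T.outgoing s = T.outgoing s' := by
  have key := eq_of_chart_eq
    (fun p : T.Tri × ClosedTriangle => {h | ∃ i, p.2 = triVertex i ∧ h = T.outgoing (p.1, i)})
    (fun p q hpq => ?_) h
  · have hmem : T.outgoing s ∈ {h | ∃ i, (s.1, triVertex s.2).2 = triVertex i ∧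
        h = T.outgoing (s.1, i)} := ⟨s.2, rfl, rfl⟩
    rw [key] at hmem
    obtain ⟨i, hi, h⟩ := hmem
    rw [h, ← triVertex_injective hi]
  · have hv : ∀ (p : T.Tri × ClosedTriangle) a, p.2 = triVertex a →
        {h | ∃ i, p.2 = triVertex i ∧ h = T.outgoing (p.1, i)} = {T.outgoing (p.1, a)} := by
      intro p a ha
      ext h
      constructor
      · rintro ⟨i, hi, rfl⟩
        rw [triVertex_injective (hi.symm.trans ha)]
        rfl
      · rintro rfl
        exact ⟨a, ha, rfl⟩
    have hv' : ∀ p : T.Tri × ClosedTriangle, (∀ a, p.2 ≠ triVertex a) →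
        {h | ∃ i, p.2 = triVertex i ∧ h = T.outgoing (p.1, i)} = ∅ := fun p hp =>
      Set.eq_empty_iff_forall_notMem.2 fun h ⟨i, hi, _⟩ => hp i hi
    rcases sideIdent_cases hpq with ⟨a, b, ha, hb, hab⟩ | ⟨h₁, h₂, -⟩
    · refine (hv p a ha).trans (Eq.trans (congrArg _ ?_) (hv q b hb).symm)
      rcases hab with ⟨hnb, h⟩ | ⟨hnb, h⟩
      · rw [← h, outgoing_rho hnb]
      · rw [← h, outgoing_rho hnb]
    · exact (hv' p h₁).trans (hv' q h₂).symm

/-- Turn backwards around the starting point until the previous step of `rho` came from a boundary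
segment; this happens because the orbit is cyclic and contains one. -/
theorem exists_isEntry_start_eq {s : T.Tri × Fin 3} (hs : ¬ T.IsBoundary s) :
    ∃ s', T.IsEntry s' ∧ T.start s' = T.start s := by
  have key : ∀ (d : ℕ) (b : T.Tri × Fin 3), T.IsBoundary b → ¬ T.IsBoundary (T.rho^[d] b) →
      ∃ s', T.IsEntry s' ∧ T.start s' = T.start (T.rho^[d] b) := by
    intro d b hb
    induction d with
    | zero => exact fun h => absurd hb h
    | succ d ih =>
      intro h
      rw [Function.iterate_succ_apply'] at h ⊢
      by_cases hd : T.IsBoundary (T.rho^[d] b)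
      · exact ⟨_, ⟨h, _, hd, (T.rho_of_isBoundary hd).symm⟩, rfl⟩
      · rw [start_rho hd]
        exact ih hd
  obtain ⟨i, hi⟩ := exists_isBoundary_iterate s
  obtain ⟨d, hd⟩ := SameOrbit.symm (T := T) ⟨i, rfl⟩
  have := key d _ hi
  rw [hd] at this
  exact this hs

/-- Both entries lead to the same outgoing segment. Going back from it, the longer way would pass
through the entry of the shorter one, hence through the boundary segment before it, although no
boundary segment is met earlier. -/
theorem IsEntry.eq_of_start_eq {s s' : T.Tri × Fin 3} (hs : T.IsEntry s) (hs' : T.IsEntry s')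
    (h : T.start s = T.start s') : s = s' := by
  have key : ∀ {s s' : T.Tri × Fin 3} {i j : ℕ}, T.IsEntry s → i ≤ j →
      (∀ l < j, ¬ T.IsBoundary (T.rho^[l] s')) → T.rho^[i] s = T.rho^[j] s' → s = s' := by
    intro s s' i j hs hij hlt he
    obtain ⟨d, rfl⟩ := Nat.exists_eq_add_of_le hij
    rw [Function.iterate_add_apply] at he
    have he' := T.rho_injective.iterate i he
    cases d with
    | zero => exact he'
    | succ d =>
      obtain ⟨b, hb, hb'⟩ := hs.2
      rw [Function.iterate_succ_apply', ← hb', ← T.rho_of_isBoundary hb] at he'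
      exact absurd (T.rho_injective he' ▸ hb) (hlt d (by omega))
  have he := outgoing_eq_of_start_eq h
  obtain ⟨i, hi, -, hlt⟩ := exists_outgoing s
  obtain ⟨j, hj, -, hlt'⟩ := exists_outgoing s'
  rw [hi, hj] at he
  rcases le_total i j with hij | hij
  · exact key hs hij hlt' he
  · exact (key hs' hij hlt he.symm).symm

/-- Two boundary segments in immediate succession leave no room for an arc at their common point: an
entry there would have outgoing segment `h` and reach it through `g`. -/
theorem start_ne_of_rho_eq {g h s : T.Tri × Fin 3} (hg : T.IsBoundary g) (hh : T.IsBoundary h)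
    (hgh : T.rho g = h) (hs : ¬ T.IsBoundary s) : T.start s ≠ T.start h := by
  intro heq
  obtain ⟨s', hs', hss'⟩ := exists_isEntry_start_eq hs
  have he := outgoing_eq_of_start_eq (hss'.trans heq)
  rw [outgoing_of_isBoundary hh] at he
  obtain ⟨i, hi, -, hlt⟩ := exists_outgoing s'
  rw [hi] at he
  cases i with
  | zero => exact hs'.1 ((show s' = h from he) ▸ hh)
  | succ i =>
    rw [Function.iterate_succ_apply', ← hgh] at he
    exact hlt i i.lt_succ_self (T.rho_injective he ▸ hg)

theorem finish_eq_start_glue {h : T.Tri × Fin 3} (hh : ¬ T.IsBoundary h) :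
    T.finish h = T.start (T.glue h) := by
  rw [← start_rho (T.not_isBoundary_glue hh), rho, T.glue_glue]
  rfl

theorem mem_markedOn_iff (p : S) (C : T.BoundaryComponent) :
    p ∈ T.markedOn C ↔ ∃ s, ¬ T.IsBoundary s ∧ T.component s = C ∧ T.start s = p := by
  constructor
  · rintro ⟨hp, h, hh, rfl | rfl⟩
    · exact ⟨h, hh, (on_start_iff h C).1 hp, rfl⟩
    · rw [finish_eq_start_glue hh] at hp ⊢
      exact ⟨_, T.not_isBoundary_glue hh, (on_start_iff _ C).1 hp, rfl⟩
  · rintro ⟨s, hs, hC, rfl⟩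
    exact ⟨(on_start_iff s C).2 hC, s, hs, Or.inl rfl⟩

theorem component_eq_of_start_eq {s s' : T.Tri × Fin 3} (h : T.start s = T.start s') :
    T.component s = T.component s' :=
  congrArg ConnectedComponents.mk (Subtype.ext h)

theorem n_eq_ncard (C : T.BoundaryComponent) :
    T.n C = {s | T.IsEntry s ∧ T.component s = C}.ncard := by
  have : T.markedOn C = T.start '' {s | T.IsEntry s ∧ T.component s = C} := by
    ext p
    rw [mem_markedOn_iff]
    constructor
    · rintro ⟨s, hs, hC, rfl⟩
      obtain ⟨s', hs', h⟩ := exists_isEntry_start_eq hs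
      exact ⟨s', ⟨hs', (component_eq_of_start_eq h).trans hC⟩, h⟩
    · rintro ⟨s, ⟨hs, hC⟩, rfl⟩
      exact ⟨s, hs.1, hC, rfl⟩
  rw [n, this]
  exact Set.InjOn.ncard_image fun s hs s' hs' h => hs.1.eq_of_start_eq hs'.1 h

/-- A boundary segment `b` has both endpoints incident to arcs exactly when the other two sides of
its triangle are arcs, and `b` is matched with the entry `nxt b`. A second boundary side of the
triangle would cut off an endpoint of `b` from all arcs. -/
theorem m_eq_ncard (C : T.BoundaryComponent) : T.m C = {s | (T.IsEntry s ∧ T.component s = C) ∧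
    ¬ T.IsBoundary (T.nxt s)}.ncard := by
  rw [m, ← Set.ncard_image_of_injective _ T.nxt_bijective.1]
  congr 1
  ext s
  constructor
  · rintro ⟨h, ⟨hb, hs, hf⟩, rfl⟩
    obtain ⟨s₁, hs₁, -, he₁⟩ := (mem_markedOn_iff _ _).1 hs
    obtain ⟨s₂, hs₂, hC, he₂⟩ := (mem_markedOn_iff _ _).1 hf
    refine ⟨⟨⟨fun hb' => ?_, h, hb, rfl⟩, (component_eq_of_start_eq he₂).symm.trans hC⟩,
      fun hb' => ?_⟩
    · exact start_ne_of_rho_eq hb hb' (T.rho_of_isBoundary hb) hs₂ he₂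
    · refine start_ne_of_rho_eq hb' hb ?_ hs₁ he₁
      rw [T.rho_of_isBoundary hb', nxt_nxt_nxt]
  · rintro ⟨⟨⟨hs, b, hb, rfl⟩, hC⟩, hg⟩
    refine ⟨b, ⟨hb, ?_, ?_⟩, rfl⟩
    · refine (mem_markedOn_iff _ _).2 ⟨_, T.not_isBoundary_glue hg, ?_, ?_⟩
      · rw [← component_rho, rho, T.glue_glue, nxt_nxt_nxt, ← component_rho,
          T.rho_of_isBoundary hb, hC]
      · rw [← start_rho (T.not_isBoundary_glue hg), rho, T.glue_glue, nxt_nxt_nxt]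
    · exact (mem_markedOn_iff _ _).2 ⟨_, hs, hC, rfl⟩

theorem exists_ne_arc (hT : 2 ≤ Nat.card T.polygons.Arc) (s : T.Tri × Fin 3) :
    ∃ h, ¬ T.IsBoundary h ∧ h ≠ s ∧ h ≠ T.glue s := by
  by_contra hcon
  push Not at hcon
  have hsub : Subsingleton T.polygons.Arc := by
    have key : ∀ e : T.polygons.Arc, e.1 = s(s, T.glue s) := by
      rintro ⟨_, h, hh, rfl⟩
      change s(h, T.glue h) = s(s, T.glue s)
      by_cases hs : h = s
      · subst hs
        rfl
      · rw [hcon h hh hs, T.glue_glue]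
        exact Sym2.eq_swap
    exact ⟨fun e e' => Subtype.ext ((key e).trans (key e').symm)⟩
  have : Nat.card T.polygons.Arc ≤ 1 := Finite.card_le_one_iff_subsingleton.2 hsub
  omega

section Connected

variable [T2Space S] [ConnectedSpace S]

/-- The one or two triangles at `s` are glued to nothing else, so by connectedness they are the
whole surface. -/
theorem eq_of_isolated {s : T.Tri × Fin 3} (h₁ : ∀ h : T.Tri × Fin 3, h.1 = s.1 →
    T.IsBoundary h ∨ h = s) (h₂ : ∀ h : T.Tri × Fin 3, h.1 = (T.glue s).1 →
    T.IsBoundary h ∨ h = T.glue s) (h : T.Tri × Fin 3) (hh : ¬ T.IsBoundary h) :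
    h = s ∨ h = T.glue s := by
  have key : ∀ h : T.Tri × Fin 3, h.1 ∈ ({s.1, (T.glue s).1} : Set T.Tri) →
      (T.glue h).1 ∈ ({s.1, (T.glue s).1} : Set T.Tri) := by
    rintro h (h' | h')
    · rcases h₁ h h' with hb | rfl
      · rw [show T.glue h = h from hb]
        exact Or.inl h'
      · exact Or.inr rfl
    · rcases h₂ h h' with hb | rfl
      · rw [show T.glue h = h from hb]
        exact Or.inr h'
      · rw [T.glue_glue]
        exact Or.inl rfl
  have huniv := eq_univ_of_glue_closed (T := T) (X := {s.1, (T.glue s).1}) ⟨s.1, Or.inl rfl⟩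
    fun h => ⟨key h, fun h' => by rw [← T.glue_glue h]; exact key _ h'⟩
  have hmem : h.1 ∈ ({s.1, (T.glue s).1} : Set T.Tri) := huniv ▸ Set.mem_univ _
  rcases hmem with h' | h'
  · exact Or.inl ((h₁ h h').resolve_left hh)
  · exact Or.inr ((h₂ h h').resolve_left hh)

theorem not_isolated (hT : 2 ≤ Nat.card T.polygons.Arc)
    {s : T.Tri × Fin 3} (h₁ : ∀ h : T.Tri × Fin 3, h.1 = s.1 →
    T.IsBoundary h ∨ h = s) (h₂ : ∀ h : T.Tri × Fin 3, h.1 = (T.glue s).1 →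
    T.IsBoundary h ∨ h = T.glue s) : False := by
  obtain ⟨h, hh, hne, hne'⟩ := exists_ne_arc hT s
  rcases eq_of_isolated h₁ h₂ h hh with h' | h'
  · exact hne h'
  · exact hne' h'

theorem exists_not_isBoundary (hT : 2 ≤ Nat.card T.polygons.Arc)
    (t : T.Tri) : ∃ i, ¬ T.IsBoundary (t, i) := by
  by_contra hcon
  push Not at hcon
  have hb : ∀ h : T.Tri × Fin 3, h.1 = t → T.IsBoundary h := by
    rintro ⟨_, i⟩ rfl
    exact hcon i
  refine not_isolated hT (s := (t, 0)) (fun h h' => Or.inl (hb h h')) fun h h' => Or.inl (hb h ?_)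
  rw [h', show T.glue (t, 0) = (t, 0) from hcon 0]

/-- Follow the boundary from a segment on `C`: not all sides of its triangle are boundary segments,
so an entry appears after one or two steps. -/
theorem exists_isEntry_component_eq (hT : 2 ≤ Nat.card T.polygons.Arc)
    (C : T.BoundaryComponent) :
    ∃ s, T.IsEntry s ∧ T.component s = C := by
  obtain ⟨h, rfl⟩ := component_surjective C
  obtain ⟨i, hi⟩ := exists_isBoundary_iterate h
  have hC := component_eq_of_sameOrbit (T := T) (s := h) ⟨i, rfl⟩
  rw [hC]
  generalize T.rho^[i] h = b at hi
  have hC₁ : T.component (T.nxt b) = T.component b := by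
    rw [← T.rho_of_isBoundary hi, component_rho]
  by_cases h1 : T.IsBoundary (T.nxt b)
  · have hC₂ : T.component (T.nxt (T.nxt b)) = T.component b := by
      rw [← T.rho_of_isBoundary h1, component_rho, hC₁]
    by_cases h2 : T.IsBoundary (T.nxt (T.nxt b))
    · exfalso
      obtain ⟨j, hj⟩ := exists_not_isBoundary hT b.1
      rcases eq_or_eq_nxt (T := T) (s := (b.1, j)) (h := b) rfl with h | h | h
      · exact hj (h ▸ hi)
      · exact hj (h ▸ h1)
      · exact hj (h ▸ h2)
    · exact ⟨_, ⟨h2, _, h1, rfl⟩, hC₂⟩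
  · exact ⟨_, ⟨h1, _, hi, rfl⟩, hC₁⟩

end Connected

end TriangulatedSurface

/-! ### Entries, orbits and forbidden lengths after cutting. -/

namespace PolygonGluing

variable {P : PolygonGluing}

theorem forbiddenLength_eq {t : P.Side} {l : ℕ} (h : P.IsBoundary ((P.step id)^[l + 1] t))
    (hlt : ∀ i < l, ¬ P.IsBoundary ((P.step id)^[i + 1] t)) : P.forbiddenLength t = l :=
  le_antisymm (Nat.sInf_le h) (le_csInf ⟨l, h⟩ fun i hi => not_lt.1 fun hil => hlt i hil hi)

end PolygonGluing

namespace TriangulatedSurface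

variable {S : Type*} [TopologicalSpace S] {T : TriangulatedSurface S}

namespace Cut

variable (K : T.Cut)

/-- A side of a triangle, as a side of a polygon of the cut. -/
def inl (s : T.Tri × Fin 3) : K.polygons.Side := (Sum.inl s : (T.Tri × Fin 3) ⊕ K.corners)

/-- The new boundary segment at a corner. -/
def inr (c : T.Tri × Fin 3) (hc : c ∈ K.corners) : K.polygons.Side :=
  (Sum.inr ⟨c, hc⟩ : (T.Tri × Fin 3) ⊕ K.corners)

instance : Finite K.polygons.Side := inferInstanceAs (Finite ((T.Tri × Fin 3) ⊕ K.corners))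

variable {K}

theorem side_cases (x : K.polygons.Side) : (∃ s, x = K.inl s) ∨ ∃ c hc, x = K.inr c hc := by
  rcases x with s | ⟨c, hc⟩
  · exact Or.inl ⟨s, rfl⟩
  · exact Or.inr ⟨c, hc, rfl⟩

theorem inl_injective : Function.Injective K.inl := Sum.inl_injective

theorem inl_ne_inr {s c : T.Tri × Fin 3} {hc : c ∈ K.corners} : K.inl s ≠ K.inr c hc :=
  Sum.inl_ne_inr

theorem glue_inl (s : T.Tri × Fin 3) : K.polygons.glue (K.inl s) = K.inl (T.glue s) := rfl

theorem next_inl_of_mem {s : T.Tri × Fin 3} (h : T.nxt s ∈ K.corners) :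
    K.polygons.next (K.inl s) = K.inr (T.nxt s) h :=
  dif_pos h

theorem next_inl_of_notMem {s : T.Tri × Fin 3} (h : T.nxt s ∉ K.corners) :
    K.polygons.next (K.inl s) = K.inl (T.nxt s) :=
  dif_neg h

theorem next_inr {c : T.Tri × Fin 3} (hc : c ∈ K.corners) :
    K.polygons.next (K.inr c hc) = K.inl c := rfl

theorem isBoundary_inl {s : T.Tri × Fin 3} : K.polygons.IsBoundary (K.inl s) ↔ T.IsBoundary s :=
  inl_injective.eq_iff (f := K.inl) (a := T.glue s) (b := s)

theorem isBoundary_inr {c : T.Tri × Fin 3} (hc : c ∈ K.corners) :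
    K.polygons.IsBoundary (K.inr c hc) := rfl

theorem not_isBoundary_of_mem {c s : T.Tri × Fin 3} (hc : c ∈ K.corners) (hs : s.1 = c.1) :
    ¬ T.IsBoundary s := by
  obtain ⟨t, i⟩ := s
  obtain rfl : t = c.1 := hs
  exact K.internal c hc i

theorem notMem_of_isBoundary {b s : T.Tri × Fin 3} (hb : T.IsBoundary b) (hs : s.1 = b.1) :
    s ∉ K.corners := fun h => not_isBoundary_of_mem h hs.symm hb

theorem nxt_notMem {c : T.Tri × Fin 3} (hc : c ∈ K.corners) : T.nxt c ∉ K.corners := fun h =>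
  nxt_ne c (K.once _ h _ hc rfl)

theorem nxt_nxt_notMem {c : T.Tri × Fin 3} (hc : c ∈ K.corners) : T.nxt (T.nxt c) ∉ K.corners :=
  fun h => nxt_nxt_ne c (K.once _ h _ hc rfl)

theorem next_bijective : Function.Bijective K.polygons.next := by
  have hs : Function.Surjective K.polygons.next := by
    intro x
    rcases side_cases x with ⟨s, rfl⟩ | ⟨c, hc, rfl⟩
    · by_cases h : s ∈ K.corners
      · exact ⟨_, next_inr h⟩
      · obtain ⟨s, rfl⟩ := T.nxt_bijective.2 s
        exact ⟨_, next_inl_of_notMem h⟩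
    · obtain ⟨s, rfl⟩ := T.nxt_bijective.2 c
      exact ⟨_, next_inl_of_mem hc⟩
  exact ⟨Finite.injective_iff_surjective.2 hs, hs⟩

theorem noIn_inl_iff {s : T.Tri × Fin 3} : K.polygons.NoIn (K.inl s) ↔
    s ∈ K.corners ∨ ∃ b, T.IsBoundary b ∧ T.nxt b = s := by
  constructor
  · rintro ⟨x, hx, hxs⟩
    rcases side_cases x with ⟨b, rfl⟩ | ⟨c, hc, rfl⟩
    · by_cases h : T.nxt b ∈ K.corners
      · rw [next_inl_of_mem h] at hxs
        exact absurd hxs.symm inl_ne_inr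
      · rw [next_inl_of_notMem h] at hxs
        exact Or.inr ⟨b, isBoundary_inl.1 hx, inl_injective hxs⟩
    · rw [next_inr] at hxs
      exact Or.inl (inl_injective hxs ▸ hc)
  · rintro (h | ⟨b, hb, rfl⟩)
    · exact ⟨_, isBoundary_inr h, next_inr h⟩
    · exact ⟨_, isBoundary_inl.2 hb, next_inl_of_notMem (notMem_of_isBoundary hb rfl)⟩

theorem noOut_inl_iff {s : T.Tri × Fin 3} : K.polygons.NoOut (K.inl s) ↔
    T.nxt s ∈ K.corners ∨ T.IsBoundary (T.nxt s) := by
  by_cases h : T.nxt s ∈ K.corners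
  · refine iff_of_true ?_ (Or.inl h)
    rw [PolygonGluing.NoOut, next_inl_of_mem h]
    exact isBoundary_inr h
  · rw [PolygonGluing.NoOut, next_inl_of_notMem h, isBoundary_inl]
    simp [h]

theorem entry_inl_iff {s : T.Tri × Fin 3} : K.polygons.Entry (K.inl s) ↔
    s ∈ K.corners ∨ T.IsEntry s := by
  rw [PolygonGluing.Entry, noIn_inl_iff, isBoundary_inl, IsEntry]
  constructor
  · rintro ⟨h, h' | h'⟩
    · exact Or.inl h'
    · exact Or.inr ⟨h, h'⟩
  · rintro (h | ⟨h, h'⟩)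
    · exact ⟨not_isBoundary_of_mem h rfl, Or.inl h⟩
    · exact ⟨h, Or.inr h'⟩

theorem not_entry_inr {c : T.Tri × Fin 3} (hc : c ∈ K.corners) :
    ¬ K.polygons.Entry (K.inr c hc) := fun h => h.1 (isBoundary_inr hc)

theorem notMem_of_isEntry {s : T.Tri × Fin 3} (h : T.IsEntry s) : s ∉ K.corners := by
  obtain ⟨-, b, hb, rfl⟩ := h
  exact notMem_of_isBoundary hb rfl

theorem rho_inl_of_mem {s : T.Tri × Fin 3} (h : T.rho s ∈ K.corners) :
    K.polygons.rho (K.inl s) = K.inr (T.rho s) h :=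
  next_inl_of_mem h

theorem rho_inl_of_notMem {s : T.Tri × Fin 3} (h : T.rho s ∉ K.corners) :
    K.polygons.rho (K.inl s) = K.inl (T.rho s) :=
  next_inl_of_notMem h

theorem rho_inr {c : T.Tri × Fin 3} (hc : c ∈ K.corners) :
    K.polygons.rho (K.inr c hc) = K.inl c := rfl

theorem rho_injective : Function.Injective K.polygons.rho := fun _ _ h =>
  PolygonGluing.glue_injective (next_bijective.1 h)

variable (K)

/-- The boundary component of a side of the cut. -/
def component (x : K.polygons.Side) : T.BoundaryComponent :=
  T.component (Sum.elim id Subtype.val (x : (T.Tri × Fin 3) ⊕ K.corners))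

variable {K}

theorem component_inl (s : T.Tri × Fin 3) : K.component (K.inl s) = T.component s := rfl

theorem component_inr {c : T.Tri × Fin 3} (hc : c ∈ K.corners) :
    K.component (K.inr c hc) = T.component c := rfl

theorem component_rho (x : K.polygons.Side) :
    K.component (K.polygons.rho x) = K.component x := by
  rcases side_cases x with ⟨s, rfl⟩ | ⟨c, hc, rfl⟩
  · rw [component_inl, ← TriangulatedSurface.component_rho]
    by_cases h : T.rho s ∈ K.corners
    · rw [rho_inl_of_mem h, component_inr]
    · rw [rho_inl_of_notMem h, component_inl]
  · rw [rho_inr, component_inl, component_inr]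

theorem exists_iterate_inl {s t : T.Tri × Fin 3} (h : T.SameOrbit s t) :
    ∃ i, K.polygons.rho^[i] (K.inl s) = K.inl t := by
  obtain ⟨i, rfl⟩ := h
  induction i with
  | zero => exact ⟨0, rfl⟩
  | succ i ih =>
    refine exists_iterate_trans ih ?_
    rw [Function.iterate_succ_apply']
    generalize T.rho^[i] s = u
    by_cases h : T.rho u ∈ K.corners
    -- At a cut corner the new boundary segment is inserted into the orbit, which costs one more
    -- step.
    · exact ⟨2, by
        change K.polygons.rho (K.polygons.rho (K.inl u)) = _
        rw [rho_inl_of_mem h, rho_inr]⟩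
    · exact ⟨1, rho_inl_of_notMem h⟩

theorem exists_iterate_inl_eq (x : K.polygons.Side) :
    ∃ s, K.component x = T.component s ∧ ∃ i, K.polygons.rho^[i] x = K.inl s := by
  rcases side_cases x with ⟨s, rfl⟩ | ⟨c, hc, rfl⟩
  · exact ⟨s, rfl, 0, rfl⟩
  · exact ⟨c, rfl, 1, rho_inr hc⟩

theorem component_eq_iff [T2Space S] (x y : K.polygons.Side) :
    K.component x = K.component y ↔ ∃ i, K.polygons.rho^[i] x = y := by
  constructor
  · intro h
    obtain ⟨s, hs, hs'⟩ := exists_iterate_inl_eq x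
    obtain ⟨t, ht, ht'⟩ := exists_iterate_inl_eq y
    rw [hs, ht, TriangulatedSurface.component_eq_iff] at h
    exact exists_iterate_trans hs' (exists_iterate_trans (exists_iterate_inl h)
      (exists_iterate_symm rho_injective ht'))
  · rintro ⟨i, rfl⟩
    induction i with
    | zero => rfl
    | succ i ih => rw [Function.iterate_succ_apply', component_rho, ih]

theorem exists_isBoundary_rho (x : K.polygons.Side) :
    ∃ i, K.polygons.IsBoundary (K.polygons.rho^[i] x) := by
  obtain ⟨s, -, i, hi⟩ := exists_iterate_inl_eq x
  obtain ⟨j, hj⟩ := exists_isBoundary_iterate s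
  obtain ⟨l, hl⟩ := exists_iterate_inl (K := K) (s := s) ⟨j, rfl⟩
  refine ⟨l + i, ?_⟩
  rw [Function.iterate_add_apply, hi, hl]
  exact isBoundary_inl.2 hj

/-- A quasi-triangle has a single boundary segment, which cannot both precede and follow an arc. So
the triangle is uncut and its two other sides are boundary segments. -/
theorem isBoundary_of_noIn_noOut {s h : T.Tri × Fin 3} (h₁ : K.polygons.NoIn (K.inl s))
    (h₂ : K.polygons.NoOut (K.inl s)) (hs : h.1 = s.1) : T.IsBoundary h ∨ h = s := by
  rw [noIn_inl_iff] at h₁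
  rw [noOut_inl_iff] at h₂
  rcases h₁ with h₁ | ⟨b, hb, rfl⟩
  · rcases h₂ with h₂ | h₂
    · exact absurd h₂ (nxt_notMem h₁)
    · exact absurd h₂ (not_isBoundary_of_mem h₁ rfl)
  · rcases h₂ with h₂ | h₂
    · exact absurd h₂ (notMem_of_isBoundary hb rfl)
    · rcases eq_or_eq_nxt (T := T) (s := h) (h := b) hs with rfl | rfl | rfl
      · exact Or.inl hb
      · exact Or.inr rfl
      · exact Or.inl h₂

theorem exists_run {e : K.polygons.Side} (he : ¬ K.polygons.IsBoundary e)
    (ho : K.polygons.NoOut e) : ∃ t l j, K.polygons.Entry t ∧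
      (K.polygons.step id)^[l] t = e ∧
      (∀ i ≤ l, ¬ K.polygons.IsBoundary ((K.polygons.step id)^[i] t)) ∧
      (∀ i ≤ j, K.polygons.IsBoundary ((K.polygons.step id)^[i + 1] e)) ∧
      (K.polygons.step id)^[j + 2] e = t := by
  have hstep : K.polygons.step id = K.polygons.next := rfl
  rw [hstep]
  rcases side_cases e with ⟨x, rfl⟩ | ⟨c, hc, rfl⟩
  swap
  · exact absurd (isBoundary_inr hc) he
  rw [isBoundary_inl] at he
  rw [noOut_inl_iff] at ho
  rcases ho with ho | ho
  · have e₁ := next_inl_of_notMem (nxt_notMem ho)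
    have e₂ := next_inl_of_notMem (nxt_nxt_notMem ho)
    rw [nxt_nxt_nxt] at e₂
    have e₃ := next_inl_of_mem ho
    -- Quasi-triangle: three arc sides from the cut corner to `x`, then the new segment alone.
    refine ⟨K.inl (T.nxt x), 2, 0, entry_inl_iff.2 (Or.inl ho), ?_, ?_, ?_, ?_⟩
    · change K.polygons.next (K.polygons.next _) = _
      rw [e₁, e₂]
    · intro i hi
      interval_cases i
      · exact isBoundary_inl.not.2 (not_isBoundary_of_mem ho rfl)
      · change ¬ K.polygons.IsBoundary (K.polygons.next _)
        rw [e₁]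
        exact isBoundary_inl.not.2 (not_isBoundary_of_mem ho rfl)
      · change ¬ K.polygons.IsBoundary (K.polygons.next (K.polygons.next _))
        rw [e₁, e₂]
        exact fun h => he (isBoundary_inl.1 h)
    · intro i hi
      interval_cases i
      change K.polygons.IsBoundary (K.polygons.next _)
      rw [e₃]
      exact isBoundary_inr ho
    · change K.polygons.next (K.polygons.next _) = _
      rw [e₃, next_inr]
  · have hK : ∀ s : T.Tri × Fin 3, s.1 = x.1 → s ∉ K.corners := fun s hs =>
      notMem_of_isBoundary ho hs
    have e₁ := next_inl_of_notMem (hK (T.nxt x) rfl)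
    have e₂ := next_inl_of_notMem (hK (T.nxt (T.nxt x)) rfl)
    have e₃ := next_inl_of_notMem (hK (T.nxt (T.nxt (T.nxt x))) rfl)
    rw [nxt_nxt_nxt] at e₃
    by_cases hb : T.IsBoundary (T.nxt (T.nxt x))
    -- Triangle with two boundary segments: `x` is its own entry, and `j = 1` records two segments.
    · refine ⟨K.inl x, 0, 1, entry_inl_iff.2 (Or.inr ⟨he, _, hb, nxt_nxt_nxt x⟩), rfl, ?_, ?_, ?_⟩
      · intro i hi
        interval_cases i
        exact fun h => he (isBoundary_inl.1 h)
      · intro i hi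
        interval_cases i
        · change K.polygons.IsBoundary (K.polygons.next _)
          rw [e₁]
          exact isBoundary_inl.2 ho
        · change K.polygons.IsBoundary (K.polygons.next (K.polygons.next _))
          rw [e₁, e₂]
          exact isBoundary_inl.2 hb
      · change K.polygons.next (K.polygons.next (K.polygons.next _)) = _
        rw [e₁, e₂, e₃]
    -- Triangle with one boundary segment: the two arc sides form the run.
    · refine ⟨K.inl (T.nxt (T.nxt x)), 1, 0, entry_inl_iff.2 (Or.inr ⟨hb, _, ho, rfl⟩), e₃,
        ?_, ?_, ?_⟩
      · intro i hi
        interval_cases i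
        · exact fun h => hb ((isBoundary_inl (s := T.nxt (T.nxt x))).1 h)
        · change ¬ K.polygons.IsBoundary (K.polygons.next _)
          rw [e₃]
          exact fun h => he (isBoundary_inl.1 h)
      · intro i hi
        interval_cases i
        change K.polygons.IsBoundary (K.polygons.next _)
        rw [e₁]
        exact isBoundary_inl.2 ho
      · change K.polygons.next (K.polygons.next _) = _
        rw [e₁, e₂]

theorem isRegular [T2Space S] [ConnectedSpace S] (hT : 2 ≤ Nat.card T.polygons.Arc) :
    K.polygons.IsRegular where
  bijective := next_bijective
  not_isolated x hx := by
    rcases side_cases x with ⟨s, rfl⟩ | ⟨c, hc, rfl⟩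
    · rw [glue_inl]
      rintro ⟨h₁, h₂, h₃, h₄⟩
      exact TriangulatedSurface.not_isolated hT (s := s)
        (fun _ => isBoundary_of_noIn_noOut h₁ h₂) fun _ => isBoundary_of_noIn_noOut h₃ h₄
    · exact absurd (isBoundary_inr hc) hx
  exists_isBoundary := exists_isBoundary_rho
  exists_run _ he ho := exists_run he ho

theorem forbiddenLength_of_mem {s : T.Tri × Fin 3} (hs : s ∈ K.corners) :
    K.polygons.forbiddenLength (K.inl s) = 2 := by
  have e₁ := next_inl_of_notMem (nxt_notMem hs)
  have e₂ := next_inl_of_notMem (nxt_nxt_notMem hs)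
  have hs' : T.nxt (T.nxt (T.nxt s)) ∈ K.corners := by rwa [nxt_nxt_nxt]
  have e₃ := next_inl_of_mem hs'
  refine PolygonGluing.forbiddenLength_eq ?_ fun i hi => ?_
  · change K.polygons.IsBoundary (K.polygons.next (K.polygons.next (K.polygons.next (K.inl _))))
    rw [e₁, e₂, e₃]
    exact isBoundary_inr hs'
  · interval_cases i
    · change ¬ K.polygons.IsBoundary (K.polygons.next (K.inl _))
      rw [e₁]
      exact isBoundary_inl.not.2 (not_isBoundary_of_mem hs rfl)
    · change ¬ K.polygons.IsBoundary (K.polygons.next (K.polygons.next (K.inl _)))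
      rw [e₁, e₂]
      exact isBoundary_inl.not.2 (not_isBoundary_of_mem hs rfl)

open Classical in
theorem forbiddenLength_of_isEntry {s : T.Tri × Fin 3} (hs : T.IsEntry s) :
    K.polygons.forbiddenLength (K.inl s) = if T.IsBoundary (T.nxt s) then 0 else 1 := by
  obtain ⟨-, b, hb, rfl⟩ := hs
  have hK : ∀ s : T.Tri × Fin 3, s.1 = b.1 → s ∉ K.corners := fun s hs =>
    notMem_of_isBoundary hb hs
  have e₁ := next_inl_of_notMem (hK (T.nxt (T.nxt b)) rfl)
  have e₂ := next_inl_of_notMem (hK (T.nxt (T.nxt (T.nxt b))) rfl)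
  rw [nxt_nxt_nxt] at e₂
  split_ifs with h
  · refine PolygonGluing.forbiddenLength_eq ?_ fun i hi => absurd hi (Nat.not_lt_zero _)
    change K.polygons.IsBoundary (K.polygons.next (K.inl _))
    rw [e₁]
    exact isBoundary_inl.2 h
  · refine PolygonGluing.forbiddenLength_eq ?_ fun i hi => ?_
    · change K.polygons.IsBoundary (K.polygons.next (K.polygons.next (K.inl _)))
      rw [e₁, e₂]
      exact isBoundary_inl.2 hb
    · interval_cases i
      change ¬ K.polygons.IsBoundary (K.polygons.next (K.inl _))
      rw [e₁]
      exact fun h' => h (isBoundary_inl.1 h')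

theorem numCutsOn_eq_ncard (C : T.BoundaryComponent) :
    K.numCutsOn C = {s | s ∈ K.corners ∧ T.component s = C}.ncard := by
  simp only [numCutsOn, on_start_iff]

theorem setOf_entry_eq (C : T.BoundaryComponent) :
    {x | K.polygons.Entry x ∧ K.component x = C} =
      K.inl '' ({s | T.IsEntry s ∧ T.component s = C} ∪
        {s | s ∈ K.corners ∧ T.component s = C}) := by
  ext x
  constructor
  · rintro ⟨hx, hC⟩
    rcases side_cases x with ⟨s, rfl⟩ | ⟨c, hc, rfl⟩
    · refine ⟨s, ?_, rfl⟩
      rcases entry_inl_iff.1 hx with h | h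
      · exact Or.inr ⟨h, hC⟩
      · exact Or.inl ⟨h, hC⟩
    · exact absurd hx (not_entry_inr hc)
  · rintro ⟨s, ⟨h, hC⟩ | ⟨h, hC⟩, rfl⟩
    · exact ⟨entry_inl_iff.2 (Or.inr h), hC⟩
    · exact ⟨entry_inl_iff.2 (Or.inl h), hC⟩

theorem disjoint_isEntry_corners (C : T.BoundaryComponent) :
    Disjoint {s | T.IsEntry s ∧ T.component s = C} {s | s ∈ K.corners ∧ T.component s = C} :=
  Set.disjoint_left.2 fun _ h h' => notMem_of_isEntry h.1 h'.1

theorem ncard_entry_eq (C : T.BoundaryComponent) :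
    {x | K.polygons.Entry x ∧ K.component x = C}.ncard = T.n C + K.numCutsOn C := by
  rw [setOf_entry_eq, Set.ncard_image_of_injective _ inl_injective,
    Set.ncard_union_eq (disjoint_isEntry_corners C), n_eq_ncard, numCutsOn_eq_ncard]

/-- Old entries contribute one exactly when their triangle has a single boundary segment, which
`m_eq_ncard` counts; each cut corner contributes the two arrows of its quasi-triangle. -/
theorem sum_forbiddenLength_eq (C : T.BoundaryComponent) :
    ∑ x ∈ (Set.toFinite {x | K.polygons.Entry x ∧ K.component x = C}).toFinset,
      K.polygons.forbiddenLength x = T.m C + 2 * K.numCutsOn C := by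
  classical
  have h : (Set.toFinite {x | K.polygons.Entry x ∧ K.component x = C}).toFinset =
      ((Set.toFinite {s | T.IsEntry s ∧ T.component s = C}).toFinset ∪
        (Set.toFinite {s | s ∈ K.corners ∧ T.component s = C}).toFinset).image K.inl := by
    ext x
    rw [Set.Finite.mem_toFinset, setOf_entry_eq]
    simp only [Set.mem_image, Set.mem_union, Finset.mem_image, Finset.mem_union,
      Set.Finite.mem_toFinset]
  rw [h, Finset.sum_image inl_injective.injOn, Finset.sum_union]
  · congr 1
    · rw [Finset.sum_congr rfl fun s hs =>
        forbiddenLength_of_isEntry (K := K) ((Set.Finite.mem_toFinset _).1 hs).1, m_eq_ncard,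
        Finset.sum_ite, Finset.sum_const_zero, zero_add, Finset.sum_const, smul_eq_mul, mul_one,
        ← Set.ncard_coe_finset]
      congr 1
      ext s
      simp
    · rw [Finset.sum_congr rfl fun s hs =>
        forbiddenLength_of_mem (K := K) ((Set.Finite.mem_toFinset _).1 hs).1,
        Finset.sum_const, smul_eq_mul, mul_comm, numCutsOn_eq_ncard, Set.ncard_eq_toFinset_card]
  · rw [Finset.disjoint_left]
    intro s hs hs'
    exact notMem_of_isEntry ((Set.Finite.mem_toFinset _).1 hs).1
      ((Set.Finite.mem_toFinset _).1 hs').1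

end Cut

end TriangulatedSurface

/-! ### Cycles of relations, and assembly of the invariant. -/

namespace TriangulatedSurface

variable {S : Type*} [TopologicalSpace S] {T : TriangulatedSurface S}

namespace Cut

open BoundQuiver PolygonGluing

variable {K : T.Cut} (k : Type*) [Field k]

theorem Arrow.exists_side_eq (a : K.polygons.Arrow) : ∃ s, a.side = K.inl s := by
  rcases side_cases a.side with h | ⟨c, hc, h⟩
  · exact h
  · exact absurd (h ▸ isBoundary_inr hc) a.not_isBoundary

theorem Arrow.nxt_notMem {a : K.polygons.Arrow} {s : T.Tri × Fin 3} (ha : a.side = K.inl s) :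
    T.nxt s ∉ K.corners ∧ K.polygons.next a.side = K.inl (T.nxt s) := by
  by_cases h : T.nxt s ∈ K.corners
  · have := a.not_isBoundary_next
    rw [ha, next_inl_of_mem h] at this
    exact absurd (isBoundary_inr h) this
  · exact ⟨h, by rw [ha, next_inl_of_notMem h]⟩

theorem side_eq_of_rel {a b : K.polygons.Arrow} {s : T.Tri × Fin 3} (ha : a.side = K.inl s)
    (h : (K.polygons.boundQuiver k).Rel a b) : b.side = K.inl (T.nxt s) := by
  rw [(rel_iff k a b).1 h, (Arrow.nxt_notMem ha).2]

/-- The arrow of an uncut internal triangle that starts at its side `i`. -/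
def triangleArrow {t : T.Tri} (ht : t ∈ K.internalTriangles) (i : Fin 3) : K.polygons.Arrow :=
  ⟨K.inl (t, i), isBoundary_inl.not.2 (ht.1 i), by
    rw [next_inl_of_notMem (s := (t, i)) (ht.2 _)]
    exact isBoundary_inl.not.2 (ht.1 _)⟩

theorem triangleArrow_side {t : T.Tri} (ht : t ∈ K.internalTriangles) (i : Fin 3) :
    (triangleArrow ht i).side = K.inl (t, i) := rfl

theorem rel_triangleArrow {t : T.Tri} (ht : t ∈ K.internalTriangles) (i : Fin 3) :
    (K.polygons.boundQuiver k).Rel (triangleArrow ht i) (triangleArrow ht (i + 1)) := by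
  rw [rel_iff, triangleArrow_side, triangleArrow_side,
    next_inl_of_notMem (s := (t, i)) (ht.2 _)]
  rfl

theorem triangleArrow_injective {t : T.Tri} (ht : t ∈ K.internalTriangles) :
    Function.Injective (triangleArrow ht) := fun i j h => by
  have h' : K.inl (t, i) = K.inl (t, j) := congrArg Arrow.side h
  exact congrArg Prod.snd (inl_injective h')

/-- The zero cycle of an uncut internal triangle. -/
def triangleCycle {t : T.Tri} (ht : t ∈ K.internalTriangles) : Cycle K.polygons.Arrow :=
  ↑[triangleArrow ht 0, triangleArrow ht 1, triangleArrow ht 2]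

theorem cycle_rotate {α : Type*} (a b c : α) : ([a, b, c] : Cycle α) = [b, c, a] :=
  Cycle.coe_eq_coe.2 ⟨1, rfl⟩

theorem eq_triangleCycle {t : T.Tri} (ht : t ∈ K.internalTriangles) (i : Fin 3) :
    ([triangleArrow ht i, triangleArrow ht (i + 1), triangleArrow ht (i + 1 + 1)] :
      Cycle K.polygons.Arrow) = triangleCycle ht := by
  fin_cases i
  · rfl
  · exact (cycle_rotate _ _ _).symm.trans (by rfl)
  · exact (cycle_rotate _ _ _).trans (by rfl)

theorem isZeroCycle_triangleCycle {t : T.Tri} (ht : t ∈ K.internalTriangles) :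
    IsZeroCycle (B := K.polygons.boundQuiver k) (triangleCycle ht) := by
  refine ⟨?_, ?_, ?_⟩
  · exact fun h => List.cons_ne_nil _ _ ((Cycle.coe_eq_nil _).1 h)
  · refine Cycle.nodup_coe_iff.2 ?_
    have : [triangleArrow ht 0, triangleArrow ht 1, triangleArrow ht 2] =
      [0, 1, 2].map (triangleArrow ht) := rfl
    rw [this]
    exact List.Nodup.map (triangleArrow_injective ht) (by decide)
  · refine (Cycle.chain_coe_cons _ _ _).2 ?_
    have h0 := rel_triangleArrow k ht 0
    have h1 := rel_triangleArrow k ht 1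
    have h2 := rel_triangleArrow k ht 2
    exact List.isChain_cons_cons.2 ⟨h0, List.isChain_cons_cons.2 ⟨h1,
      List.isChain_cons_cons.2 ⟨h2, List.isChain_singleton _⟩⟩⟩

/-- A relation moves on to the next side of the same triangle, and `nxt` has order three without
shorter returns. Closing up after one or two arrows is thus impossible, and a fourth arrow would
repeat the first. Three arrows pass all three corners, so none of them is cut and all sides are
arcs. -/
theorem exists_eq_triangleCycle {c : Cycle K.polygons.Arrow}
    (hc : IsZeroCycle (B := K.polygons.boundQuiver k) c) :
    ∃ t, ∃ ht : t ∈ K.internalTriangles, triangleCycle ht = c := by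
  obtain ⟨hne, hnd, hch⟩ := hc
  induction c using Quot.inductionOn with
  | _ l =>
    cases l with
    | nil => exact absurd rfl hne
    | cons a l =>
      replace hnd : (a :: l).Nodup := Cycle.nodup_coe_iff.1 hnd
      replace hch : List.IsChain (K.polygons.boundQuiver k).Rel (a :: (l ++ [a])) :=
        (Cycle.chain_coe_cons _ _ _).1 hch
      obtain ⟨s, hs⟩ := Arrow.exists_side_eq a
      have hn := (Arrow.nxt_notMem hs).1
      match l, hnd, hch with
      | [], hnd, hch =>
        have := side_eq_of_rel k hs (List.isChain_cons_cons.1 hch).1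
        exact absurd (inl_injective (this.symm.trans hs)) (nxt_ne s)
      | [b], hnd, hch =>
        obtain ⟨h₁, hch⟩ := List.isChain_cons_cons.1 hch
        have hb := side_eq_of_rel k hs h₁
        have := side_eq_of_rel k hb (List.isChain_cons_cons.1 hch).1
        exact absurd (inl_injective (this.symm.trans hs)) (nxt_nxt_ne s)
      | [b, c], hnd, hch =>
        obtain ⟨h₁, hch⟩ := List.isChain_cons_cons.1 hch
        obtain ⟨h₂, hch⟩ := List.isChain_cons_cons.1 hch
        have hb := side_eq_of_rel k hs h₁
        have hc := side_eq_of_rel k hb h₂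
        have hb' := (Arrow.nxt_notMem hb).1
        have hc' := (Arrow.nxt_notMem hc).1
        have ht : s.1 ∈ K.internalTriangles := by
          refine ⟨fun i hi => ?_, fun i hi => ?_⟩
          · rcases eq_or_eq_nxt (T := T) (s := (s.1, i)) (h := s) rfl with h | h | h
            · exact a.not_isBoundary (hs ▸ isBoundary_inl.2 (h ▸ hi))
            · exact b.not_isBoundary (hb ▸ isBoundary_inl.2 (h ▸ hi))
            · exact c.not_isBoundary (hc ▸ isBoundary_inl.2 (h ▸ hi))
          · rw [nxt_nxt_nxt] at hc'
            rcases eq_or_eq_nxt (T := T) (s := (s.1, i)) (h := s) rfl with h | h | h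
            · exact hc' (h ▸ hi)
            · exact hn (h ▸ hi)
            · exact hb' (h ▸ hi)
        refine ⟨s.1, ht, (eq_triangleCycle ht s.2).symm.trans ?_⟩
        rw [show triangleArrow ht s.2 = a from Arrow.ext_side hs.symm,
          show triangleArrow ht (s.2 + 1) = b from Arrow.ext_side hb.symm,
          show triangleArrow ht (s.2 + 1 + 1) = c from Arrow.ext_side hc.symm]
        rfl
      | b :: c :: d :: l, hnd, hch =>
        obtain ⟨h₁, hch⟩ := List.isChain_cons_cons.1 hch
        obtain ⟨h₂, hch⟩ := List.isChain_cons_cons.1 hch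
        obtain ⟨h₃, hch⟩ := List.isChain_cons_cons.1 hch
        have hd := side_eq_of_rel k (side_eq_of_rel k (side_eq_of_rel k hs h₁) h₂) h₃
        rw [nxt_nxt_nxt] at hd
        have had : a = d := Arrow.ext_side (hs.trans hd.symm)
        exact absurd (by rw [had]; simp) (List.nodup_cons.1 hnd).1

theorem isZeroCycle_length {c : Cycle K.polygons.Arrow}
    (hc : IsZeroCycle (B := K.polygons.boundQuiver k) c) : c.length = 3 := by
  obtain ⟨t, ht, rfl⟩ := exists_eq_triangleCycle k hc
  rfl

variable {k}

theorem AG_zero_three (σ ε : K.polygons.Arrow → ℤˣ) :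
    AG (B := K.polygons.boundQuiver k) σ ε 0 3 = K.internalTriangles.ncard := by
  refine (if_pos rfl).trans (Set.ncard_congr (fun t ht => triangleCycle ht) ?_ ?_ ?_).symm
  · exact fun t ht => ⟨isZeroCycle_triangleCycle k ht, rfl⟩
  · intro t t' ht ht' h
    -- Any single arrow of the cycle remembers its triangle, whatever the rotation.
    have hmem : triangleArrow ht 0 ∈ triangleCycle ht := Cycle.mem_coe_iff.2 (by simp)
    change triangleCycle ht = triangleCycle ht' at h
    rw [h] at hmem
    have : ∃ i, triangleArrow ht 0 = triangleArrow ht' i := by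
      have := Cycle.mem_coe_iff.1 hmem
      simp only [List.mem_cons, List.not_mem_nil, or_false] at this
      rcases this with h | h | h <;> exact ⟨_, h⟩
    obtain ⟨i, hi⟩ := this
    exact congrArg Prod.fst (inl_injective (congrArg Arrow.side hi))
  · rintro c ⟨hc, -⟩
    exact exists_eq_triangleCycle k hc

theorem AG_zero_of_ne (σ ε : K.polygons.Arrow → ℤˣ) {m : ℕ} (hm : m ≠ 3) :
    AG (B := K.polygons.boundQuiver k) σ ε 0 m = 0 := by
  refine (if_pos rfl).trans ?_
  refine (congrArg Set.ncard (Set.eq_empty_iff_forall_notMem.2 ?_)).trans (Set.ncard_empty _)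
  exact fun c hc => hm (hc.2.symm.trans (isZeroCycle_length k hc.1))

theorem AG_of_ne_zero [T2Space S] [ConnectedSpace S] (hT : 2 ≤ Nat.card T.polygons.Arc)
    {σ ε : K.polygons.Arrow → ℤˣ} (hσ : (K.polygons.boundQuiver k).IsSignPair σ ε)
    {n m : ℕ} (hn : n ≠ 0) : AG (B := K.polygons.boundQuiver k) σ ε n m =
      {C : T.BoundaryComponent |
        n = T.n C + K.numCutsOn C ∧ m = T.m C + 2 * K.numCutsOn C}.ncard := by
  rw [(isRegular hT).AG_eq_ncard hσ K.component component_eq_iff (fun C => ?_) hn]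
  · simp only [ncard_entry_eq, sum_forbiddenLength_eq]
  · obtain ⟨s, hs, hC⟩ := exists_isEntry_component_eq hT C
    exact ⟨K.inl s, entry_inl_iff.2 (Or.inr hs), hC⟩

end Cut

end TriangulatedSurface

end

end SurfaceAlgebra


theorem mainTheorem3 {k : Type*} [Field k] {S : Type*} [TopologicalSpace S] [T2Space S]
    [ConnectedSpace S] (T : SurfaceAlgebra.TriangulatedSurface S)
    (hT : 2 ≤ Nat.card T.polygons.Arc) (K : T.Cut) :
    (∃ σ ε, (K.surfaceAlgebra k).IsSignPair σ ε) ∧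
    ∀ σ ε, (K.surfaceAlgebra k).IsSignPair σ ε →
      SurfaceAlgebra.BoundQuiver.AG σ ε 0 3 = K.internalTriangles.ncard ∧
      (∀ m, m ≠ 3 → SurfaceAlgebra.BoundQuiver.AG σ ε 0 m = 0) ∧
      ∀ n m, n ≠ 0 → SurfaceAlgebra.BoundQuiver.AG σ ε n m =
        {C : T.BoundaryComponent |
          n = T.n C + K.numCutsOn C ∧ m = T.m C + 2 * K.numCutsOn C}.ncard :=
  ⟨SurfaceAlgebra.PolygonGluing.exists_isSignPair k
      SurfaceAlgebra.TriangulatedSurface.Cut.next_bijective, fun σ ε hσ =>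
    ⟨SurfaceAlgebra.TriangulatedSurface.Cut.AG_zero_three σ ε,
      fun _ hm => SurfaceAlgebra.TriangulatedSurface.Cut.AG_zero_of_ne σ ε hm,
      fun _ _ hn => SurfaceAlgebra.TriangulatedSurface.Cut.AG_of_ne_zero hT hσ hn⟩⟩
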